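/- For a finite tree $T$ all of whose vertices have valency $1$ or $3$, let $B(T)$ be its set of endpoints with the relation $R(a,b,c,d)$: $a,b,c,d$ are pairwise different and the arcs $ab$ and $cd$ of $T$ are disjoint. \emph{Boron trees} are the structures isomorphic to some $(B(T),R)$, together with the one-point structure (with $R$ empty). Let $T_n$ be the graph whose vertices are the non-empty binary sequences of length $<n$, with edges between $s$ and $si$ ($i=0,1$) and an edge between $0$ and $1$, and let $B_n=B(T_n)$. An \emph{ordered boron tree} is a structure $(A,R,S,\leq_{lex})$ such that $(A,R)$ is a boron tree and, for some $n$ and some embedding $\phi$ of $(A,R)$ into $B_n$, the relation $\leq_{lex}$ is induced via $\phi$ by the lexicographical order of $B_n$, and $S(a,b,c)$ holds iff $\phi(a),\phi(b)<_{lex}\phi(c)$ and the longest common initial segment of $\phi(a),\phi(b)$ is longer than that of $\phi(b),\phi(c)$. Let $\mathcal{SB}$ be the class of ordered boron trees. Let $\mathcal{SB}_1$ be the class of pairs $(A,p)$, where $A\in\mathcal{SB}$ and $p$ is a partial automorphism of $A$ (an isomorphism between two substructures of $A$); an embedding $(A,p)\to(B,q)$ is an embedding $\phi\colon A\to B$ such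 that for all $x\in\mathrm{dom}(p)$ we have $\phi(x)\in\mathrm{dom}(q)$ and $q(\phi(x))=\phi(p(x))$. A class has the \emph{cofinal amalgamation property} (CAP) if it has a subclass $\mathcal{C}$ such that every member of the class embeds into a member of $\mathcal{C}$ and $\mathcal{C}$ has the amalgamation property. \textbf{Theorem.} The class $\mathcal{SB}_1$ has CAP. Moreover, the universal ordered boron tree exists, i.e. there is a countable ultrahomogeneous structure $M$ whose non-empty finite substructures are, up to isomorphism, exactly the members of $\mathcal{SB}$ (the Fra\"{\i}ss\'e limit of $\mathcal{SB}$); and for every such $M$ the group $\mathrm{Aut}(M)$, with the topology inherited from $M^M$ ($M$ discrete), has a comeager conjugacy class. -/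

import Mathlib

open FirstOrder CategoryTheory

namespace OrderedBoron

/-! ### Boron trees -/

/-- The class of finite graph-theoretic trees in which every vertex has valency `1` or `3`
(finiteness is required where the class is used). -/
def IsBoronGraph {V : Type} (T : SimpleGraph V) : Prop :=
  T.IsTree ∧ ∀ v, (T.neighborSet v).ncard = 1 ∨ (T.neighborSet v).ncard = 3

/-- The set of endpoints of a graph: its vertices of valency `1`. -/
def endpoints {V : Type} (T : SimpleGraph V) : Set V :=
  {v | (T.neighborSet v).ncard = 1}

/-- `ab|cd`: the arc from `a` to `b` and the arc from `c` to `d` do not intersect. -/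
def ArcsDisjoint {V : Type} (T : SimpleGraph V) (a b c d : V) : Prop :=
  ∃ (p : T.Walk a b) (q : T.Walk c d), p.IsPath ∧ q.IsPath ∧ ∀ v, ¬ (v ∈ p.support ∧ v ∈ q.support)

/-- The relation `R` of the structure `B(T)`: `a, b, c, d` are pairwise different and `ab|cd`. -/
def Quartet {V : Type} (T : SimpleGraph V) (a b c d : V) : Prop :=
  [a, b, c, d].Nodup ∧ ArcsDisjoint T a b c d

/-- `(A, R)` is a boron tree: it is isomorphic to `B(T)` for a finite tree `T` with all valencies
`1` or `3`, or it is the one-point structure. -/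
def IsBoronTree {A : Type} (R : A → A → A → A → Prop) : Prop :=
  (∃ (V : Type) (T : SimpleGraph V), Finite V ∧ IsBoronGraph T ∧
    ∃ e : A ≃ endpoints T, ∀ a b c d, R a b c d ↔ Quartet T (e a) (e b) (e c) (e d)) ∨
  (Nonempty (Unique A) ∧ ∀ a b c d, ¬ R a b c d)

/-! ### The trees `T_n` of binary sequences -/

/-- The vertices of `T_n`: the nonempty binary sequences of length `< n`. -/
abbrev BinVertex (n : ℕ) : Type := {s : List Bool // s ≠ [] ∧ s.length < n}

/-- The graph `T_n`: `s` is joined to `s0` and `s1`, and (the root `∅` having been removed) the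
vertices `0` and `1` are joined to each other. -/
def binTree (n : ℕ) : SimpleGraph (BinVertex n) :=
  SimpleGraph.fromRel fun s t =>
    (∃ i : Bool, t.1 = s.1 ++ [i]) ∨ (s.1 = [false] ∧ t.1 = [true])

/-- The strict lexicographical order on binary sequences of the same length: at the first place
where they differ, `s` has a `0` and `t` has a `1`. -/
def LexLT (s t : List Bool) : Prop :=
  ∃ r u v : List Bool, s = r ++ false :: u ∧ t = r ++ true :: v

/-- The meet of two binary sequences: their longest common initial segment. -/
def meet : List Bool → List Bool → List Bool
  | a :: s, b :: t => if a = b then a :: meet s t else []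
  | _, _ => []

/-! ### Ordered boron trees -/

/-- The relation symbols: `R` (quaternary), `S` (ternary) and `≤_lex` (binary). -/
inductive Symb : ℕ → Type
  | quartet : Symb 4
  | split : Symb 3
  | le : Symb 2

/-- The relational signature of ordered boron trees. -/
def L : FirstOrder.Language.{0, 0} := ⟨fun _ => Empty, Symb⟩

instance : L.IsRelational := fun _ => (inferInstance : IsEmpty Empty)

instance : Countable (Σ n, L.Functions n) := (inferInstance : Countable (Σ _ : ℕ, Empty))

section
variable (A : Type) [L.Structure A]

/-- The relation `R` of a structure. -/
def RR (a b c d : A) : Prop :=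
  FirstOrder.Language.Structure.RelMap (L := L) (M := A) (n := 4) Symb.quartet ![a, b, c, d]

/-- The relation `S` of a structure. -/
def SS (a b c : A) : Prop :=
  FirstOrder.Language.Structure.RelMap (L := L) (M := A) (n := 3) Symb.split ![a, b, c]

/-- The relation `≤_lex` of a structure. -/
def LexLE (a b : A) : Prop :=
  FirstOrder.Language.Structure.RelMap (L := L) (M := A) (n := 2) Symb.le ![a, b]

/-- `(A, R, S, ≤_lex)` is an ordered boron tree: `(A, R)` is a boron tree, and for some embedding
`φ` of `(A, R)` into some `B_n = B(T_n)`, the relation `≤_lex` is inherited from the lexicographical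
order, and `S(a, b, c)` holds iff `φ a, φ b <_lex φ c` and the meet of `φ a, φ b` is longer than the
meet of `φ b, φ c`. -/
def IsOrderedBoronTree : Prop :=
  IsBoronTree (RR A) ∧
  ∃ (n : ℕ) (φ : A → endpoints (binTree n)), Function.Injective φ ∧
    (∀ a b c d, RR A a b c d ↔ Quartet (binTree n) (φ a) (φ b) (φ c) (φ d)) ∧
    (∀ a b, LexLE A a b ↔ (φ a = φ b ∨ LexLT (φ a).1.1 (φ b).1.1)) ∧
    (∀ a b c, SS A a b c ↔
      LexLT (φ a).1.1 (φ c).1.1 ∧ LexLT (φ b).1.1 (φ c).1.1 ∧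
        (meet (φ b).1.1 (φ c).1.1).length < (meet (φ a).1.1 (φ b).1.1).length)

end

/-- The class `SB` of ordered boron trees. -/
def SB : Set (Bundled.{0} L.Structure) := {A | IsOrderedBoronTree A}

/-- `M` is the universal ordered boron tree: it is countable and it is the Fraïssé limit of `SB`,
that is, it is ultrahomogeneous and its nonempty finite substructures are, up to isomorphism,
exactly the members of `SB`. (The age in Mathlib's sense also contains the empty structure, which is
not a boron tree.) -/
def IsUniversalOrderedBoronTree (M : Type) [L.Structure M] : Prop :=
  ∃ _ : Countable M, L.IsFraisseLimit ({A : Bundled.{0} L.Structure | IsEmpty A} ∪ SB) M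

/-! ### Classes of partial automorphisms -/

/-- A pair `(A, p)`, where `p` is a partial automorphism of the structure `A`, that is, an
isomorphism between two substructures of `A`. -/
structure PartialAut (L : FirstOrder.Language.{0, 0}) where
  carrier : Bundled.{0} L.Structure
  p : carrier ≃ₚ[L] carrier

/-- An embedding `(A, p) → (B, q)`: an embedding `φ : A → B` such that `φ ∘ p = q ∘ φ` on the domain
of `p`; in other words, `q` extends the copy of `p`. -/
structure PartialAut.Emb {L : FirstOrder.Language.{0, 0}} (X Y : PartialAut L) where
  toEmbedding : X.carrier ↪[L] Y.carrier
  map_dom : ∀ x : X.p.dom, toEmbedding x ∈ Y.p.dom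
  comm : ∀ x : X.p.dom,
    toEmbedding (X.p.toEquiv x) = Y.p.toEquiv ⟨toEmbedding x, map_dom x⟩

/-- The class `F_1` of all `(A, p)` with `A ∈ F` and `p` a partial automorphism of `A`. -/
def partialAuts {L : FirstOrder.Language.{0, 0}} (F : Set (Bundled.{0} L.Structure)) : Set (PartialAut L) :=
  {X | X.carrier ∈ F}

/-- The amalgamation property. -/
def HasAP {L : FirstOrder.Language.{0, 0}} (F : Set (PartialAut L)) : Prop :=
  ∀ A ∈ F, ∀ B ∈ F, ∀ C ∈ F, ∀ (α : A.Emb B) (β : A.Emb C),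
    ∃ D ∈ F, ∃ (γ : B.Emb D) (δ : C.Emb D),
      ∀ x : A.carrier, γ.toEmbedding (α.toEmbedding x) = δ.toEmbedding (β.toEmbedding x)

/-- The cofinal amalgamation property: some cofinal subclass has the amalgamation property. -/
def HasCAP {L : FirstOrder.Language.{0, 0}} (F : Set (PartialAut L)) : Prop :=
  ∃ F' ⊆ F, (∀ A ∈ F, ∃ B ∈ F', Nonempty (A.Emb B)) ∧ HasAP F'

/-! ### Automorphism groups -/

/-- The topology on `Aut(M)` inherited from the product `M^M`, where `M` is discrete. -/
abbrev autTopology (L : FirstOrder.Language.{0, 0}) (M : Type) [L.Structure M] : TopologicalSpace (M ≃[L] M) :=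
  TopologicalSpace.induced (fun g : M ≃[L] M => (g : M → M))
    (@Pi.topologicalSpace M (fun _ => M) fun _ => ⊥)

/-- Some conjugacy class `{h g h⁻¹ : h ∈ Aut(M)}` is comeager in `Aut(M)`. -/
def HasComeagerConjugacyClass (L : FirstOrder.Language.{0, 0}) (M : Type) [L.Structure M] : Prop :=
  ∃ g : M ≃[L] M,
    {f : M ≃[L] M | ∃ h : M ≃[L] M, f = h.comp (g.comp h.symm)} ∈
      @residual (M ≃[L] M) (autTopology L M)

end OrderedBoron

/-! Write T x y z when the meet of x and y is strictly longer than the meet of x and z. In a binary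
tree, R and S can be expressed by T and the lexicographical order, and T can be recovered from S and
the order. Hence ordered boron trees are exactly the finite nonempty structures described by an
order and a relation T satisfying the axioms of `OBT` (`isOrderedBoronTree_iff`), and the argument
takes place among these.

For a fixed point a, the relation T a is a strict weak order: it compares the places where points
leave the branch to a (above means nearer to the root). These weak orders and the sides on which
points leave determine T and the order, except on points leaving at one common place. This yields a
canonical amalgam of B and C over a common part I (`AmalgData.amalg`): along the branch to each
common point, the two weak orders are merged, with points of B placed above points of C where no
common point decides. The result does not depend on the common point used as base, and nearest
common points supply enough bases to verify the axioms. Since no choice is made, a pair of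
automorphisms of B and C with the same action on I acts on the amalgam. This matters because I will
be a union of infinite orbits.

The universal tree is built explicitly from finite subsets of a coloured dense order; one-point
extensions are realized by changing membership at a single place. Inside it, every finite partial
automorphism extends to an automorphism. Call g good for finite sets B, D (`Good`) if its
restriction to D determines all relations within the orbits of B and every point has a nearest point
in these orbits. Two automorphisms extending a good restriction can be amalgamated over B by the
canonical amalgam over the orbits (`Good.amalg`).

Good restrictions are cofinal (`exists_good`). If a is moved, then under g or its inverse the points
of its orbit branch off from each other deeper and deeper; far along the orbit, consecutive points
look alike from any given finite set, so g can be changed to fix one of them without changing it on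
that set (`exists_fixed_of_deepening`). Seen from such a fixed point the orbit is strictly monotone,
which gives nearest points. The relations between orbits are then controlled by finitely many
monotone functions of the exponent and finitely many open conditions, and all of these are decided
by a long enough finite part (`Determined`). This proves CAP; joint embedding is amalgamation over
one fixed point.

For the conjugacy class, call an automorphism generic if cofinally many of its finite restrictions
can be amalgamated and every finite partial map compatible with such a restriction occurs in it.
Each requirement is open and dense, so generic automorphisms are comeager, and a back-and-forth
argument shows that any two are conjugate. -/

namespace OrderedBoron

/-! ### Binary branching structures and their calculus -/

/-- An ordered binary tree of points, up to equality: `lt` is a strict weak order, and `T x y z`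
says that `x` and `y` branch off from each other strictly below the node where `z` branches off. -/
structure OBT (X : Type*) where
  lt : X → X → Prop
  T : X → X → X → Prop
  lt_asymm : ∀ x y, lt x y → ¬ lt y x
  lt_split : ∀ x y z, lt x y → lt x z ∨ lt z y
  T_symm : ∀ x y z, T x y z → T y x z
  T_asymm : ∀ x y z, T x y z → ¬ T x z y
  T_split : ∀ x y z w, T x y z → T x y w ∨ T x w z
  T_self : ∀ x y, T x x y ↔ lt x y ∨ lt y x
  T_total : ∀ x y z, lt x y → T x y z ∨ T x z y ∨ T y z x
  T_lt : ∀ x y z, T x y z → lt x z → lt y z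
  T_gt : ∀ x y z, T x y z → lt z x → lt z y

namespace OBT

variable {X Y : Type*} (o : OBT X)

/-- The structure induced on the source of a map. -/
def comap (f : Y → X) : OBT Y where
  lt x y := o.lt (f x) (f y)
  T x y z := o.T (f x) (f y) (f z)
  lt_asymm _ _ := o.lt_asymm _ _
  lt_split _ _ _ := o.lt_split _ _ _
  T_symm _ _ _ := o.T_symm _ _ _
  T_asymm _ _ _ := o.T_asymm _ _ _
  T_split _ _ _ _ := o.T_split _ _ _ _
  T_self _ _ := o.T_self _ _
  T_total _ _ _ := o.T_total _ _ _
  T_lt _ _ _ := o.T_lt _ _ _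
  T_gt _ _ _ := o.T_gt _ _ _

/-- Distinct points can be compared. -/
def Reduced : Prop := ∀ x y, ¬ o.lt x y → ¬ o.lt y x → x = y

theorem lt_irrefl (x : X) : ¬ o.lt x x := fun h => o.lt_asymm _ _ h h

theorem lt_trans {x y z : X} (h : o.lt x y) (h' : o.lt y z) : o.lt x z := by
  rcases o.lt_split x y z h with h1 | h1
  · exact h1
  · exact absurd h1 (o.lt_asymm _ _ h')

theorem T_comm {x y z : X} : o.T x y z ↔ o.T y x z := ⟨o.T_symm _ _ _, o.T_symm _ _ _⟩

theorem T_irrefl (x y : X) : ¬ o.T x y y := fun h => o.T_asymm _ _ _ h h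

theorem not_T_left (x y : X) : ¬ o.T x y x := by
  intro h
  have := o.T_asymm _ _ _ (o.T_symm _ _ _ h)
  exact this (o.T_symm _ _ _ h)

/-- Transitivity of the branching order at `x`. -/
theorem T_trans {x y z w : X} (h : o.T x y z) (h' : o.T x z w) : o.T x y w := by
  rcases o.T_split x y z w h with h1 | h1
  · exact h1
  · exact absurd h1 (o.T_asymm _ _ _ h')

theorem T_rot {x y z : X} (h : o.T x y z) : ¬ o.T y z x := fun h' =>
  o.T_asymm _ _ _ (o.T_symm _ _ _ h) h'

theorem T_ne {x y z : X} (h : o.T x y z) : o.lt x z ∨ o.lt z x := by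
  rw [← o.T_self]
  rcases o.T_split x y z x h with h1 | h1
  · exact absurd h1 (o.not_T_left _ _)
  · exact h1

theorem T_self_of {x y z : X} (h : o.T x y z) : o.T x x z := (o.T_self _ _).2 (o.T_ne h)

/-- Two points deeper than `z` on the branch to `a` meet below `z`. -/
theorem T_of_deeper {a x y z : X} (hx : o.T a x z) (hy : o.T a y z) : o.T x y z := by
  rcases o.T_split _ _ _ y (o.T_symm _ _ _ hx) with h | h
  · rcases o.T_split _ _ _ x (o.T_symm _ _ _ hy) with h' | h'
    · exact absurd (o.T_symm _ _ _ h') (o.T_asymm _ _ _ (o.T_symm _ _ _ h))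
    · exact o.T_symm _ _ _ h'
  · exact h

theorem T_congr_mid {x y z : X} (h : ¬ o.lt x y) (h' : ¬ o.lt y x) (hz : o.lt x z ∨ o.lt z x) :
    o.T x y z := by
  have h1 := (o.T_self x z).2 hz
  rcases o.T_split _ _ _ y h1 with h2 | h2
  · exact absurd ((o.T_self _ _).1 h2) (by tauto)
  · exact h2

/-- Two points at the same level of the branch to `a` lie on the same side of it. -/
theorem T_of_level {a x y z : X} (h : ¬ o.T a x y) (h' : ¬ o.T a y x)
    (hz : o.T a z x) : o.T x y z := by
  have hxz : o.lt x z ∨ o.lt z x := by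
    rcases o.T_ne (o.T_symm _ _ _ hz) with h1 | h1 <;> tauto
  by_cases hxy : o.lt x y ∨ o.lt y x
  · have key : o.T x y z ∨ o.T x z y ∨ o.T y z x := by
      rcases hxy with h1 | h1
      · exact o.T_total _ _ _ h1
      · rcases o.T_total _ _ z h1 with h2 | h2 | h2
        · exact Or.inl (o.T_symm _ _ _ h2)
        · exact Or.inr (Or.inr h2)
        · exact Or.inr (Or.inl h2)
    rcases key with h1 | h1 | h1
    · exact h1
    · exact absurd (o.T_of_deeper (o.T_trans (o.T_symm _ _ _ hz) (o.T_symm _ _ _ h1))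
        (o.T_symm _ _ _ h1)) h
    · exact absurd (o.T_of_deeper (o.T_symm _ _ _ hz) (o.T_symm _ _ _ h1)) h'
  · exact o.T_congr_mid (by tauto) (by tauto) hxz

theorem not_T_of_branch {i j x : X} (h : o.T i x j) : ¬ o.T j x i ∧ ¬ o.T j i x :=
  ⟨fun h' => o.T_asymm _ _ _ (o.T_symm _ _ _ h) (o.T_symm _ _ _ h'),
    fun h' => o.T_asymm _ _ _ h (o.T_symm _ _ _ h')⟩

theorem T_of_same_level {i j x : X} (h : ¬ o.T i x j) (h' : ¬ o.T i j x)
    (hij : o.lt i j ∨ o.lt j i) : o.T j x i :=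
  o.T_of_level h' h (by rw [T_self]; exact hij)

theorem T_iff_below {i j x : X} (y : X) (h : o.T i j x) : o.T i y x ↔ o.T j y x :=
  ⟨fun h' => o.T_of_deeper h h', fun h' => o.T_of_deeper (o.T_symm _ _ _ h) h'⟩

theorem T_iff_above {i j x : X} (y : X) (h : o.T i j x) : o.T i x y ↔ o.T j x y := by
  have key : ∀ i j, o.T i j x → o.T i x y → o.T j x y := fun i j h h' =>
    o.T_of_deeper (o.T_trans h h') h'
  exact ⟨key _ _ h, key _ _ (o.T_symm _ _ _ h)⟩

/-- The relation `T x y z` as seen from the branch to `a`. -/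
theorem T_iff_of_branch {a x y z : X}
    (h : o.T a x y ∨ o.T a y x ∨ o.T a y z ∨ o.T a z y ∨ o.T a x z ∨ o.T a z x) :
    o.T x y z ↔ (o.T a x z ∧ o.T a y z) ∨ (¬ o.T a x y ∧ ¬ o.T a y x ∧ o.T a z x) := by
  constructor
  · intro hT
    by_contra hc
    push Not at hc
    obtain ⟨h1, h2⟩ := hc
    have hT1 := o.T_asymm _ _ _ hT
    have hT2 := o.T_rot hT
    have d := @T_of_deeper _ o a
    have l := @T_of_level _ o a
    have s := o.T_split a
    have c := fun x y z => @T_comm _ o x y z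
    have e := o.T_asymm a
    grind
  · rintro (⟨h1, h2⟩ | ⟨h1, h2, h3⟩)
    · exact o.T_of_deeper h1 h2
    · exact o.T_of_level h1 h2 h3

end OBT

/-! ### Branching structures from binary digits -/

/-- Points with binary digits at linearly ordered places, where distinct points have a first place
of difference. -/
theorem exists_OBT_of_bits {X Λ : Type*} [LinearOrder Λ] (δ : X → X → Λ) (bit : X → Λ → Bool)
    (symm : ∀ x y, δ x y = δ y x) (agree : ∀ x y q, q < δ x y → bit x q = bit y q)
    (differ : ∀ x y, x ≠ y → bit x (δ x y) ≠ bit y (δ x y))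
    (top : ∀ x y, x ≠ y → δ x y < δ x x) :
    ∃ o : OBT X, o.Reduced ∧
      (∀ x y, o.lt x y ↔ x ≠ y ∧ bit x (δ x y) = false ∧ bit y (δ x y) = true) ∧
      ∀ x y z, o.T x y z ↔ δ x z < δ x y := by
  -- Ultrametric inequality: otherwise x and z would agree, through y, at their own first place of
  -- difference.
  have ultra : ∀ x y z, δ x y ≤ δ x z ∨ δ y z ≤ δ x z := by
    intro x y z
    by_contra! h
    by_cases hxz : x = z
    · subst hxz
      by_cases hxy : x = y
      · subst hxy; exact lt_irrefl _ h.1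
      · exact lt_asymm h.1 (top _ _ hxy)
    · exact differ _ _ hxz ((agree _ _ _ h.1).trans (agree _ _ _ h.2))
  refine ⟨⟨fun x y => x ≠ y ∧ bit x (δ x y) = false ∧ bit y (δ x y) = true,
    fun x y z => δ x z < δ x y, ?_, ?_, ?_, ?_, ?_, ?_, ?_, ?_, ?_⟩, ?_, fun _ _ => Iff.rfl,
    fun _ _ _ => Iff.rfl⟩
  · grind
  · rintro x y z ⟨h1, h2, h3⟩
    have := ultra x y z
    have := ultra x z y
    have := ultra z x y
    grind
  · intro x y z h
    have := ultra x y z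
    have := ultra y x z
    grind
  · intro x y z h h'
    exact lt_asymm h h'
  · intro x y z w h
    rcases lt_or_ge (δ x w) (δ x y) with h1 | h1
    · exact Or.inl h1
    · exact Or.inr (h.trans_le h1)
  · intro x y
    by_cases hxy : x = y
    · subst hxy; simp
    · have := differ x y hxy
      have := top x y hxy
      grind
  · rintro x y z ⟨h1, h2, h3⟩
    have h4 := ultra x y z
    have h5 := ultra x z y
    have h6 := ultra z x y
    have := agree x z
    have := agree y z
    have := differ y z
    have := differ x z
    cases hb : bit z (δ x y) <;> grind
  · intro x y z h
    have h4 := ultra x y z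
    have h5 := ultra x z y
    have h6 := ultra z x y
    have := agree x y (δ x z) h
    have := top x z
    grind
  · intro x y z h
    have h4 := ultra x y z
    have h5 := ultra x z y
    have h6 := ultra z x y
    have := agree x y (δ x z) h
    have := top x z
    grind
  · intro x y h h'
    by_contra hxy
    have := differ x y hxy
    grind

end OrderedBoron

namespace OrderedBoron
namespace OBT

/-- Of two points leaving the branch to a at different places, the lower one is on the side of a
where the upper one leaves. So the side of the upper one decides. -/
theorem lt_iff_of_branch {X : Type*} (o : OBT X) {a x y : X} (h : o.T a x y ∨ o.T a y x) :
    o.lt x y ↔ (o.T a y x ∧ o.lt x a) ∨ (o.T a x y ∧ o.lt a y) := by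
  rcases h with h | h
  · have h1 := o.T_asymm _ _ _ h
    have h2 := o.T_lt _ _ _ h
    have h3 := o.T_lt _ _ _ (o.T_symm _ _ _ h)
    grind
  · have h1 := o.T_asymm _ _ _ h
    have h2 := o.T_gt _ _ _ h
    have h3 := o.T_gt _ _ _ (o.T_symm _ _ _ h)
    grind

/-! ### Merging two structures along the branches to common points -/

/-- A common substructure of two structures, given by two families of points with the same
relations, such that every point of `C` has a nearest point in the substructure. -/
structure AmalgData (B C I : Type*) where
  oB : OBT B
  oC : OBT C
  u : I → B
  v : I → C
  lt_iff : ∀ i j, oB.lt (u i) (u j) ↔ oC.lt (v i) (v j)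
  T_iff : ∀ i j k, oB.T (u i) (u j) (u k) ↔ oC.T (v i) (v j) (v k)
  nearC : ∀ c, ∃ i, ∀ j, ¬ oC.T c (v j) (v i)

namespace AmalgData

variable {B C I : Type*} (d : AmalgData B C I)

/-- In the amalgam, `x` branches off strictly above `y` from the branch to the `i`-th common point;
where the common points do not decide, points of `B` branch off above points of `C`. -/
def above (i : I) : B ⊕ C → B ⊕ C → Prop
  | .inl b, .inl b' => d.oB.T (d.u i) b' b
  | .inr c, .inr c' => d.oC.T (d.v i) c' c
  | .inl b, .inr c => ∀ k, d.oC.T (d.v i) c (d.v k) ∨ d.oB.T (d.u i) (d.u k) b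
  | .inr c, .inl b => ∃ k, (¬ d.oC.T (d.v i) c (d.v k) ∧ d.oB.T (d.u i) b (d.u k)) ∨
      (d.oC.T (d.v i) (d.v k) c ∧ ¬ d.oB.T (d.u i) (d.u k) b)

theorem above_asymm (i : I) (x y : B ⊕ C) (h : d.above i x y) : ¬ d.above i y x := by
  rcases x with b | c <;> rcases y with b' | c' <;> simp only [above] at *
  · exact d.oB.T_asymm _ _ _ h
  · rintro ⟨k, hk⟩
    have := h k
    have := d.oB.T_asymm (d.u i) b (d.u k)
    have := d.oC.T_asymm (d.v i) c' (d.v k)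
    grind
  · intro h'
    obtain ⟨k, hk⟩ := h
    have := h' k
    have := d.oB.T_asymm (d.u i) b' (d.u k)
    have := d.oC.T_asymm (d.v i) c (d.v k)
    grind
  · exact d.oC.T_asymm _ _ _ h

/-- Together with asymmetry, this makes the merged comparison a strict weak order on the disjoint
union. A point of B fails to be above a point of C only if some common point lies weakly between
them, and such witnesses can be compared in both factors. -/
theorem above_split (i : I) (x y z : B ⊕ C) (h : d.above i x y) :
    d.above i x z ∨ d.above i z y := by
  have sB := d.oB.T_split (d.u i)
  have sC := d.oC.T_split (d.v i)
  have aB := d.oB.T_asymm (d.u i)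
  have aC := d.oC.T_asymm (d.v i)
  have tT := d.T_iff i
  rcases x with b | c <;> rcases y with b' | c' <;> rcases z with b'' | c'' <;>
    simp only [above] at *
  · grind
  · by_contra! hc
    obtain ⟨⟨k, hk⟩, hc⟩ := hc
    have := hc k
    grind
  · by_contra! hc
    obtain ⟨hc, k, hk⟩ := hc
    have := h k
    grind
  · by_contra! hc
    obtain ⟨⟨k, hk⟩, hc⟩ := hc
    have := h k
    grind
  · by_contra! hc
    obtain ⟨k, hk⟩ := h
    have := hc.1 k
    grind
  · by_contra! hc
    obtain ⟨k, hk⟩ := h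
    have := hc.2 k
    grind
  · by_contra! hc
    obtain ⟨h1, k, hk⟩ := hc
    have := h1 k
    grind
  · grind

/-- `x` branches off above the `j`-th common point from the branch to the `i`-th one. -/
def abv (i j : I) : B ⊕ C → Prop
  | .inl b => d.oB.T (d.u i) (d.u j) b
  | .inr c => d.oC.T (d.v i) (d.v j) c

/-- `x` branches off below the `j`-th common point from the branch to the `i`-th one. -/
def blw (i j : I) : B ⊕ C → Prop
  | .inl b => d.oB.T (d.u i) b (d.u j)
  | .inr c => d.oC.T (d.v i) c (d.v j)

/-- `x` lies to the left of the `i`-th common point. -/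
def left (i : I) : B ⊕ C → Prop
  | .inl b => d.oB.lt b (d.u i)
  | .inr c => d.oC.lt c (d.v i)

/-- `x` lies to the right of the `i`-th common point. -/
def right (i : I) : B ⊕ C → Prop
  | .inl b => d.oB.lt (d.u i) b
  | .inr c => d.oC.lt (d.v i) c

variable {d} {i j : I} {x y z w : B ⊕ C}

theorem abv_comm : d.abv i j x ↔ d.abv j i x := by
  rcases x with b | c
  · exact d.oB.T_comm
  · exact d.oC.T_comm

theorem not_abv_of_blw (h : d.blw i j x) : ¬ d.blw j i x ∧ ¬ d.abv i j x := by
  rw [abv_comm]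
  rcases x with b | c
  · exact d.oB.not_T_of_branch h
  · exact d.oC.not_T_of_branch h

theorem blw_of_not (hij : d.oB.lt (d.u i) (d.u j) ∨ d.oB.lt (d.u j) (d.u i))
    (h : ¬ d.abv i j x) (h' : ¬ d.blw i j x) : d.blw j i x := by
  rcases x with b | c
  · exact d.oB.T_of_same_level h' h hij
  · rw [d.lt_iff, d.lt_iff] at hij
    exact d.oC.T_of_same_level h' h hij

/-- The place where the j-th common point leaves the branch to the i-th is known in both factors. It
therefore separates points of either factor, whatever the default rule says. -/
theorem above_of_abv (h : d.abv i j x) (h' : ¬ d.abv i j y) : d.above i x y := by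
  have sB := d.oB.T_split (d.u i)
  have sC := d.oC.T_split (d.v i)
  rcases x with b | c <;> rcases y with b' | c' <;> simp only [abv, above] at *
  · grind
  · intro k
    have := d.T_iff i
    grind
  · refine ⟨j, ?_⟩
    grind
  · grind

theorem above_of_blw (h : d.blw i j y) (h' : ¬ d.blw i j x) : d.above i x y := by
  have sB := d.oB.T_split (d.u i)
  have sC := d.oC.T_split (d.v i)
  rcases x with b | c <;> rcases y with b' | c' <;> simp only [blw, above] at *
  · grind
  · intro k
    have := d.T_iff i
    grind
  · refine ⟨j, ?_⟩
    grind
  · grind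

theorem abv_or_of_above (h : d.above i x y) : d.abv i j x ∨ d.blw i j y := by
  have sB := d.oB.T_split (d.u i)
  have sC := d.oC.T_split (d.v i)
  rcases x with b | c <;> rcases y with b' | c' <;> simp only [abv, blw, above] at *
  · grind
  · have := h j
    grind
  · obtain ⟨k, hk⟩ := h
    have := d.T_iff i
    grind
  · grind

/-- Above the place where i and j part, the two branches coincide. Any common point whose comparison
could matter there is seen identically from both. -/
theorem above_inl_inr_iff {b : B} {c : C} (h : d.abv i j (.inl b)) :
    d.above i (.inl b) (.inr c) ↔ d.above j (.inl b) (.inr c) := by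
  have key : ∀ i j, d.abv i j (.inl b) → d.above i (.inl b) (.inr c) →
      d.above j (.inl b) (.inr c) := by
    intro i j h h' k
    simp only [abv, above] at *
    have h1 := d.oB.T_iff_below (d.u k) h
    rw [← h1]
    by_cases h2 : d.oB.T (d.u i) (d.u k) b
    · exact Or.inr h2
    · left
      have h3 := (h' k).resolve_right h2
      have h4 : d.oC.T (d.v i) (d.v j) (d.v k) := by
        rw [← d.T_iff]
        have := d.oB.T_split _ _ _ (d.u k) h
        grind
      exact (d.oC.T_iff_below c h4).1 h3
  exact ⟨key _ _ h, key _ _ (abv_comm.1 h)⟩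

/-- If b is also above the parting place, a witness for i serves for j; otherwise the parting place
itself separates c from b. -/
theorem above_inr_inl_iff {b : B} {c : C} (h : d.abv i j (.inr c)) :
    d.above i (.inr c) (.inl b) ↔ d.above j (.inr c) (.inl b) := by
  have key : ∀ i j, d.abv i j (.inr c) → d.above i (.inr c) (.inl b) →
      d.above j (.inr c) (.inl b) := by
    intro i j h h'
    by_cases hb : d.abv j i (.inl b)
    · simp only [abv, above] at *
      obtain ⟨k, hk⟩ := h'
      refine ⟨k, ?_⟩
      have h1 := d.oC.T_iff_below (d.v k) h
      have h2 := d.oC.T_iff_above (d.v k) h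
      have h3 := d.oB.T_iff_below (d.u k) (d.oB.T_symm _ _ _ hb)
      have h4 := d.oB.T_iff_above (d.u k) (d.oB.T_symm _ _ _ hb)
      grind
    · exact above_of_abv (abv_comm.1 h) hb
  exact ⟨key _ _ h, key _ _ (abv_comm.1 h)⟩

theorem above_iff_of_abv_left (h : d.abv i j x) : d.above i x y ↔ d.above j x y := by
  rcases x with b | c <;> rcases y with b' | c'
  · exact d.oB.T_iff_below b' h
  · exact above_inl_inr_iff h
  · exact above_inr_inl_iff h
  · exact d.oC.T_iff_below c' h

theorem above_iff_of_abv_right (h : d.abv i j x) : d.above i y x ↔ d.above j y x := by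
  have key : ∀ i j, d.abv i j x → d.above i y x → d.above j y x := by
    intro i j h h'
    have h1 : d.abv i j y := by
      rcases abv_or_of_above (j := j) h' with h1 | h1
      · exact h1
      · exact absurd h (not_abv_of_blw h1).2
    exact (above_iff_of_abv_left h1).1 h'
  exact ⟨key _ _ h, key _ _ (abv_comm.1 h)⟩

/-- Covers bases that are not separated by the order: since structures need not be reduced,
different indices may name the same place. -/
theorem above_iff_of_eq (hij : ¬ d.oB.lt (d.u i) (d.u j)) (hji : ¬ d.oB.lt (d.u j) (d.u i)) :
    d.above i x y ↔ d.above j x y := by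
  have eB : ∀ a b, d.oB.T (d.u i) a b ↔ d.oB.T (d.u j) a b := by
    intro a b
    by_cases h : d.oB.lt (d.u i) b ∨ d.oB.lt b (d.u i)
    · exact d.oB.T_iff_below _ (d.oB.T_congr_mid hij hji h)
    · have := d.oB.lt_split
      have h1 := fun h' => h (d.oB.T_ne (x := d.u i) (y := a) (z := b) h')
      have h2 := @T_ne _ d.oB (d.u j) a b
      grind
  have eC : ∀ a b, d.oC.T (d.v i) a b ↔ d.oC.T (d.v j) a b := by
    rw [d.lt_iff] at hij hji
    intro a b
    by_cases h : d.oC.lt (d.v i) b ∨ d.oC.lt b (d.v i)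
    · exact d.oC.T_iff_below _ (d.oC.T_congr_mid hij hji h)
    · have := d.oC.lt_split
      have h1 := fun h' => h (d.oC.T_ne (x := d.v i) (y := a) (z := b) h')
      have h2 := @T_ne _ d.oC (d.v j) a b
      grind
  rcases x with b | c <;> rcases y with b' | c' <;> simp only [above, eB, eC]

variable (d i) in
/-- `x` and `y` branch off on the same side below `z`, as seen from the branch to the `i`-th
common point. -/
def comb (x y z : B ⊕ C) : Prop :=
  (d.above i z x ∧ d.above i z y) ∨ (¬ d.above i x y ∧ ¬ d.above i y x ∧ d.above i x z)

variable (d i) in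
/-- The order of `x` and `y`, as seen from the branch to the `i`-th common point. -/
def ordComb (x y : B ⊕ C) : Prop :=
  (d.above i x y ∧ d.left i x) ∨ (d.above i y x ∧ d.right i y)

variable (d i) in
/-- `x, y, z` branch off at the same place of the branch to the `i`-th common point. -/
def level (x y : B ⊕ C) : Prop := ¬ d.above i x y ∧ ¬ d.above i y x

/-- Independence of the base, the heart of the amalgam. Each point leaves above the parting of i and
j, or on the side of i, or on the side of j. The comparisons from i and j agree on the first kind
and are forced between different kinds; the exceptional case is that all three points leave at one
place as seen from j. -/
theorem comb_consistent (h : d.comb i x y z) (hj : ¬ (d.level j x y ∧ d.level j x z)) :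
    d.comb j x y z := by
  by_cases hij : d.oB.lt (d.u i) (d.u j) ∨ d.oB.lt (d.u j) (d.u i)
  · have a := d.above_asymm
    have s := d.above_split
    have f1 : ∀ x, d.abv i j x ↔ d.abv j i x := fun x => abv_comm
    have f2 : ∀ x, d.blw i j x → ¬ d.blw j i x ∧ ¬ d.abv i j x := fun x => not_abv_of_blw
    have f2' : ∀ x, d.blw j i x → ¬ d.blw i j x ∧ ¬ d.abv j i x := fun x => not_abv_of_blw
    have f3 : ∀ x, ¬ d.abv i j x → ¬ d.blw i j x → d.blw j i x := fun x => blw_of_not hij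
    have f4 : ∀ x y, d.abv i j x → (d.above i x y ↔ d.above j x y) :=
      fun x y => above_iff_of_abv_left
    have f5 : ∀ x y, d.abv i j x → (d.above i y x ↔ d.above j y x) :=
      fun x y => above_iff_of_abv_right
    have f6 : ∀ x y, d.abv i j x → ¬ d.abv i j y → d.above i x y := fun x y => above_of_abv
    have f6' : ∀ x y, d.abv j i x → ¬ d.abv j i y → d.above j x y := fun x y => above_of_abv
    have f7 : ∀ x y, d.blw i j y → ¬ d.blw i j x → d.above i x y := fun x y => above_of_blw
    have f7' : ∀ x y, d.blw j i y → ¬ d.blw j i x → d.above j x y := fun x y => above_of_blw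
    have f8 : ∀ x y, d.above i x y → d.abv i j x ∨ d.blw i j y := fun x y => abv_or_of_above
    have f8' : ∀ x y, d.above j x y → d.abv j i x ∨ d.blw j i y := fun x y => abv_or_of_above
    have st : ∀ x, d.abv i j x ∨ (¬ d.abv i j x ∧ d.blw i j x ∧ ¬ d.blw j i x) ∨
        (¬ d.abv i j x ∧ ¬ d.blw i j x ∧ d.blw j i x) := by grind
    simp only [comb, level] at *
    rcases st x with hx | hx | hx <;> rcases st y with hy | hy | hy <;>
      rcases st z with hz | hz | hz <;> grind
  · have := fun x y => above_iff_of_eq (x := x) (y := y) (not_or.1 hij).1 (not_or.1 hij).2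
    simpa only [comb, this] using h

theorem left_iff_of_abv (h : d.abv i j x) : d.left i x ↔ d.left j x := by
  rcases x with b | c
  · have h1 := d.oB.T_lt _ _ _ h
    have h2 := d.oB.T_gt _ _ _ h
    have h3 := d.oB.T_gt _ _ _ (d.oB.T_symm _ _ _ h)
    exact ⟨h2, h3⟩
  · have h2 := d.oC.T_gt _ _ _ h
    have h3 := d.oC.T_gt _ _ _ (d.oC.T_symm _ _ _ h)
    exact ⟨h2, h3⟩

theorem right_iff_of_abv (h : d.abv i j x) : d.right i x ↔ d.right j x := by
  rcases x with b | c
  · have h2 := d.oB.T_lt _ _ _ h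
    have h3 := d.oB.T_lt _ _ _ (d.oB.T_symm _ _ _ h)
    exact ⟨h2, h3⟩
  · have h2 := d.oC.T_lt _ _ _ h
    have h3 := d.oC.T_lt _ _ _ (d.oC.T_symm _ _ _ h)
    exact ⟨h2, h3⟩

/-- Seen from i, everything on the side of j leaves at the place where j leaves, hence on the same
side as j. -/
theorem left_iff_of_blw (h : d.blw j i x) : d.left i x ↔ d.oB.lt (d.u j) (d.u i) := by
  rcases x with b | c
  · exact ⟨d.oB.T_lt _ _ _ (d.oB.T_symm _ _ _ h), d.oB.T_lt _ _ _ h⟩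
  · rw [d.lt_iff]
    exact ⟨d.oC.T_lt _ _ _ (d.oC.T_symm _ _ _ h), d.oC.T_lt _ _ _ h⟩

theorem right_iff_of_blw (h : d.blw j i x) : d.right i x ↔ d.oB.lt (d.u i) (d.u j) := by
  rcases x with b | c
  · exact ⟨d.oB.T_gt _ _ _ (d.oB.T_symm _ _ _ h), d.oB.T_gt _ _ _ h⟩
  · rw [d.lt_iff]
    exact ⟨d.oC.T_gt _ _ _ (d.oC.T_symm _ _ _ h), d.oC.T_gt _ _ _ h⟩

/-- Independence of the base for the order, by the same division of the points into three kinds. -/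
theorem ordComb_consistent (h : d.ordComb i x y) (hj : ¬ d.level j x y) : d.ordComb j x y := by
  by_cases hij : d.oB.lt (d.u i) (d.u j) ∨ d.oB.lt (d.u j) (d.u i)
  · have a := d.above_asymm
    have f1 : ∀ x, d.abv i j x ↔ d.abv j i x := fun x => abv_comm
    have f2 : ∀ x, d.blw i j x → ¬ d.blw j i x ∧ ¬ d.abv i j x := fun x => not_abv_of_blw
    have f2' : ∀ x, d.blw j i x → ¬ d.blw i j x ∧ ¬ d.abv j i x := fun x => not_abv_of_blw
    have f3 : ∀ x, ¬ d.abv i j x → ¬ d.blw i j x → d.blw j i x := fun x => blw_of_not hij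
    have f4 : ∀ x y, d.abv i j x → (d.above i x y ↔ d.above j x y) :=
      fun x y => above_iff_of_abv_left
    have f5 : ∀ x y, d.abv i j x → (d.above i y x ↔ d.above j y x) :=
      fun x y => above_iff_of_abv_right
    have f6' : ∀ x y, d.abv j i x → ¬ d.abv j i y → d.above j x y := fun x y => above_of_abv
    have f7' : ∀ x y, d.blw j i y → ¬ d.blw j i x → d.above j x y := fun x y => above_of_blw
    have f8 : ∀ x y, d.above i x y → d.abv i j x ∨ d.blw i j y := fun x y => abv_or_of_above
    have f8' : ∀ x y, d.above j x y → d.abv j i x ∨ d.blw j i y := fun x y => abv_or_of_above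
    have l1 : ∀ x, d.abv i j x → (d.left i x ↔ d.left j x) := fun x => left_iff_of_abv
    have l2 : ∀ x, d.abv i j x → (d.right i x ↔ d.right j x) := fun x => right_iff_of_abv
    have l3 : ∀ x, d.blw j i x → (d.left i x ↔ d.oB.lt (d.u j) (d.u i)) :=
      fun x => left_iff_of_blw
    have l4 : ∀ x, d.blw j i x → (d.right i x ↔ d.oB.lt (d.u i) (d.u j)) :=
      fun x => right_iff_of_blw
    have l3' : ∀ x, d.blw i j x → (d.left j x ↔ d.oB.lt (d.u i) (d.u j)) :=
      fun x => left_iff_of_blw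
    have l4' : ∀ x, d.blw i j x → (d.right j x ↔ d.oB.lt (d.u j) (d.u i)) :=
      fun x => right_iff_of_blw
    have st : ∀ x, d.abv i j x ∨ (¬ d.abv i j x ∧ d.blw i j x ∧ ¬ d.blw j i x) ∨
        (¬ d.abv i j x ∧ ¬ d.blw i j x ∧ d.blw j i x) := by grind
    simp only [ordComb, level] at *
    rcases st x with hx | hx | hx <;> rcases st y with hy | hy | hy <;> grind
  · have e := fun x y => above_iff_of_eq (x := x) (y := y) (not_or.1 hij).1 (not_or.1 hij).2
    have sB := d.oB.lt_split
    have sC := d.oC.lt_split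
    have lt_iff := d.lt_iff
    have l : ∀ x, (d.left i x ↔ d.left j x) ∧ (d.right i x ↔ d.right j x) := by
      rintro (b | c) <;> simp only [left, right] <;> grind
    simpa only [ordComb, e, l] using h

end AmalgData
end OBT
end OrderedBoron

namespace OrderedBoron
namespace OBT
namespace AmalgData

variable {B C I : Type*} (d : AmalgData B C I)

/-! ### The amalgam satisfies the axioms -/

/-- The relation `T` on points of the same factor. -/
def pureT : B ⊕ C → B ⊕ C → B ⊕ C → Prop
  | .inl x, .inl y, .inl z => d.oB.T x y z
  | .inr x, .inr y, .inr z => d.oC.T x y z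
  | _, _, _ => False

/-- The order on points of the same factor. -/
def pureLt : B ⊕ C → B ⊕ C → Prop
  | .inl x, .inl y => d.oB.lt x y
  | .inr x, .inr y => d.oC.lt x y
  | _, _ => False

/-- The relation `T` of the amalgam. -/
def amalgT (x y z : B ⊕ C) : Prop := (∃ i, d.comb i x y z) ∨ d.pureT x y z

/-- The order of the amalgam. -/
def amalgLt (x y : B ⊕ C) : Prop := (∃ i, d.ordComb i x y) ∨ d.pureLt x y

/-- `x` is identified with the `i`-th common point. -/
def eqv (i : I) : B ⊕ C → Prop
  | .inl b => ¬ d.oB.lt b (d.u i) ∧ ¬ d.oB.lt (d.u i) b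
  | .inr c => ¬ d.oC.lt c (d.v i) ∧ ¬ d.oC.lt (d.v i) c

variable {d} {i j : I} {x y z w : B ⊕ C}

/-- Relations inherited from one factor also obey the formula from a base, because the factor itself
satisfies it. Thus any base from which the points do not all leave at one place computes the
amalgam. -/
theorem pureT_iff (h : d.pureT x y z ∨ ∃ i, d.comb i x y z) (hi : ¬ (d.level i x y ∧ d.level i x z)) :
    d.comb i x y z := by
  rcases h with h | ⟨j, h⟩
  · have hB := fun a x y z => d.oB.T_iff_of_branch (a := a) (x := x) (y := y) (z := z)
    have hC := fun a x y z => d.oC.T_iff_of_branch (a := a) (x := x) (y := y) (z := z)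
    rcases x with x | x <;> rcases y with y | y <;> rcases z with z | z <;>
      simp only [pureT, comb, level, above] at * <;> grind
  · exact comb_consistent h hi

theorem amalgT_iff (i : I) (hi : ¬ (d.level i x y ∧ d.level i x z)) :
    d.amalgT x y z ↔ d.comb i x y z :=
  ⟨fun h => pureT_iff h.symm hi, fun h => Or.inl ⟨i, h⟩⟩

theorem amalgLt_iff (i : I) (hi : ¬ d.level i x y) :
    d.amalgLt x y ↔ d.ordComb i x y := by
  refine ⟨?_, fun h => Or.inl ⟨i, h⟩⟩
  rintro (⟨j, h⟩ | h)
  · exact ordComb_consistent h hi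
  · have hB := fun a x y => d.oB.lt_iff_of_branch (a := a) (x := x) (y := y)
    have hC := fun a x y => d.oC.lt_iff_of_branch (a := a) (x := x) (y := y)
    rcases x with x | x <;> rcases y with y | y <;>
      simp only [pureLt, ordComb, level, above, left, right] at * <;> grind

/-- The amalgam adds no relation inside a factor: a relation seen from a common point already holds
there by `T_iff_of_branch`. -/
theorem amalgT_inl {a b c : B} : d.amalgT (.inl a) (.inl b) (.inl c) ↔ d.oB.T a b c := by
  refine ⟨?_, Or.inr⟩
  rintro (⟨i, h⟩ | h)
  · simp only [comb, above] at h
    exact (d.oB.T_iff_of_branch (a := d.u i) (by grind)).2 (by grind)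
  · exact h

theorem amalgT_inr {a b c : C} : d.amalgT (.inr a) (.inr b) (.inr c) ↔ d.oC.T a b c := by
  refine ⟨?_, Or.inr⟩
  rintro (⟨i, h⟩ | h)
  · simp only [comb, above] at h
    exact (d.oC.T_iff_of_branch (a := d.v i) (by grind)).2 (by grind)
  · exact h

theorem amalgLt_inl {a b : B} : d.amalgLt (.inl a) (.inl b) ↔ d.oB.lt a b := by
  refine ⟨?_, Or.inr⟩
  rintro (⟨i, h⟩ | h)
  · simp only [ordComb, above, left, right] at h
    exact (d.oB.lt_iff_of_branch (a := d.u i) (by grind)).2 (by grind)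
  · exact h

theorem amalgLt_inr {a b : C} : d.amalgLt (.inr a) (.inr b) ↔ d.oC.lt a b := by
  refine ⟨?_, Or.inr⟩
  rintro (⟨i, h⟩ | h)
  · simp only [ordComb, above, left, right] at h
    exact (d.oC.lt_iff_of_branch (a := d.v i) (by grind)).2 (by grind)
  · exact h

theorem not_above_of_eqv (hx : d.eqv i x) (hy : d.eqv i y) : ¬ d.above j x y := by
  have key : ∀ x, d.eqv i x → ¬ d.abv j i x ∧ ¬ d.blw j i x := by
    rintro (b | c) h
    · exact ⟨fun h' => by
        have h1 := (d.oB.T_self _ _).1 (d.oB.T_self_of (d.oB.T_symm _ _ _ h'))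
        rcases h1 with h1 | h1
        · exact h.2 h1
        · exact h.1 h1, fun h' => by
        have h1 := (d.oB.T_self _ _).1 (d.oB.T_self_of (d.oB.T_symm _ _ _ h'))
        rcases h1 with h1 | h1
        · exact h.1 h1
        · exact h.2 h1⟩
    · exact ⟨fun h' => by
        have h1 := (d.oC.T_self _ _).1 (d.oC.T_self_of (d.oC.T_symm _ _ _ h'))
        rcases h1 with h1 | h1
        · exact h.2 h1
        · exact h.1 h1, fun h' => by
        have h1 := (d.oC.T_self _ _).1 (d.oC.T_self_of (d.oC.T_symm _ _ _ h'))
        rcases h1 with h1 | h1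
        · exact h.1 h1
        · exact h.2 h1⟩
  intro h
  rcases abv_or_of_above (j := i) h with h1 | h1
  · exact (key _ hx).1 h1
  · exact (key _ hy).2 h1

theorem not_amalgT_of_eqv (hx : d.eqv i x) (hy : d.eqv i y) (hz : d.eqv i z) :
    ¬ d.amalgT x y z := by
  rintro (⟨j, h⟩ | h)
  · have h1 := not_above_of_eqv (j := j) hz hx
    have h2 := not_above_of_eqv (j := j) hx hz
    simp only [comb] at h
    tauto
  · rcases x with x | x <;> rcases y with y | y <;> rcases z with z | z <;>
      simp only [pureT] at h
    · have := d.oB.lt_split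
      have := d.oB.T_ne h
      simp only [eqv] at *
      grind
    · have := d.oC.lt_split
      have := d.oC.T_ne h
      simp only [eqv] at *
      grind

theorem not_amalgLt_of_eqv (hx : d.eqv i x) (hy : d.eqv i y) : ¬ d.amalgLt x y := by
  rintro (⟨j, h⟩ | h)
  · have h1 := not_above_of_eqv (j := j) hy hx
    have h2 := not_above_of_eqv (j := j) hx hy
    simp only [ordComb] at h
    tauto
  · rcases x with x | x <;> rcases y with y | y <;> simp only [pureLt] at h
    · have := d.oB.lt_split
      simp only [eqv] at *
      grind
    · have := d.oC.lt_split
      simp only [eqv] at *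
      grind

/-- The nearest common point separates a point of one factor from all points of the other one which
are not identified with it. -/
theorem exists_separating (d : AmalgData B C I) (c : C) : ∃ i, (∀ b', ¬ d.level i (.inl b') (.inr c) ∨
      (d.eqv i (.inl b') ∧ d.eqv i (.inr c))) := by
  obtain ⟨i, hi⟩ := d.nearC c
  refine ⟨i, fun b' => ?_⟩
  by_contra! h
  obtain ⟨⟨h1, h2⟩, h3⟩ := h
  simp only [above] at h1 h2
  push Not at h1 h2
  obtain ⟨k, hk⟩ := h1
  have h4 := h2 k
  by_cases hc : d.eqv i (.inr c)
  · have h5 : ¬ d.eqv i (.inl b') := fun hb => h3 hb hc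
    simp only [eqv] at h5 hc
    have h6 := h2 i
    rw [d.oC.T_self] at h6
    rw [d.oB.T_self] at h6
    have h7 := d.oC.T_irrefl (d.v i) (d.v i)
    have h8 := h2 k
    have h9 := d.oB.not_T_left (d.u i) (d.u i)
    have h10 := d.T_iff i i k
    have h11 := d.oB.T_self (d.u i) (d.u k)
    have h12 := d.oB.T_self (d.u i) b'
    have h13 := d.oB.T_split (d.u i) (d.u i) b' (d.u k)
    have h14 := d.oC.T_self (d.v i) (d.v k)
    have h15 := d.oC.T_split (d.v i) (d.v i) (d.v k) c
    have h16 := d.oC.T_self (d.v i) c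
    grind
  · have h5 : ¬ d.oC.T (d.v i) (d.v k) c := fun h => by
      have := d.oC.T_asymm _ _ _ h
      grind
    -- A common point leaving the branch to i at the same place as c is on the side of c, so it
    -- would be nearer to c than i.
    have h6 : d.oC.T c (d.v k) (d.v i) := by
      apply d.oC.T_of_level hk.1 h5
      rw [d.oC.T_self]
      simp only [eqv] at hc
      tauto
    exact hi k h6

theorem level_trans (h : d.level i x y) (h' : d.level i y z) : d.level i x z := by
  have := d.above_split i
  simp only [level] at *
  grind

theorem level_symm (h : d.level i x y) : d.level i y x := ⟨h.2, h.1⟩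

theorem eqv_of_level (h : d.level i x y) (hy : d.eqv i y) : d.eqv i x := by
  have key : ∀ y, d.eqv i y ↔ ¬ d.abv i i y := by
    rintro (b | c)
    · simp only [eqv, abv, d.oB.T_self]; tauto
    · simp only [eqv, abv, d.oC.T_self]; tauto
  rw [key] at *
  intro hx
  exact h.1 (above_of_abv hx hy)

/-- If both factors occur, take the nearest common point of a point of C that occurs. It separates
that point from a point of B that occurs, unless both are identified with it; in that case, if all
points are at one level, all are identified with it. -/
theorem exists_base (x y z w : B ⊕ C) :
    ((x.isLeft ∧ y.isLeft ∧ z.isLeft ∧ w.isLeft) ∨ (x.isRight ∧ y.isRight ∧ z.isRight ∧ w.isRight)) ∨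
    ∃ i, (d.eqv i x ∧ d.eqv i y ∧ d.eqv i z ∧ d.eqv i w) ∨
      ¬ (d.level i x y ∧ d.level i x z ∧ d.level i x w) := by
  have key : ∀ c b, (c = x ∨ c = y ∨ c = z ∨ c = w) → (b = x ∨ b = y ∨ b = z ∨ b = w) →
      c.isRight → b.isLeft → ∃ i, (d.eqv i x ∧ d.eqv i y ∧ d.eqv i z ∧ d.eqv i w) ∨
      ¬ (d.level i x y ∧ d.level i x z ∧ d.level i x w) := by
    intro c b hc hb hc' hb'
    obtain ⟨c, rfl⟩ := Sum.isRight_iff.1 hc'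
    obtain ⟨b, rfl⟩ := Sum.isLeft_iff.1 hb'
    obtain ⟨i, hi⟩ := d.exists_separating c
    refine ⟨i, ?_⟩
    by_contra! h
    obtain ⟨h, h1, h2, h3⟩ := h
    have hx : ∀ t, (t = x ∨ t = y ∨ t = z ∨ t = w) → d.level i x t := by
      rintro t (rfl | rfl | rfl | rfl)
      · exact level_trans h1 (level_symm h1)
      all_goals assumption
    have hbc := level_trans (level_symm (hx _ hb)) (hx _ hc)
    rcases hi b with h4 | h4
    · exact h4 hbc
    · have := fun t ht => eqv_of_level (level_trans (level_symm (hx t ht)) (hx _ hc)) h4.2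
      exact h (this x (by tauto)) (this y (by tauto)) (this z (by tauto)) (this w (by tauto))
  rcases x with x | x <;> rcases y with y | y <;> rcases z with z | z <;> rcases w with w | w <;>
    first
    | (left; simp; done)
    | skip
  all_goals
    right
    first
    | exact key (.inr x) (.inl y) (by simp) (by simp) rfl rfl
    | exact key (.inr x) (.inl z) (by simp) (by simp) rfl rfl
    | exact key (.inr x) (.inl w) (by simp) (by simp) rfl rfl
    | exact key (.inr y) (.inl x) (by simp) (by simp) rfl rfl
    | exact key (.inr z) (.inl x) (by simp) (by simp) rfl rfl
    | exact key (.inr w) (.inl x) (by simp) (by simp) rfl rfl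

/-- Reduces each axiom, which involves at most four points, to a factor, to identified points, or to
a propositional fact about one weak order and sides on a single branch. -/
theorem base_cases (x y z w : B ⊕ C) {P : Prop}
    (hB : ∀ x' y' z' w', x = .inl x' → y = .inl y' → z = .inl z' → w = .inl w' → P)
    (hC : ∀ x' y' z' w', x = .inr x' → y = .inr y' → z = .inr z' → w = .inr w' → P)
    (hE : ∀ i, d.eqv i x → d.eqv i y → d.eqv i z → d.eqv i w → P)
    (hL : ∀ i, ¬ (d.level i x y ∧ d.level i x z ∧ d.level i x w) → P) : P := by
  rcases exists_base (d := d) x y z w with (h | h) | ⟨i, h | h⟩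
  · simp only [Sum.isLeft_iff] at h
    obtain ⟨⟨_, hx⟩, ⟨_, hy⟩, ⟨_, hz⟩, ⟨_, hw⟩⟩ := h
    exact hB _ _ _ _ hx hy hz hw
  · simp only [Sum.isRight_iff] at h
    obtain ⟨⟨_, hx⟩, ⟨_, hy⟩, ⟨_, hz⟩, ⟨_, hw⟩⟩ := h
    exact hC _ _ _ _ hx hy hz hw
  · exact hE i h.1 h.2.1 h.2.2.1 h.2.2.2
  · exact hL i h

theorem left_or_right (h : d.above i x y) : d.left i x ∨ d.right i x := by
  have h1 : d.abv i i x := by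
    by_contra h1
    rcases abv_or_of_above (j := i) h with h2 | h2
    · exact h1 h2
    · rcases y with b | c
      · exact d.oB.not_T_left _ _ h2
      · exact d.oC.not_T_left _ _ h2
  rcases x with b | c
  · exact ((d.oB.T_self _ _).1 h1).symm
  · exact ((d.oC.T_self _ _).1 h1).symm

theorem not_left_right (i : I) (x : B ⊕ C) : ¬ (d.left i x ∧ d.right i x) := by
  rintro ⟨h, h'⟩
  rcases x with b | c
  · exact d.oB.lt_asymm _ _ h h'
  · exact d.oC.lt_asymm _ _ h h'

theorem side_of_level {X : Type*} (o : OBT X) {a x y : X} (h : ¬ o.T a x y) (h' : ¬ o.T a y x) :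
    (o.lt x a → o.lt y a) ∧ (o.lt a x → o.lt a y) := by
  have key : o.lt x a ∨ o.lt a x → o.T x y a := fun hx =>
    o.T_of_level h h' ((o.T_self _ _).2 hx.symm)
  exact ⟨fun hx => o.T_lt _ _ _ (key (Or.inl hx)) hx, fun hx => o.T_gt _ _ _ (key (Or.inr hx)) hx⟩

/-- By the default rule, points of different factors are never level by accident: some common point
must leave at exactly their place. -/
theorem exists_of_level {b : B} {c : C} (h : d.level i (.inl b) (.inr c)) :
    ∃ k, (¬ d.oB.T (d.u i) b (d.u k) ∧ ¬ d.oB.T (d.u i) (d.u k) b) ∧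
      ¬ d.oC.T (d.v i) c (d.v k) ∧ ¬ d.oC.T (d.v i) (d.v k) c := by
  obtain ⟨h1, h2⟩ := h
  simp only [above] at h1 h2
  push Not at h1 h2
  obtain ⟨k, hk⟩ := h1
  have := h2 k
  exact ⟨k, by grind⟩

/-- For points of different factors, the side is transferred through the common point that leaves at
the same place. -/
theorem left_right_of_level (h : d.level i x y) :
    (d.left i x → d.left i y) ∧ (d.right i x → d.right i y) := by
  rcases x with b | c <;> rcases y with b' | c'
  · exact side_of_level d.oB h.2 h.1
  · obtain ⟨k, ⟨h1, h2⟩, h3, h4⟩ := exists_of_level h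
    have h5 := side_of_level d.oB h1 h2
    have h6 := side_of_level d.oC h4 h3
    rw [d.lt_iff, d.lt_iff] at h5
    exact ⟨fun h => h6.1 (h5.1 h), fun h => h6.2 (h5.2 h)⟩
  · obtain ⟨k, ⟨h1, h2⟩, h3, h4⟩ := exists_of_level (level_symm h)
    have h5 := side_of_level d.oB h2 h1
    have h6 := side_of_level d.oC h3 h4
    rw [d.lt_iff, d.lt_iff] at h5
    exact ⟨fun h => h5.1 (h6.1 h), fun h => h5.2 (h6.2 h)⟩
  · exact side_of_level d.oC h.2 h.1

variable (d) in
/-- The canonical amalgam. -/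
def amalg : OBT (B ⊕ C) where
  lt := d.amalgLt
  T := d.amalgT
  lt_asymm x y := by
    refine base_cases (d := d) x y y y ?_ ?_ ?_ ?_
    · rintro x' y' _ _ rfl rfl - -
      simp only [amalgLt_inl]
      exact d.oB.lt_asymm x' y'
    · rintro x' y' _ _ rfl rfl - -
      simp only [amalgLt_inr]
      exact d.oC.lt_asymm x' y'
    · intro i hx hy hz hw
      have hlt := fun x y => not_amalgLt_of_eqv (d := d) (x := x) (y := y) (i := i)
      grind
    · intro i h
      have k0 := amalgLt_iff (d := d) (x := x) (y := y) i
      have k1 := amalgLt_iff (d := d) (x := y) (y := x) i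
      have a := d.above_asymm i
      have s := d.above_split i
      have e := fun x y => left_or_right (d := d) (i := i) (x := x) (y := y)
      have e' := not_left_right (d := d) i
      have e0 := left_right_of_level (d := d) (i := i) (x := x) (y := y)
      have e1 := left_right_of_level (d := d) (i := i) (x := y) (y := x)
      simp only [level, ordComb] at *
      clear * - h k0 k1 a s e e' e0 e1
      grind (splits := 25)
  lt_split x y z := by
    refine base_cases (d := d) x y z z ?_ ?_ ?_ ?_
    · rintro x' y' z' _ rfl rfl rfl -
      simp only [amalgLt_inl]
      exact d.oB.lt_split x' y' z'
    · rintro x' y' z' _ rfl rfl rfl -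
      simp only [amalgLt_inr]
      exact d.oC.lt_split x' y' z'
    · intro i hx hy hz hw
      have hlt := fun x y => not_amalgLt_of_eqv (d := d) (x := x) (y := y) (i := i)
      grind
    · intro i h
      have k0 := amalgLt_iff (d := d) (x := x) (y := y) i
      have k1 := amalgLt_iff (d := d) (x := x) (y := z) i
      have k2 := amalgLt_iff (d := d) (x := z) (y := y) i
      have a := d.above_asymm i
      have s := d.above_split i
      have e := fun x y => left_or_right (d := d) (i := i) (x := x) (y := y)
      have e' := not_left_right (d := d) i
      have e0 := left_right_of_level (d := d) (i := i) (x := x) (y := y)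
      have e1 := left_right_of_level (d := d) (i := i) (x := x) (y := z)
      have e2 := left_right_of_level (d := d) (i := i) (x := y) (y := x)
      have e3 := left_right_of_level (d := d) (i := i) (x := y) (y := z)
      have e4 := left_right_of_level (d := d) (i := i) (x := z) (y := x)
      have e5 := left_right_of_level (d := d) (i := i) (x := z) (y := y)
      simp only [level, ordComb] at *
      clear * - h k0 k1 k2 a s e e' e0 e1 e2 e3 e4 e5
      grind (splits := 25)
  T_symm x y z := by
    refine base_cases (d := d) x y z z ?_ ?_ ?_ ?_
    · rintro x' y' z' _ rfl rfl rfl -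
      simp only [amalgT_inl]
      exact d.oB.T_symm x' y' z'
    · rintro x' y' z' _ rfl rfl rfl -
      simp only [amalgT_inr]
      exact d.oC.T_symm x' y' z'
    · intro i hx hy hz hw
      have hT := fun x y z => not_amalgT_of_eqv (d := d) (x := x) (y := y) (z := z) (i := i)
      grind
    · intro i h
      have k0 := amalgT_iff (d := d) (x := x) (y := y) (z := z) i
      have k1 := amalgT_iff (d := d) (x := y) (y := x) (z := z) i
      have a := d.above_asymm i
      have s := d.above_split i
      simp only [comb, level] at *
      clear * - h k0 k1 a s
      grind (splits := 25)
  T_asymm x y z := by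
    refine base_cases (d := d) x y z z ?_ ?_ ?_ ?_
    · rintro x' y' z' _ rfl rfl rfl -
      simp only [amalgT_inl]
      exact d.oB.T_asymm x' y' z'
    · rintro x' y' z' _ rfl rfl rfl -
      simp only [amalgT_inr]
      exact d.oC.T_asymm x' y' z'
    · intro i hx hy hz hw
      have hT := fun x y z => not_amalgT_of_eqv (d := d) (x := x) (y := y) (z := z) (i := i)
      grind
    · intro i h
      have k0 := amalgT_iff (d := d) (x := x) (y := y) (z := z) i
      have k1 := amalgT_iff (d := d) (x := x) (y := z) (z := y) i
      have a := d.above_asymm i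
      have s := d.above_split i
      simp only [comb, level] at *
      clear * - h k0 k1 a s
      grind (splits := 25)
  T_split x y z w := by
    refine base_cases (d := d) x y z w ?_ ?_ ?_ ?_
    · rintro x' y' z' w' rfl rfl rfl rfl
      simp only [amalgT_inl]
      exact d.oB.T_split x' y' z' w'
    · rintro x' y' z' w' rfl rfl rfl rfl
      simp only [amalgT_inr]
      exact d.oC.T_split x' y' z' w'
    · intro i hx hy hz hw
      have hT := fun x y z => not_amalgT_of_eqv (d := d) (x := x) (y := y) (z := z) (i := i)
      grind
    · intro i h
      have k0 := amalgT_iff (d := d) (x := x) (y := y) (z := z) i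
      have k1 := amalgT_iff (d := d) (x := x) (y := y) (z := w) i
      have k2 := amalgT_iff (d := d) (x := x) (y := w) (z := z) i
      have a := d.above_asymm i
      have s := d.above_split i
      simp only [comb, level] at *
      clear * - h k0 k1 k2 a s
      grind (splits := 25)
  T_self x y := by
    refine base_cases (d := d) x y y y ?_ ?_ ?_ ?_
    · rintro x' y' _ _ rfl rfl - -
      simp only [amalgT_inl, amalgLt_inl]
      exact d.oB.T_self x' y'
    · rintro x' y' _ _ rfl rfl - -
      simp only [amalgT_inr, amalgLt_inr]
      exact d.oC.T_self x' y'
    · intro i hx hy hz hw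
      have hT := fun x y z => not_amalgT_of_eqv (d := d) (x := x) (y := y) (z := z) (i := i)
      have hlt := fun x y => not_amalgLt_of_eqv (d := d) (x := x) (y := y) (i := i)
      grind
    · intro i h
      have k0 := amalgT_iff (d := d) (x := x) (y := x) (z := y) i
      have k1 := amalgLt_iff (d := d) (x := x) (y := y) i
      have k2 := amalgLt_iff (d := d) (x := y) (y := x) i
      have a := d.above_asymm i
      have s := d.above_split i
      have e := fun x y => left_or_right (d := d) (i := i) (x := x) (y := y)
      have e' := not_left_right (d := d) i
      have e0 := left_right_of_level (d := d) (i := i) (x := x) (y := y)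
      have e1 := left_right_of_level (d := d) (i := i) (x := y) (y := x)
      simp only [comb, level, ordComb] at *
      clear * - h k0 k1 k2 a s e e' e0 e1
      grind (splits := 25)
  T_total x y z := by
    refine base_cases (d := d) x y z z ?_ ?_ ?_ ?_
    · rintro x' y' z' _ rfl rfl rfl -
      simp only [amalgT_inl, amalgLt_inl]
      exact d.oB.T_total x' y' z'
    · rintro x' y' z' _ rfl rfl rfl -
      simp only [amalgT_inr, amalgLt_inr]
      exact d.oC.T_total x' y' z'
    · intro i hx hy hz hw
      have hT := fun x y z => not_amalgT_of_eqv (d := d) (x := x) (y := y) (z := z) (i := i)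
      have hlt := fun x y => not_amalgLt_of_eqv (d := d) (x := x) (y := y) (i := i)
      grind
    · intro i h
      have k0 := amalgT_iff (d := d) (x := x) (y := y) (z := z) i
      have k1 := amalgT_iff (d := d) (x := x) (y := z) (z := y) i
      have k2 := amalgT_iff (d := d) (x := y) (y := z) (z := x) i
      have k3 := amalgLt_iff (d := d) (x := x) (y := y) i
      have a := d.above_asymm i
      have s := d.above_split i
      simp only [comb, level, ordComb] at *
      clear * - h k0 k1 k2 k3 a s
      grind (splits := 25)
  T_lt x y z := by
    refine base_cases (d := d) x y z z ?_ ?_ ?_ ?_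
    · rintro x' y' z' _ rfl rfl rfl -
      simp only [amalgT_inl, amalgLt_inl]
      exact d.oB.T_lt x' y' z'
    · rintro x' y' z' _ rfl rfl rfl -
      simp only [amalgT_inr, amalgLt_inr]
      exact d.oC.T_lt x' y' z'
    · intro i hx hy hz hw
      have hT := fun x y z => not_amalgT_of_eqv (d := d) (x := x) (y := y) (z := z) (i := i)
      have hlt := fun x y => not_amalgLt_of_eqv (d := d) (x := x) (y := y) (i := i)
      grind
    · intro i h
      have k0 := amalgT_iff (d := d) (x := x) (y := y) (z := z) i
      have k1 := amalgLt_iff (d := d) (x := x) (y := z) i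
      have k2 := amalgLt_iff (d := d) (x := y) (y := z) i
      have a := d.above_asymm i
      have s := d.above_split i
      have e := fun x y => left_or_right (d := d) (i := i) (x := x) (y := y)
      have e' := not_left_right (d := d) i
      have e0 := left_right_of_level (d := d) (i := i) (x := x) (y := y)
      have e1 := left_right_of_level (d := d) (i := i) (x := x) (y := z)
      have e2 := left_right_of_level (d := d) (i := i) (x := y) (y := x)
      have e3 := left_right_of_level (d := d) (i := i) (x := y) (y := z)
      have e4 := left_right_of_level (d := d) (i := i) (x := z) (y := x)
      have e5 := left_right_of_level (d := d) (i := i) (x := z) (y := y)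
      simp only [comb, level, ordComb] at *
      clear * - h k0 k1 k2 a s e e' e0 e1 e2 e3 e4 e5
      grind (splits := 25)
  T_gt x y z := by
    refine base_cases (d := d) x y z z ?_ ?_ ?_ ?_
    · rintro x' y' z' _ rfl rfl rfl -
      simp only [amalgT_inl, amalgLt_inl]
      exact d.oB.T_gt x' y' z'
    · rintro x' y' z' _ rfl rfl rfl -
      simp only [amalgT_inr, amalgLt_inr]
      exact d.oC.T_gt x' y' z'
    · intro i hx hy hz hw
      have hT := fun x y z => not_amalgT_of_eqv (d := d) (x := x) (y := y) (z := z) (i := i)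
      have hlt := fun x y => not_amalgLt_of_eqv (d := d) (x := x) (y := y) (i := i)
      grind
    · intro i h
      have k0 := amalgT_iff (d := d) (x := x) (y := y) (z := z) i
      have k1 := amalgLt_iff (d := d) (x := z) (y := x) i
      have k2 := amalgLt_iff (d := d) (x := z) (y := y) i
      have a := d.above_asymm i
      have s := d.above_split i
      have e := fun x y => left_or_right (d := d) (i := i) (x := x) (y := y)
      have e' := not_left_right (d := d) i
      have e0 := left_right_of_level (d := d) (i := i) (x := x) (y := y)
      have e1 := left_right_of_level (d := d) (i := i) (x := x) (y := z)
      have e2 := left_right_of_level (d := d) (i := i) (x := y) (y := x)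
      have e3 := left_right_of_level (d := d) (i := i) (x := y) (y := z)
      have e4 := left_right_of_level (d := d) (i := i) (x := z) (y := x)
      have e5 := left_right_of_level (d := d) (i := i) (x := z) (y := y)
      simp only [comb, level, ordComb] at *
      clear * - h k0 k1 k2 a s e e' e0 e1 e2 e3 e4 e5
      grind (splits := 25)

theorem not_amalg_lt_of_common (i : I) :
    ¬ d.amalg.lt (.inl (d.u i)) (.inr (d.v i)) ∧ ¬ d.amalg.lt (.inr (d.v i)) (.inl (d.u i)) := by
  have h1 : d.eqv i (.inl (d.u i)) := ⟨d.oB.lt_irrefl _, d.oB.lt_irrefl _⟩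
  have h2 : d.eqv i (.inr (d.v i)) := ⟨d.oC.lt_irrefl _, d.oC.lt_irrefl _⟩
  exact ⟨not_amalgLt_of_eqv h1 h2, not_amalgLt_of_eqv h2 h1⟩

/-! ### Equivariance of the canonical amalgam -/

section equivariance

variable {f : B → B} {g : C → C} {σ : I ≃ I} (hu : ∀ i, d.u (σ i) = f (d.u i))
  (hv : ∀ i, d.v (σ i) = g (d.v i))
  (fT : ∀ x y z, d.oB.T (f x) (f y) (f z) ↔ d.oB.T x y z)
  (gT : ∀ x y z, d.oC.T (g x) (g y) (g z) ↔ d.oC.T x y z)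
  (flt : ∀ x y, d.oB.lt (f x) (f y) ↔ d.oB.lt x y)
  (glt : ∀ x y, d.oC.lt (g x) (g y) ↔ d.oC.lt x y)
include hu hv fT gT

/-- The definition uses only the relations of the factors and quantifiers over all common points, so
reindexing by σ changes nothing. -/
theorem above_map (i : I) (x y : B ⊕ C) :
    d.above (σ i) (x.map f g) (y.map f g) ↔ d.above i x y := by
  rcases x with x | x <;> rcases y with y | y <;>
    simp only [above, Sum.map_inl, Sum.map_inr, hu, hv, fT, gT] <;>
    first
    | rw [← σ.forall_congr_right]; simp only [hu, hv, fT, gT]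
    | rw [← σ.exists_congr_right]; simp only [hu, hv, fT, gT]

theorem amalg_T_map (x y z : B ⊕ C) :
    d.amalg.T (x.map f g) (y.map f g) (z.map f g) ↔ d.amalg.T x y z := by
  apply or_congr
  · rw [← σ.exists_congr_right]
    simp only [comb, above_map hu hv fT gT]
  · rcases x with x | x <;> rcases y with y | y <;> rcases z with z | z <;>
      simp [pureT, fT, gT]

include flt glt

theorem amalg_lt_map (x y : B ⊕ C) :
    d.amalg.lt (x.map f g) (y.map f g) ↔ d.amalg.lt x y := by
  have h1 : ∀ i x, d.left (σ i) (x.map f g) ↔ d.left i x := by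
    rintro i (x | x) <;> simp [left, hu, hv, flt, glt]
  have h2 : ∀ i x, d.right (σ i) (x.map f g) ↔ d.right i x := by
    rintro i (x | x) <;> simp [right, hu, hv, flt, glt]
  apply or_congr
  · rw [← σ.exists_congr_right]
    simp only [ordComb, above_map hu hv fT gT, h1, h2]
  · rcases x with x | x <;> rcases y with y | y <;> simp [pureLt, flt, glt]

end equivariance

end AmalgData
end OBT
-- Binary sequences, meets and lexicographical order
section strings

variable {a b : Bool} {s t r u : List Bool}

@[simp] theorem meet_nil_left : meet [] t = [] := by simp [meet]
@[simp] theorem meet_nil_right : meet s [] = [] := by simp [meet]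
@[simp] theorem meet_cons_self : meet (a :: s) (a :: t) = a :: meet s t := by simp [meet]

theorem meet_cons_of_ne (h : a ≠ b) : meet (a :: s) (b :: t) = [] := by simp [meet, h]

theorem meet_self : meet s s = s := by
  induction s with
  | nil => simp
  | cons a s ih => simp [ih]

theorem meet_comm : meet s t = meet t s := by
  induction s generalizing t with
  | nil => simp
  | cons a s ih =>
    cases t with
    | nil => simp
    | cons b t =>
      by_cases h : a = b
      · subst h; simp [ih (t := t)]
      · rw [meet_cons_of_ne h, meet_cons_of_ne (Ne.symm h)]

theorem meet_prefix_left : meet s t <+: s := by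
  induction s generalizing t with
  | nil => simp
  | cons a s ih =>
    cases t with
    | nil => simp
    | cons b t =>
      by_cases h : a = b
      · subst h; simpa using ih
      · simp [meet_cons_of_ne h]

theorem meet_prefix_right : meet s t <+: t := by
  rw [meet_comm]; exact meet_prefix_left

theorem prefix_meet (hs : r <+: s) (ht : r <+: t) : r <+: meet s t := by
  obtain ⟨s, rfl⟩ := hs
  obtain ⟨t, rfl⟩ := ht
  induction r with
  | nil => simp
  | cons a r ih => simpa using ih

theorem exists_eq_append_of_not_prefix (hs : ¬ s <+: t) (ht : ¬ t <+: s) :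
    ∃ (a b : Bool) (s' t' : List Bool), a ≠ b ∧ s = meet s t ++ a :: s' ∧
      t = meet s t ++ b :: t' := by
  induction s generalizing t with
  | nil => simp at hs
  | cons c s ih =>
    cases t with
    | nil => simp at ht
    | cons d t =>
      by_cases h : c = d
      · subst h
        simp only [List.cons_prefix_cons, true_and] at hs ht
        obtain ⟨a, b, s', t', hab, h1, h2⟩ := ih hs ht
        refine ⟨a, b, s', t', hab, ?_, ?_⟩
        · rw [meet_cons_self, List.cons_append, ← h1]
        · rw [meet_cons_self, List.cons_append, ← h2]
      · exact ⟨c, d, s, t, h, by simp [meet_cons_of_ne h], by simp [meet_cons_of_ne h]⟩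

/-- Incomparable sequences already differ within their own lengths, so extending them does not move
the meet. This later allows leaves to be padded to a common length. -/
theorem meet_append (hs : ¬ s <+: t) (ht : ¬ t <+: s) (u v : List Bool) :
    meet (s ++ u) (t ++ v) = meet s t := by
  induction s generalizing t with
  | nil => simp at hs
  | cons c s ih =>
    cases t with
    | nil => simp at ht
    | cons d t =>
      by_cases h : c = d
      · subst h
        simp only [List.cons_prefix_cons, true_and] at hs ht
        simp [ih hs ht]
      · simp [meet_cons_of_ne h]

theorem lexLT_cons : LexLT (a :: s) (b :: t) ↔ (a = false ∧ b = true) ∨ (a = b ∧ LexLT s t) := by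
  constructor
  · rintro ⟨r, u, v, h1, h2⟩
    cases r with
    | nil => simp_all
    | cons c r =>
      right
      simp only [List.cons_append, List.cons.injEq] at h1 h2
      exact ⟨h1.1.trans h2.1.symm, r, u, v, h1.2, h2.2⟩
  · rintro (⟨rfl, rfl⟩ | ⟨rfl, r, u, v, rfl, rfl⟩)
    · exact ⟨[], s, t, rfl, rfl⟩
    · exact ⟨a :: r, u, v, rfl, rfl⟩

theorem not_lexLT_nil_left : ¬ LexLT [] t := by
  rintro ⟨r, u, v, h, -⟩
  simp at h

theorem not_lexLT_nil_right : ¬ LexLT s [] := by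
  rintro ⟨r, u, v, -, h⟩
  simp at h

theorem lexLT_append (hs : ¬ s <+: t) (ht : ¬ t <+: s) (u v : List Bool) :
    LexLT (s ++ u) (t ++ v) ↔ LexLT s t := by
  induction s generalizing t with
  | nil => simp at hs
  | cons c s ih =>
    cases t with
    | nil => simp at ht
    | cons d t =>
      simp only [List.cons_append, lexLT_cons]
      by_cases h : c = d
      · subst h
        simp only [List.cons_prefix_cons, true_and] at hs ht
        simp [ih hs ht]
      · simp [h]

theorem lexLT_iff : LexLT s t ↔
    s[(meet s t).length]? = some false ∧ t[(meet s t).length]? = some true := by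
  induction s generalizing t with
  | nil => simp [not_lexLT_nil_left]
  | cons c s ih =>
    cases t with
    | nil => simp [not_lexLT_nil_right]
    | cons d t =>
      by_cases h : c = d
      · subst h; simp [lexLT_cons, ih]
      · simp [lexLT_cons, meet_cons_of_ne h, h]

theorem getElem?_of_lt_meet {q : ℕ} (h : q < (meet s t).length) : s[q]? = t[q]? := by
  obtain ⟨s', hs⟩ := meet_prefix_left (s := s) (t := t)
  obtain ⟨t', ht⟩ := meet_prefix_right (s := s) (t := t)
  calc s[q]? = (meet s t ++ s')[q]? := by rw [hs]
    _ = (meet s t ++ t')[q]? := by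
      rw [List.getElem?_append_left h, List.getElem?_append_left h]
    _ = t[q]? := by rw [ht]

end strings

/-- Binary sequences none of which is a proper initial segment of another one. -/
theorem exists_OBT_of_antichain {X : Type*} (φ : X → List Bool)
    (hφ : ∀ x y, φ x <+: φ y → x = y) :
    ∃ o : OBT X, o.Reduced ∧ (∀ x y, o.lt x y ↔ LexLT (φ x) (φ y)) ∧
      ∀ x y z, o.T x y z ↔ (meet (φ x) (φ z)).length < (meet (φ x) (φ y)).length := by
  have hsplit : ∀ x y, x ≠ y → ∃ (a b : Bool) (s' t' : List Bool), a ≠ b ∧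
      φ x = meet (φ x) (φ y) ++ a :: s' ∧ φ y = meet (φ x) (φ y) ++ b :: t' := fun x y h =>
    exists_eq_append_of_not_prefix (fun h' => h (hφ _ _ h')) (fun h' => h (hφ _ _ h').symm)
  have hget : ∀ x y, x ≠ y → ∃ a b : Bool, a ≠ b ∧
      (φ x)[(meet (φ x) (φ y)).length]? = some a ∧ (φ y)[(meet (φ x) (φ y)).length]? = some b := by
    intro x y h
    obtain ⟨a, b, s', t', hab, h1, h2⟩ := hsplit x y h
    exact ⟨a, b, hab, (congrArg (·[(meet (φ x) (φ y)).length]?) h1).trans (by simp),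
      (congrArg (·[(meet (φ x) (φ y)).length]?) h2).trans (by simp)⟩
  obtain ⟨o, ho, hlt, hT⟩ := exists_OBT_of_bits (fun x y => (meet (φ x) (φ y)).length)
    (fun x q => (φ x)[q]? == some true) (fun x y => by rw [meet_comm])
    (fun x y q h => by rw [getElem?_of_lt_meet h])
    (fun x y h => by
      obtain ⟨a, b, hab, h1, h2⟩ := hget x y h
      rw [h1, h2]
      cases a <;> cases b <;> simp_all)
    (fun x y h => by
      obtain ⟨a, b, s', t', hab, h1, h2⟩ := hsplit x y h
      rw [meet_self]
      exact lt_of_lt_of_eq (by simp) (congrArg List.length h1).symm)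
  refine ⟨o, ho, fun x y => ?_, hT⟩
  rw [hlt, lexLT_iff]
  by_cases h : x = y
  · subst h
    simp [meet_self]
  · obtain ⟨a, b, hab, h1, h2⟩ := hget x y h
    simp only [h1, h2]
    cases a <;> cases b <;> simp_all

/-! ### Finite branching structures as leaves of full binary trees -/

/-- The sets of leaves of finite full binary trees. -/
inductive IsLeafSet : Set (List Bool) → Prop
  | leaf : IsLeafSet {[]}
  | node (S S' : Set (List Bool)) : IsLeafSet S → IsLeafSet S' →
      IsLeafSet (List.cons false '' S ∪ List.cons true '' S')

theorem IsLeafSet.antichain {S : Set (List Bool)} (h : IsLeafSet S) :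
    ∀ s ∈ S, ∀ t ∈ S, s <+: t → s = t := by
  induction h with
  | leaf => simp
  | node S S' _ _ ih ih' =>
    rintro _ (⟨s, hs, rfl⟩ | ⟨s, hs, rfl⟩) _ (⟨t, ht, rfl⟩ | ⟨t, ht, rfl⟩) h
    · simp only [List.cons_prefix_cons, true_and] at h
      rw [ih s hs t ht h]
    · simp at h
    · simp at h
    · simp only [List.cons_prefix_cons, true_and] at h
      rw [ih' s hs t ht h]

namespace OBT

/-- For the order this gives extreme points; for T seen from a point it gives nearest points. -/
theorem exists_max {X : Type*} (r : X → X → Prop) (asymm : ∀ x y, r x y → ¬ r y x)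
    (split : ∀ x y z, r x y → r x z ∨ r z y) (s : Set X) (hs : s.Finite) (hne : s.Nonempty) :
    ∃ m ∈ s, ∀ x ∈ s, ¬ r m x := by
  induction s, hs using Set.Finite.induction_on with
  | empty => simp at hne
  | @insert a s _ _ ih =>
    rcases s.eq_empty_or_nonempty with rfl | h
    · exact ⟨a, by simp, by simpa using fun h => asymm _ _ h h⟩
    · obtain ⟨m, hm, hm'⟩ := ih h
      by_cases hma : r m a
      · refine ⟨a, by simp, ?_⟩
        rintro x (rfl | hx)
        · exact fun h => asymm _ _ h h
        · intro hax
          rcases split _ _ x hma with h1 | h1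
          · exact hm' x hx h1
          · exact asymm _ _ hax h1
      · refine ⟨m, by simp [hm], ?_⟩
        rintro x (rfl | hx)
        · exact hma
        · exact hm' x hx

/-- Every finite structure is realized by the leaves of a finite full binary tree. -/
theorem exists_leafSet {X : Type*} (o : OBT X) (s : Finset X) (hs : s.Nonempty) :
    ∃ f : X → List Bool, IsLeafSet (f '' s) ∧
      (∀ x ∈ s, ∀ y ∈ s, o.lt x y ↔ LexLT (f x) (f y)) ∧
      (∀ x ∈ s, ∀ y ∈ s, ∀ z ∈ s,
        o.T x y z ↔ (meet (f x) (f z)).length < (meet (f x) (f y)).length) := by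
  classical
  induction s using Finset.strongInduction with
  | H s ih =>
  obtain ⟨y, hy, hmax⟩ := exists_max o.lt o.lt_asymm o.lt_split (s : Set X) s.finite_toSet hs
  obtain ⟨x, hx, hmin⟩ := exists_max (fun x y => o.lt y x) (fun x y => o.lt_asymm y x)
    (fun x y z h => (o.lt_split y x z h).symm) (s : Set X) s.finite_toSet hs
  simp only [Finset.mem_coe] at hx hy hmax hmin
  by_cases hxy : o.lt x y
  · have hA : ∀ z ∈ s, o.T x z y ∨ o.T y z x := by
      intro z hz
      rcases o.T_total x y z hxy with h | h | h
      · rcases o.T_ne h with h1 | h1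
        · exact absurd (o.T_lt _ _ _ h h1) (hmax z hz)
        · exact absurd h1 (hmin z hz)
      · exact Or.inl h
      · exact Or.inr h
    have hA' : ∀ z, o.T x z y → ¬ o.T y z x := fun z h => (o.not_T_of_branch h).1
    have hB1 : ∀ z w, o.T x z y → o.T y w x → o.T x z w := by
      intro z w hz hw
      rcases o.T_split _ _ _ w hz with h | h
      · exact h
      · exact absurd hw (hA' _ h)
    have hB2 : ∀ z w, o.T x z y → o.T y w x → o.T y w z := by
      intro z w hz hw
      rcases o.T_split _ _ _ z hw with h | h
      · exact h
      · exact absurd h (hA' _ hz)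
    have hB3 : ∀ z w, o.T x z y → o.T y w x → o.lt z w := fun z w hz hw =>
      o.T_lt _ _ _ (hB1 z w hz hw) (o.T_gt _ _ _ hw hxy)
    have hB4 : ∀ z z' w, o.T x z y → o.T x z' y → o.T y w x → o.T z z' w :=
      fun z z' w h1 h2 h3 => o.T_of_deeper (hB1 z w h1 h3) (hB1 z' w h2 h3)
    have hB5 : ∀ z w w', o.T x z y → o.T y w x → o.T y w' x → o.T w w' z :=
      fun z w w' h1 h2 h3 => o.T_of_deeper (hB2 z w h1 h2) (hB2 z w' h1 h3)
    obtain ⟨f, hf, hflt, hfT⟩ := ih (s.filter fun z => o.T x z y)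
      ⟨Finset.filter_subset _ _, fun h => by
        have := (Finset.mem_filter.1 (h hy)).2
        exact o.T_irrefl _ _ this⟩
      ⟨x, Finset.mem_filter.2 ⟨hx, (o.T_self _ _).2 (Or.inl hxy)⟩⟩
    obtain ⟨g, hg, hglt, hgT⟩ := ih (s.filter fun z => o.T y z x)
      ⟨Finset.filter_subset _ _, fun h => by
        have := (Finset.mem_filter.1 (h hx)).2
        exact o.T_irrefl _ _ this⟩
      ⟨y, Finset.mem_filter.2 ⟨hy, (o.T_self _ _).2 (Or.inr hxy)⟩⟩
    simp only [Finset.mem_filter] at hflt hfT hglt hgT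
    let F : X → List Bool := fun z => if o.T x z y then false :: f z else true :: g z
    have F0 : ∀ z, o.T x z y → F z = false :: f z := fun z h => if_pos h
    have F1 : ∀ z, o.T y z x → F z = true :: g z := fun z h => if_neg (fun h' => hA' z h' h)
    refine ⟨F, ?_, ?_, ?_⟩
    · have : F '' s = List.cons false '' (f '' (s.filter fun z => o.T x z y)) ∪
          List.cons true '' (g '' (s.filter fun z => o.T y z x)) := by
        ext l
        simp only [Set.mem_image, Set.mem_union, Finset.coe_filter, Set.mem_ofPred_eq,
          Finset.mem_coe, exists_exists_and_eq_and]
        constructor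
        · rintro ⟨z, hz, rfl⟩
          rcases hA z hz with h | h
          · exact Or.inl ⟨z, ⟨hz, h⟩, (F0 z h).symm⟩
          · exact Or.inr ⟨z, ⟨hz, h⟩, (F1 z h).symm⟩
        · rintro (⟨z, ⟨hz, h⟩, rfl⟩ | ⟨z, ⟨hz, h⟩, rfl⟩)
          · exact ⟨z, hz, F0 z h⟩
          · exact ⟨z, hz, F1 z h⟩
      rw [this]
      exact IsLeafSet.node _ _ hf hg
    · intro z hz w hw
      rcases hA z hz with h1 | h1 <;> rcases hA w hw with h2 | h2
      · rw [F0 z h1, F0 w h2, hflt z ⟨hz, h1⟩ w ⟨hw, h2⟩]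
        simp [lexLT_cons]
      · rw [F0 z h1, F1 w h2]
        simp [lexLT_cons, hB3 z w h1 h2]
      · rw [F1 z h1, F0 w h2]
        simp [lexLT_cons, o.lt_asymm _ _ (hB3 w z h2 h1)]
      · rw [F1 z h1, F1 w h2, hglt z ⟨hz, h1⟩ w ⟨hw, h2⟩]
        simp [lexLT_cons]
    · intro z hz w hw v hv
      have m1 : ∀ s t, meet (true :: s) (false :: t) = [] := fun s t => meet_cons_of_ne (by simp)
      have m2 : ∀ s t, meet (false :: s) (true :: t) = [] := fun s t => meet_cons_of_ne (by simp)
      rcases hA z hz with h1 | h1 <;> rcases hA w hw with h2 | h2 <;> rcases hA v hv with h3 | h3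
      · rw [F0 z h1, F0 w h2, F0 v h3, hfT z ⟨hz, h1⟩ w ⟨hw, h2⟩ v ⟨hv, h3⟩]
        simp
      · rw [F0 z h1, F0 w h2, F1 v h3]
        simp [m2, hB4 z w v h1 h2 h3]
      · rw [F0 z h1, F1 w h2, F0 v h3]
        simp [m2, o.T_asymm _ _ _ (hB4 z v w h1 h3 h2)]
      · rw [F0 z h1, F1 w h2, F1 v h3]
        simp [m2]
        exact fun h => o.T_rot h (hB5 z w v h1 h2 h3)
      · rw [F1 z h1, F0 w h2, F0 v h3]
        simp [m1]
        exact fun h => o.T_rot h (hB4 w v z h2 h3 h1)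
      · rw [F1 z h1, F0 w h2, F1 v h3]
        simp [m1, o.T_asymm _ _ _ (hB5 w z v h2 h1 h3)]
      · rw [F1 z h1, F1 w h2, F0 v h3]
        simp [m1, hB5 v z w h3 h1 h2]
      · rw [F1 z h1, F1 w h2, F1 v h3, hgT z ⟨hz, h1⟩ w ⟨hw, h2⟩ v ⟨hv, h3⟩]
        simp
  · have hno : ∀ z ∈ s, ∀ w ∈ s, ¬ o.lt z w := by
      intro z hz w hw h
      have h1 := o.lt_split _ _ x h
      have h2 := hmin z hz
      have h3 := o.lt_split x w y (h1.resolve_left h2)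
      have h4 := hmax w hw
      tauto
    -- No two points are comparable, and the structure need not be reduced, so all of them go to a
    -- single leaf.
    refine ⟨fun _ => [], ?_, ?_, ?_⟩
    · have : (fun _ => []) '' (s : Set X) = ({[]} : Set (List Bool)) := by
        ext l; simp [hs.exists_mem, eq_comm]
      rw [this]; exact IsLeafSet.leaf
    · intro z hz w hw
      simp [hno z hz w hw, not_lexLT_nil_left]
    · intro z hz w hw v hv
      refine iff_of_false (fun h => ?_) (by simp)
      rcases o.T_ne h with h1 | h1
      · exact hno _ hz _ hv h1
      · exact hno _ hv _ hz h1

end OBT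
-- The graph of a full binary tree with its root suppressed
/-- The neighbour of a nonempty binary sequence in the direction of the edge between `0` and `1`. -/
def par (s : List Bool) : List Bool := if s.length = 1 then s.map not else s.dropLast

theorem par_singleton (b : Bool) : par [b] = [!b] := by simp [par]

theorem par_append {s : List Bool} (hs : s ≠ []) (b : Bool) : par (s ++ [b]) = s := by
  have : 0 < s.length := List.length_pos_of_ne_nil hs
  rw [par, if_neg (by simp; omega)]
  simp

theorem par_cases {s : List Bool} (hs : s ≠ []) :
    (∃ b, s = [b] ∧ par s = [!b]) ∨ (∃ t b, t ≠ [] ∧ s = t ++ [b] ∧ par s = t) := by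
  rcases List.eq_nil_or_concat s with h | ⟨t, b, rfl⟩
  · exact absurd h hs
  · rw [List.concat_eq_append] at *
    by_cases ht : t = []
    · subst ht
      exact Or.inl ⟨b, rfl, par_singleton b⟩
    · exact Or.inr ⟨t, b, ht, rfl, par_append ht b⟩

/-- The graph of binary sequences with a given property: `s` is joined to `s0` and `s1`, and the
vertices `0` and `1` are joined to each other. -/
def seqGraph (p : List Bool → Prop) : SimpleGraph {s // p s} :=
  SimpleGraph.fromRel fun s t =>
    (∃ i : Bool, t.1 = s.1 ++ [i]) ∨ (s.1 = [false] ∧ t.1 = [true])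

/-- The nonempty initial segments of the leaves of a full binary tree. -/
structure FullTree (p : List Bool → Prop) : Prop where
  ne_nil : ∀ s, p s → s ≠ []
  root : ∀ b, p [b]
  init : ∀ s b, s ≠ [] → p (s ++ [b]) → p s
  sibling : ∀ s b b', s ≠ [] → p (s ++ [b]) → p (s ++ [b'])

namespace FullTree

variable {p : List Bool → Prop} (hp : FullTree p)
include hp

/-- Every edge points from a vertex towards the middle edge; the middle edge itself does so in both
directions, since `par` exchanges 0 and 1. -/
theorem adj_iff (x y : {s // p s}) :
    (seqGraph p).Adj x y ↔ y.1 = par x.1 ∨ x.1 = par y.1 := by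
  obtain ⟨s, hs⟩ := x
  obtain ⟨t, ht⟩ := y
  have hs' := hp.ne_nil s hs
  have ht' := hp.ne_nil t ht
  simp only [seqGraph, SimpleGraph.fromRel_adj, ne_eq, Subtype.mk.injEq]
  constructor
  · rintro ⟨-, (⟨i, rfl⟩ | ⟨rfl, rfl⟩) | (⟨i, rfl⟩ | ⟨rfl, rfl⟩)⟩
    · exact Or.inr (par_append hs' i).symm
    · simp [par]
    · exact Or.inl (par_append ht' i).symm
    · simp [par]
  · have key : ∀ s t : List Bool, s ≠ [] → t = par s → s ≠ t ∧
        (((∃ i : Bool, t = s ++ [i]) ∨ (s = [false] ∧ t = [true])) ∨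
          ((∃ i : Bool, s = t ++ [i]) ∨ (t = [false] ∧ s = [true]))) := by
      rintro s t hs h
      rcases par_cases hs with ⟨b, rfl, h'⟩ | ⟨r, b, hr, rfl, h'⟩
      · rw [h'] at h
        subst h
        cases b <;> simp
      · rw [h'] at h
        subst h
        simp
    rintro (h | h)
    · exact key s t hs' h
    · obtain ⟨h1, h2⟩ := key t s ht' h
      exact ⟨Ne.symm h1, h2.symm⟩

theorem of_prefix {s t : List Bool} (hs : s ≠ []) (h : s <+: t) (ht : p t) : p s := by
  obtain ⟨u, rfl⟩ := h
  induction u using List.reverseRecOn with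
  | nil => simpa using ht
  | append_singleton u b ih =>
    rw [← List.append_assoc] at ht
    exact ih (hp.init _ b (by simp [hs]) ht)

theorem par_mem {s : List Bool} (hs : p s) : p (par s) := by
  rcases par_cases (hp.ne_nil s hs) with ⟨b, rfl, h'⟩ | ⟨r, b, hr, rfl, h'⟩
  · rw [h']; exact hp.root _
  · rw [h']; exact hp.init _ _ hr hs

/-- The vertices extending u are joined to the rest by a single edge, the one from u to `par u`.
This cut yields both acyclicity and the vertices that an arc must visit. -/
theorem eq_of_boundary {u : List Bool} (hu : u ≠ []) {x y : {s // p s}}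
    (h : (seqGraph p).Adj x y) (hx : u <+: x.1) (hy : ¬ u <+: y.1) : x.1 = u ∧ y.1 = par u := by
  rw [hp.adj_iff] at h
  rcases h with h | h
  · suffices x.1 = u by rw [h, this]; simp
    rcases par_cases (hp.ne_nil _ x.2) with ⟨b, h1, h'⟩ | ⟨r, b, hr, h1, h'⟩
    · rw [h1] at hx ⊢
      rcases List.prefix_cons_iff.1 hx with h2 | ⟨v, h2, h3⟩
      · exact absurd h2 hu
      · simp only [List.prefix_nil] at h3
        rw [h2, h3]
    · rw [h1, List.prefix_concat_iff] at hx
      rcases hx with h2 | h2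
      · rw [h1, h2]
      · rw [h, h'] at hy
        exact absurd h2 hy
  · rcases par_cases (hp.ne_nil _ y.2) with ⟨b, h1, h'⟩ | ⟨r, b, hr, h1, h'⟩
    · rw [h, h'] at hx
      have h2 : u = [!b] := by
        rcases List.prefix_cons_iff.1 hx with h2 | ⟨v, h2, h3⟩
        · exact absurd h2 hu
        · simp only [List.prefix_nil] at h3
          rw [h2, h3]
      rw [h, h', h2, par_singleton, h1]
      simp
    · rw [h, h'] at hx
      rw [h1] at hy
      exact absurd (hx.trans (List.prefix_append _ _)) hy

theorem mem_support_of_separates {u : List Bool} (hu : u ≠ []) {x y : {s // p s}}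
    (w : (seqGraph p).Walk x y) (hx : u <+: x.1) (hy : ¬ u <+: y.1) :
    (∃ v ∈ w.support, v.1 = u) ∧ ∃ v ∈ w.support, v.1 = par u := by
  obtain ⟨d, hd, h1, h2⟩ := w.exists_boundary_dart {v | u <+: v.1} hx hy
  obtain ⟨h3, h4⟩ := hp.eq_of_boundary hu d.adj h1 h2
  exact ⟨⟨d.fst, w.dart_fst_mem_support_of_mem_darts hd, h3⟩,
    ⟨d.snd, w.dart_snd_mem_support_of_mem_darts hd, h4⟩⟩

/-- The walk down to an initial segment. -/
theorem exists_walk_prefix {r s : List Bool} (hr : r ≠ []) (hrs : r <+: s) (hs : p s) :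
    ∃ w : (seqGraph p).Walk ⟨s, hs⟩ ⟨r, hp.of_prefix hr hrs hs⟩,
      ∀ v ∈ w.support, r <+: v.1 ∧ v.1 <+: s := by
  obtain ⟨u, rfl⟩ := hrs
  induction u using List.reverseRecOn with
  | nil =>
    have h : (⟨r ++ [], hs⟩ : {s // p s}) = ⟨r, hp.of_prefix hr ⟨[], rfl⟩ hs⟩ := by simp
    exact ⟨SimpleGraph.Walk.nil.copy rfl h, by simp⟩
  | append_singleton u b ih =>
    have hs' := hs
    rw [← List.append_assoc] at hs'
    have hne : r ++ u ≠ [] := by simp [hr]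
    obtain ⟨w, hw⟩ := ih (hp.init _ b hne hs')
    have hadj : (seqGraph p).Adj ⟨r ++ (u ++ [b]), hs⟩ ⟨r ++ u, hp.init _ b hne hs'⟩ := by
      rw [hp.adj_iff]
      left
      simp only [← List.append_assoc]
      exact (par_append hne b).symm
    refine ⟨.cons hadj w, ?_⟩
    intro v hv
    rw [SimpleGraph.Walk.support_cons, List.mem_cons] at hv
    rcases hv with rfl | hv
    · simp
    · refine ⟨(hw v hv).1, (hw v hv).2.trans ?_⟩
      rw [← List.append_assoc]
      exact List.prefix_append _ _

/-- The arc between two vertices. -/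
theorem exists_walk (x y : {s // p s}) : ∃ w : (seqGraph p).Walk x y,
    ∀ v ∈ w.support, meet x.1 y.1 <+: v.1 ∧ (v.1 <+: x.1 ∨ v.1 <+: y.1) := by
  obtain ⟨s, hs⟩ := x
  obtain ⟨t, ht⟩ := y
  -- If the meet is the removed root, the arc crosses the edge between 0 and 1.
  by_cases h : meet s t = []
  · have hs' := hp.ne_nil s hs
    have ht' := hp.ne_nil t ht
    obtain ⟨a, s, rfl⟩ := List.exists_cons_of_ne_nil hs'
    obtain ⟨b, t, rfl⟩ := List.exists_cons_of_ne_nil ht'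
    have hab : a ≠ b := by
      rintro rfl
      simp at h
    obtain ⟨w, hw⟩ := hp.exists_walk_prefix (r := [a]) (by simp) (by simp) hs
    obtain ⟨w', hw'⟩ := hp.exists_walk_prefix (r := [b]) (by simp) (by simp) ht
    have hadj : (seqGraph p).Adj ⟨[a], hp.root a⟩ ⟨[b], hp.root b⟩ := by
      rw [hp.adj_iff]
      left
      simp only [par_singleton]
      cases a <;> cases b <;> simp_all
    refine ⟨w.append (.cons hadj w'.reverse), ?_⟩
    intro v hv
    rw [SimpleGraph.Walk.mem_support_append_iff, SimpleGraph.Walk.support_cons,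
      List.mem_cons, SimpleGraph.Walk.support_reverse, List.mem_reverse] at hv
    simp only [h, List.nil_prefix, true_and]
    rcases hv with hv | rfl | hv
    · exact Or.inl (hw v hv).2
    · simp
    · exact Or.inr (hw' v hv).2
  · obtain ⟨w, hw⟩ := hp.exists_walk_prefix h meet_prefix_left hs
    obtain ⟨w', hw'⟩ := hp.exists_walk_prefix h meet_prefix_right ht
    refine ⟨w.append w'.reverse, ?_⟩
    intro v hv
    rw [SimpleGraph.Walk.mem_support_append_iff, SimpleGraph.Walk.support_reverse,
      List.mem_reverse] at hv
    rcases hv with hv | hv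
    · exact ⟨(hw v hv).1, Or.inl (hw v hv).2⟩
    · exact ⟨(hw' v hv).1, Or.inr (hw' v hv).2⟩

/-- Every edge is a bridge: a walk leaving the sequences that extend its lower end must cross that
very edge. -/
theorem isTree : (seqGraph p).IsTree := by
  refine ⟨?_, ?_⟩
  · have : Nonempty {s // p s} := ⟨⟨[false], hp.root _⟩⟩
    refine ⟨fun x y => ?_⟩
    obtain ⟨w, -⟩ := hp.exists_walk x y
    exact ⟨w⟩
  · rw [SimpleGraph.isAcyclic_iff_forall_adj_isBridge]
    have key : ∀ x y : {s // p s}, y.1 = par x.1 → (seqGraph p).IsBridge s(x, y) := by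
      intro x y h
      rw [SimpleGraph.isBridge_iff_forall_walk_mem_edges]
      intro w
      have hx := hp.ne_nil _ x.2
      have hy : ¬ x.1 <+: y.1 := by
        rw [h]
        intro h'
        rcases par_cases hx with ⟨b, h1, h2⟩ | ⟨r, b, hr, h1, h2⟩
        · rw [h1, par_singleton] at h'
          simp at h'
        · rw [h2] at h'
          have := h'.length_le
          rw [h1] at this
          simp at this
      obtain ⟨d, hd, h1, h2⟩ := w.exists_boundary_dart {v | x.1 <+: v.1} (List.prefix_refl _) hy
      obtain ⟨h3, h4⟩ := hp.eq_of_boundary hx d.adj h1 h2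
      have h5 : d.fst = x := Subtype.ext h3
      have h6 : d.snd = y := Subtype.ext (h4.trans h.symm)
      rw [SimpleGraph.Walk.edges, List.mem_map]
      refine ⟨d, hd, ?_⟩
      rw [← h5, ← h6]
      rfl
    intro x y h
    rw [hp.adj_iff] at h
    rcases h with h | h
    · exact key x y h
    · rw [Sym2.eq_swap]; exact key y x h

theorem neighborSet_image (x : {s // p s}) : Subtype.val '' ((seqGraph p).neighborSet x) =
    {par x.1} ∪ {t | p t ∧ ∃ b, t = x.1 ++ [b]} := by
  ext t
  simp only [Set.mem_image, SimpleGraph.mem_neighborSet, hp.adj_iff, Subtype.exists,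
    exists_and_right, exists_eq_right, Set.mem_union, Set.mem_singleton_iff, Set.mem_ofPred_eq]
  constructor
  · rintro ⟨ht, h | h⟩
    · exact Or.inl h
    · rcases par_cases (hp.ne_nil _ ht) with ⟨b, rfl, h'⟩ | ⟨r, b, hr, rfl, h'⟩
      · left
        rw [h, h', par_singleton]; simp
      · right
        exact ⟨ht, b, by rw [h, h']⟩
  · rintro (rfl | ⟨ht, b, rfl⟩)
    · exact ⟨hp.par_mem x.2, Or.inl rfl⟩
    · exact ⟨ht, Or.inr (par_append (hp.ne_nil _ x.2) b).symm⟩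

theorem ncard_neighborSet (x : {s // p s}) :
    (¬ p (x.1 ++ [false]) ∧ ((seqGraph p).neighborSet x).ncard = 1) ∨
    (p (x.1 ++ [false]) ∧ ((seqGraph p).neighborSet x).ncard = 3) := by
  have hx := hp.ne_nil _ x.2
  rw [← Set.ncard_image_of_injective _ Subtype.val_injective, hp.neighborSet_image]
  by_cases h : p (x.1 ++ [false])
  · right
    refine ⟨h, ?_⟩
    have h1 : {t | p t ∧ ∃ b, t = x.1 ++ [b]} = {x.1 ++ [false], x.1 ++ [true]} := by
      ext t
      simp only [Set.mem_ofPred_eq, Set.mem_insert_iff, Set.mem_singleton_iff]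
      constructor
      · rintro ⟨-, b, rfl⟩
        cases b <;> simp
      · rintro (rfl | rfl)
        · exact ⟨h, _, rfl⟩
        · exact ⟨hp.sibling _ _ _ hx h, _, rfl⟩
    have hlen : (par x.1).length ≤ x.1.length := by
      rcases par_cases hx with ⟨b, h1, h2⟩ | ⟨r, b, hr, h1, h2⟩
      · rw [h1, par_singleton]; simp
      · rw [h2, h1]; simp
    have h2 : ∀ b, par x.1 ≠ x.1 ++ [b] := fun b h => by
      rw [h] at hlen
      simp at hlen
    rw [h1, Set.singleton_union, Set.ncard_eq_three]
    exact ⟨_, _, _, h2 _, h2 _, by simp, rfl⟩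
  · left
    refine ⟨h, ?_⟩
    have h1 : {t | p t ∧ ∃ b, t = x.1 ++ [b]} = ∅ := by
      ext t
      simp only [Set.mem_ofPred_eq, Set.mem_empty_iff_false, iff_false]
      rintro ⟨ht, b, rfl⟩
      exact h (hp.sibling _ _ _ hx ht)
    rw [h1, Set.union_empty, Set.ncard_singleton]

theorem isBoronGraph : IsBoronGraph (seqGraph p) :=
  ⟨hp.isTree, fun x => (hp.ncard_neighborSet x).imp And.right And.right⟩

theorem mem_endpoints (x : {s // p s}) : x ∈ endpoints (seqGraph p) ↔ ¬ p (x.1 ++ [false]) := by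
  rcases hp.ncard_neighborSet x with ⟨h, h'⟩ | ⟨h, h'⟩ <;>
    rw [endpoints, Set.mem_ofPred_eq, h'] <;> simp [h]

theorem endpoints_antichain {x y : {s // p s}} (hx : x ∈ endpoints (seqGraph p))
    (h : x.1 <+: y.1) : x = y := by
  rw [hp.mem_endpoints] at hx
  obtain ⟨u, hu⟩ := h
  cases u with
  | nil => exact Subtype.ext (by simpa using hu)
  | cons b u =>
    exfalso
    have hx' := hp.ne_nil _ x.2
    exact hx (hp.sibling _ b _ hx' (hp.of_prefix (by simp) ⟨u, by simpa using hu⟩ y.2))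

/-- A walk between distinct endpoints passes through the place where they branch off. -/
theorem exists_mem_support_meet {x y : {s // p s}} (hx : ¬ x.1 <+: y.1) (hy : ¬ y.1 <+: x.1)
    (w : (seqGraph p).Walk x y) :
    ∃ v ∈ w.support, v.1 = if meet x.1 y.1 = [] then [false] else meet x.1 y.1 := by
  obtain ⟨a, b, s, t, hab, h1, h2⟩ := exists_eq_append_of_not_prefix hx hy
  set m := meet x.1 y.1 with hm
  obtain ⟨h3, h4⟩ := hp.mem_support_of_separates (u := m ++ [a]) (by simp) w
    ⟨s, by rw [h1]; simp⟩ (fun h => by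
      rw [h2] at h
      rw [List.prefix_append_right_inj] at h
      simp [hab] at h)
  -- At the removed root both ends of the middle edge are visited; `[false]` is the fixed
  -- representative, so that two such arcs visibly meet.
  split_ifs with h
  · rw [h] at h3 h4
    simp only [List.nil_append, par_singleton] at h3 h4
    cases a
    · exact h3
    · exact h4
  · rw [par_append h] at h4
    exact h4

/-- An arc consists of extensions of the meet of its ends that are initial segments of one of the
ends. So if the meet of one pair is an initial segment of neither end of the other arc, the arcs are
disjoint. Otherwise the two meets are comparable: if equal, both arcs pass there; if not, the longer
one separates the ends of the other arc and lies on both. -/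
theorem quartet_iff {a b c d : {s // p s}} (ha : a ∈ endpoints (seqGraph p))
    (hb : b ∈ endpoints (seqGraph p)) (hc : c ∈ endpoints (seqGraph p))
    (hd : d ∈ endpoints (seqGraph p)) :
    Quartet (seqGraph p) a b c d ↔ [a, b, c, d].Nodup ∧
      (((meet a.1 c.1).length < (meet a.1 b.1).length ∧
        (meet a.1 d.1).length < (meet a.1 b.1).length) ∨
      ((meet c.1 a.1).length < (meet c.1 d.1).length ∧
        (meet c.1 b.1).length < (meet c.1 d.1).length)) := by
  classical
  refine and_congr_right fun hnd => ?_
  have hT : ∀ x y z : {s // p s}, (meet x.1 z.1).length < (meet x.1 y.1).length ↔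
      ¬ meet x.1 y.1 <+: z.1 := by
    intro x y z
    rw [← not_le, not_iff_not]
    constructor
    · intro h
      exact (List.prefix_of_prefix_length_le meet_prefix_left meet_prefix_left h).trans
        meet_prefix_right
    · intro h
      exact (prefix_meet meet_prefix_left h).length_le
  simp only [hT]
  have hne : ∀ x y : {s // p s}, x ∈ endpoints (seqGraph p) → x ≠ y → ¬ x.1 <+: y.1 :=
    fun x y hx hxy h => hxy (hp.endpoints_antichain hx h)
  simp only [List.nodup_cons, List.mem_cons, List.not_mem_nil, or_false, not_or] at hnd
  constructor
  · rintro ⟨w, w', -, -, hdisj⟩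
    have hcommon : ¬ ∃ v ∈ w.support, ∃ v' ∈ w'.support, v.1 = v'.1 := by
      rintro ⟨v, hv, v', hv', h⟩
      rw [Subtype.ext h] at hv
      exact hdisj v' ⟨hv, hv'⟩
    by_contra! hcon
    obtain ⟨h1, h2⟩ := hcon
    set m := meet a.1 b.1 with hm
    set n := meet c.1 d.1 with hn
    have hab := hne a b ha (by tauto)
    have hba := hne b a hb (by tauto)
    have hcd := hne c d hc (by tauto)
    have hdc := hne d c hd (by tauto)
    obtain ⟨v, hv, hv1⟩ := hp.exists_mem_support_meet hab hba w
    obtain ⟨v', hv', hv1'⟩ := hp.exists_mem_support_meet hcd hdc w'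
    rw [← hm] at hv1
    rw [← hn] at hv1'
    have hma : m <+: a.1 := meet_prefix_left
    have hmb : m <+: b.1 := meet_prefix_right
    have hnc : n <+: c.1 := meet_prefix_left
    have hnd' : n <+: d.1 := meet_prefix_right
    by_cases hmn : m = n
    · exact hcommon ⟨v, hv, v', hv', by rw [hv1, hv1', hmn]⟩
    · have hn' : n <+: a.1 ∨ n <+: b.1 := by tauto
      have hm' : m <+: c.1 ∨ m <+: d.1 := by tauto
      have hcomp : m <+: n ∨ n <+: m := by
        rcases hn' with h | h
        · exact List.prefix_or_prefix_of_prefix hma h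
        · exact List.prefix_or_prefix_of_prefix hmb h
      rcases hcomp with hcomp | hcomp
      · have hn0 : n ≠ [] := by
          rintro h
          rw [h, List.prefix_nil] at hcomp
          exact hmn (hcomp.trans h.symm)
        have hnm : ¬ n <+: m := fun h => hmn (hcomp.eq_of_length_le h.length_le)
        rw [if_neg hn0] at hv1'
        rcases hn' with h | h
        · obtain ⟨⟨z, hz, hz1⟩, -⟩ := hp.mem_support_of_separates hn0 w h
            (fun h' => hnm (prefix_meet h h'))
          exact hcommon ⟨z, hz, v', hv', by rw [hz1, hv1']⟩
        · obtain ⟨⟨z, hz, hz1⟩, -⟩ := hp.mem_support_of_separates hn0 w.reverse h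
            (fun h' => hnm (prefix_meet h' h))
          rw [SimpleGraph.Walk.support_reverse, List.mem_reverse] at hz
          exact hcommon ⟨z, hz, v', hv', by rw [hz1, hv1']⟩
      · have hm0 : m ≠ [] := by
          rintro h
          rw [h, List.prefix_nil] at hcomp
          exact hmn (h.trans hcomp.symm)
        have hmn' : ¬ m <+: n := fun h => hmn (h.eq_of_length_le hcomp.length_le)
        rw [if_neg hm0] at hv1
        rcases hm' with h | h
        · obtain ⟨⟨z, hz, hz1⟩, -⟩ := hp.mem_support_of_separates hm0 w' h
            (fun h' => hmn' (prefix_meet h h'))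
          exact hcommon ⟨v, hv, z, hz, by rw [hz1, hv1]⟩
        · obtain ⟨⟨z, hz, hz1⟩, -⟩ := hp.mem_support_of_separates hm0 w'.reverse h
            (fun h' => hmn' (prefix_meet h' h))
          rw [SimpleGraph.Walk.support_reverse, List.mem_reverse] at hz
          exact hcommon ⟨v, hv, z, hz, by rw [hz1, hv1]⟩
  · intro h
    obtain ⟨w, hw⟩ := hp.exists_walk a b
    obtain ⟨w', hw'⟩ := hp.exists_walk c d
    refine ⟨w.bypass, w'.bypass, w.bypass_isPath, w'.bypass_isPath, ?_⟩
    rintro v ⟨hv, hv'⟩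
    obtain ⟨h1, h2⟩ := hw v (w.support_bypass_subset_support hv)
    obtain ⟨h3, h4⟩ := hw' v (w'.support_bypass_subset_support hv')
    rcases h with ⟨h5, h6⟩ | ⟨h5, h6⟩
    · rcases h4 with h4 | h4
      · exact h5 (h1.trans h4)
      · exact h6 (h1.trans h4)
    · rcases h2 with h2 | h2
      · exact h5 (h3.trans h2)
      · exact h6 (h3.trans h2)

end FullTree
namespace IsLeafSet

variable {S : Set (List Bool)}

theorem nonempty (h : IsLeafSet S) : S.Nonempty := by
  induction h with
  | leaf => simp
  | node S S' _ _ ih _ => exact (ih.image _).mono Set.subset_union_left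

theorem extend (h : IsLeafSet S) : ∀ s b b', (∃ l ∈ S, s ++ [b] <+: l) →
    ∃ l ∈ S, s ++ [b'] <+: l := by
  induction h with
  | leaf => simp
  | node S S' hS hS' ih ih' =>
    rintro (_ | ⟨c, s⟩) b b' ⟨l, hl, hsl⟩
    · obtain ⟨l0, h0⟩ := hS.nonempty
      obtain ⟨l1, h1⟩ := hS'.nonempty
      cases b'
      · exact ⟨false :: l0, Or.inl ⟨_, h0, rfl⟩, by simp⟩
      · exact ⟨true :: l1, Or.inr ⟨_, h1, rfl⟩, by simp⟩
    · rcases hl with ⟨l, hl, rfl⟩ | ⟨l, hl, rfl⟩ <;>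
        simp only [List.cons_append, List.cons_prefix_cons] at hsl
      · obtain ⟨l', hl', h'⟩ := ih s b b' ⟨l, hl, hsl.2⟩
        exact ⟨false :: l', Or.inl ⟨_, hl', rfl⟩, by simpa [hsl.1] using h'⟩
      · obtain ⟨l', hl', h'⟩ := ih' s b b' ⟨l, hl, hsl.2⟩
        exact ⟨true :: l', Or.inr ⟨_, hl', rfl⟩, by simpa [hsl.1] using h'⟩

theorem mem_or_extend (h : IsLeafSet S) {s : List Bool} (hs : ∃ l ∈ S, s <+: l) :
    s ∈ S ∨ ∃ l ∈ S, s ++ [false] <+: l := by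
  obtain ⟨l, hl, u, rfl⟩ := hs
  cases u with
  | nil => left; simpa using hl
  | cons b u => exact Or.inr (h.extend s b false ⟨_, hl, u, by simp⟩)

theorem fullTree (h : IsLeafSet S) (h' : S ≠ {[]}) :
    FullTree (fun s => s ≠ [] ∧ ∃ l ∈ S, s <+: l) := by
  have key : ∀ b, ∃ l ∈ S, [b] <+: l := by
    obtain ⟨l, hl⟩ := h.nonempty
    rcases l with _ | ⟨c, l⟩
    · exfalso
      apply h'
      ext t
      constructor
      · intro ht
        exact (h.antichain _ hl _ ht (by simp)).symm
      · rintro rfl; exact hl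
    · exact fun b => h.extend [] c b ⟨_, hl, by simp⟩
  refine ⟨fun s hs => hs.1, fun b => ⟨by simp, key b⟩, ?_, ?_⟩
  · rintro s b hs ⟨-, l, hl, hsl⟩
    exact ⟨hs, l, hl, (List.prefix_append _ _).trans hsl⟩
  · rintro s b b' hs ⟨-, hl⟩
    exact ⟨by simp, h.extend s b b' hl⟩

end IsLeafSet

theorem fullTree_length {n : ℕ} (hn : 2 ≤ n) : FullTree (fun s => s ≠ [] ∧ s.length < n) where
  ne_nil s hs := hs.1
  root b := ⟨by simp, by simp; omega⟩
  init s b hs h := ⟨hs, by have := h.2; simp at this; omega⟩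
  sibling s b b' hs h := ⟨by simp, by have := h.2; simp at this ⊢; omega⟩

theorem mem_endpoints_binTree {n : ℕ} (hn : 2 ≤ n) (x : BinVertex n) :
    x ∈ endpoints (binTree n) ↔ x.1.length + 1 = n := by
  have h := (fullTree_length hn).mem_endpoints x
  have h2 := x.2.2
  refine h.trans ?_
  simp
  omega

/-! ### Ordered boron trees as branching structures -/

/-- `o` describes the relations of the structure `A`. -/
structure Describes (A : Type) [L.Structure A] (o : OBT A) : Prop where
  reduced : o.Reduced
  lexLE : ∀ a b, LexLE A a b ↔ a = b ∨ o.lt a b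
  ss : ∀ a b c, SS A a b c ↔ o.lt a c ∧ o.lt b c ∧ o.T a b c
  rr : ∀ a b c d, RR A a b c d ↔ [a, b, c, d].Nodup ∧
    ((o.T a b c ∧ o.T a b d) ∨ (o.T c d a ∧ o.T c d b))

/-- S sees T only when the last point is to the right of the others. When z is to the left, the two
competing branchings would be visible to S, with the rightmost point as last entry, so T holds
exactly when neither occurs. -/
theorem OBT.T_iff_of_lt {X : Type*} (o : OBT X) (ho : o.Reduced) (x y z : X) :
    o.T x y z ↔ (o.lt x z ∧ o.lt y z ∧ o.T x y z) ∨
      (o.lt z x ∧ o.lt z y ∧ ¬ (o.lt z y ∧ o.lt x y ∧ o.T z x y) ∧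
        ¬ (o.lt z x ∧ o.lt y x ∧ o.T z y x)) := by
  constructor
  · intro h
    have h1 := o.T_lt _ _ _ h
    have h2 := o.T_gt _ _ _ h
    have h3 : ¬ o.T z x y := fun h' => o.T_asymm _ _ _ (o.T_symm _ _ _ h') (h)
    have h4 : ¬ o.T z y x := fun h' => o.T_rot h (o.T_symm _ _ _ h')
    rcases o.T_ne h with h5 | h5
    · exact Or.inl ⟨h5, h1 h5, h⟩
    · exact Or.inr ⟨h5, h2 h5, by tauto, by tauto⟩
  · rintro (⟨-, -, h⟩ | ⟨h1, h2, h3, h4⟩)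
    · exact h
    · by_cases hxy : o.lt x y
      · rcases o.T_total x y z hxy with h | h | h
        · exact h
        · exact absurd ⟨h2, hxy, o.T_symm _ _ _ h⟩ h3
        · exact absurd (o.T_gt _ _ _ h hxy) (o.lt_asymm _ _ h1)
      · by_cases hyx : o.lt y x
        · rcases o.T_total y x z hyx with h | h | h
          · exact o.T_symm _ _ _ h
          · exact absurd ⟨h1, hyx, o.T_symm _ _ _ h⟩ h4
          · exact absurd (o.T_gt _ _ _ h hyx) (o.lt_asymm _ _ h2)
        · rw [← ho _ _ hxy hyx, o.T_self]
          exact Or.inr h1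

namespace Describes

variable {A B : Type} [L.Structure A] [L.Structure B] {o : OBT A} {o' : OBT B}

theorem lt_iff (h : Describes A o) (a b : A) : o.lt a b ↔ LexLE A a b ∧ a ≠ b := by
  rw [h.lexLE]
  constructor
  · intro h'
    refine ⟨Or.inr h', ?_⟩
    rintro rfl
    exact o.lt_irrefl _ h'
  · tauto

theorem T_iff (h : Describes A o) (x y z : A) : o.T x y z ↔ SS A x y z ∨
    (o.lt z x ∧ o.lt z y ∧ ¬ SS A z x y ∧ ¬ SS A z y x) := by
  rw [h.ss, h.ss, h.ss]
  exact o.T_iff_of_lt h.reduced x y z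

/-- Maps preserving the order and the relation `T` are embeddings. -/
def embedding (h : Describes A o) (h' : Describes B o') (f : A → B)
    (hlt : ∀ x y, o'.lt (f x) (f y) ↔ o.lt x y)
    (hT : ∀ x y z, o'.T (f x) (f y) (f z) ↔ o.T x y z) : A ↪[L] B where
  toFun := f
  inj' x y hxy := by
    apply h.reduced
    · rw [← hlt, hxy]; exact o'.lt_irrefl _
    · rw [← hlt, hxy]; exact o'.lt_irrefl _
  map_fun' := fun g => g.elim
  map_rel' := by
    have hinj : Function.Injective f := fun x y hxy => by
      apply h.reduced
      · rw [← hlt, hxy]; exact o'.lt_irrefl _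
      · rw [← hlt, hxy]; exact o'.lt_irrefl _
    intro n r xs
    cases r with
    | quartet =>
      have h1 := h.rr (xs 0) (xs 1) (xs 2) (xs 3)
      have h2 := h'.rr (f (xs 0)) (f (xs 1)) (f (xs 2)) (f (xs 3))
      rw [RR] at h1 h2
      have e1 : ![xs 0, xs 1, xs 2, xs 3] = xs := by
        ext i; fin_cases i <;> rfl
      have e2 : ![f (xs 0), f (xs 1), f (xs 2), f (xs 3)] = f ∘ xs := by
        ext i; fin_cases i <;> rfl
      rw [e1] at h1
      rw [e2] at h2
      rw [h1, h2]
      simp only [hT]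
      rw [← List.nodup_map_iff hinj]
      rfl
    | split =>
      have h1 := h.ss (xs 0) (xs 1) (xs 2)
      have h2 := h'.ss (f (xs 0)) (f (xs 1)) (f (xs 2))
      rw [SS] at h1 h2
      have e1 : ![xs 0, xs 1, xs 2] = xs := by
        ext i; fin_cases i <;> rfl
      have e2 : ![f (xs 0), f (xs 1), f (xs 2)] = f ∘ xs := by
        ext i; fin_cases i <;> rfl
      rw [e1] at h1
      rw [e2] at h2
      rw [h1, h2]
      simp only [hT, hlt]
    | le =>
      have h1 := h.lexLE (xs 0) (xs 1)
      have h2 := h'.lexLE (f (xs 0)) (f (xs 1))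
      rw [LexLE] at h1 h2
      have e1 : ![xs 0, xs 1] = xs := by
        ext i; fin_cases i <;> rfl
      have e2 : ![f (xs 0), f (xs 1)] = f ∘ xs := by
        ext i; fin_cases i <;> rfl
      rw [e1] at h1
      rw [e2] at h2
      rw [h1, h2, hlt, hinj.eq_iff]

theorem map_lexLE (f : A ↪[L] B) (a b : A) : LexLE B (f a) (f b) ↔ LexLE A a b := by
  have h := f.map_rel Symb.le ![a, b]
  have e : f ∘ ![a, b] = ![f a, f b] := by
    ext i; fin_cases i <;> rfl
  rw [e] at h
  exact h

theorem map_ss (f : A ↪[L] B) (a b c : A) : SS B (f a) (f b) (f c) ↔ SS A a b c := by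
  have h := f.map_rel Symb.split ![a, b, c]
  have e : f ∘ ![a, b, c] = ![f a, f b, f c] := by
    ext i; fin_cases i <;> rfl
  rw [e] at h
  exact h

theorem map_rr (f : A ↪[L] B) (a b c d : A) : RR B (f a) (f b) (f c) (f d) ↔ RR A a b c d := by
  have h := f.map_rel Symb.quartet ![a, b, c, d]
  have e : f ∘ ![a, b, c, d] = ![f a, f b, f c, f d] := by
    ext i; fin_cases i <;> rfl
  rw [e] at h
  exact h

theorem map_lt (h : Describes A o) (h' : Describes B o') (f : A ↪[L] B) (x y : A) :
    o'.lt (f x) (f y) ↔ o.lt x y := by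
  rw [h.lt_iff, h'.lt_iff, map_lexLE, f.injective.ne_iff]

theorem map_T (h : Describes A o) (h' : Describes B o') (f : A ↪[L] B) (x y z : A) :
    o'.T (f x) (f y) (f z) ↔ o.T x y z := by
  rw [h.T_iff, h'.T_iff]
  simp only [map_ss, map_lt h h']

/-- The structure induced through an embedding. -/
theorem comap (h' : Describes B o') (f : A ↪[L] B) : Describes A (o'.comap f) where
  reduced x y h1 h2 := f.injective (h'.reduced _ _ h1 h2)
  lexLE a b := by rw [← map_lexLE f, h'.lexLE, f.injective.eq_iff]; rfl
  ss a b c := by rw [← map_ss f, h'.ss]; rfl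
  rr a b c d := by
    rw [← map_rr f, h'.rr, ← List.nodup_map_iff f.injective]; rfl

end Describes

/-- The structure with the relations described by `o`. -/
@[reducible] def OBT.toStructure {A : Type} (o : OBT A) : L.Structure A where
  funMap := fun f => f.elim
  RelMap := fun r => match r with
    | .quartet => fun xs => [xs 0, xs 1, xs 2, xs 3].Nodup ∧
      ((o.T (xs 0) (xs 1) (xs 2) ∧ o.T (xs 0) (xs 1) (xs 3)) ∨
        (o.T (xs 2) (xs 3) (xs 0) ∧ o.T (xs 2) (xs 3) (xs 1)))
    | .split => fun xs => o.lt (xs 0) (xs 2) ∧ o.lt (xs 1) (xs 2) ∧ o.T (xs 0) (xs 1) (xs 2)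
    | .le => fun xs => xs 0 = xs 1 ∨ o.lt (xs 0) (xs 1)

theorem OBT.describes {A : Type} (o : OBT A) (ho : o.Reduced) : @Describes A o.toStructure o :=
  letI := o.toStructure
  { reduced := ho
    lexLE := fun _ _ => Iff.rfl
    ss := fun _ _ _ => Iff.rfl
    rr := fun _ _ _ _ => Iff.rfl }

theorem IsBoronGraph.endpoints_nonempty {V : Type} [Finite V] {T : SimpleGraph V}
    (h : IsBoronGraph T) : (endpoints T).Nonempty := by
  classical
  have := Fintype.ofFinite V
  have hne : Nonempty V := h.1.1.nonempty
  have : Nontrivial V := by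
    obtain ⟨v⟩ := hne
    have : (T.neighborSet v).Nonempty := by
      apply Set.nonempty_of_ncard_ne_zero
      rcases h.2 v with h | h <;> omega
    obtain ⟨w, hw⟩ := this
    exact ⟨v, w, hw.ne⟩
  obtain ⟨v, hv⟩ := h.1.exists_vert_degree_one_of_nontrivial
  refine ⟨v, ?_⟩
  rw [endpoints, Set.mem_ofPred_eq, Set.ncard_eq_toFinset_card']
  exact hv

theorem IsBoronTree.finite_nonempty {A : Type} {R : A → A → A → A → Prop} (h : IsBoronTree R) :
    Finite A ∧ Nonempty A := by
  rcases h with ⟨V, T, hV, hT, e, -⟩ | ⟨⟨h⟩, -⟩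
  · have := hT.endpoints_nonempty.to_subtype
    exact ⟨Finite.of_equiv _ e.symm, e.nonempty⟩
  · exact ⟨inferInstance, ⟨h.default⟩⟩

theorem IsOrderedBoronTree.exists_describes {A : Type} [L.Structure A]
    (h : IsOrderedBoronTree A) : ∃ o : OBT A, Describes A o := by
  obtain ⟨hB, n, φ, hinj, hR, hle, hS⟩ := h
  obtain ⟨a⟩ := hB.finite_nonempty.2
  have hn : 2 ≤ n := by
    have h1 := (φ a).1.2.2
    have h2 := List.length_pos_of_ne_nil (φ a).1.2.1
    omega
  have hF := fullTree_length hn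
  have hanti : ∀ x y, (φ x).1.1 <+: (φ y).1.1 → x = y := fun x y hxy =>
    hinj (Subtype.ext (hF.endpoints_antichain (φ x).2 hxy))
  obtain ⟨o, ho, hlt, hT⟩ := exists_OBT_of_antichain (fun a => (φ a).1.1) hanti
  refine ⟨o, ho, ?_, ?_, ?_⟩
  · intro a b
    rw [hle, hlt, hinj.eq_iff]
  · intro a b c
    rw [hS, hlt, hlt, o.T_comm, hT, meet_comm (s := (φ b).1.1) (t := (φ a).1.1)]
  · intro a b c d
    rw [hR]
    refine (hF.quartet_iff (φ a).2 (φ b).2 (φ c).2 (φ d).2).trans ?_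
    simp only [hT]
    rw [← List.nodup_map_iff (Subtype.val_injective.comp hinj)]
    rfl

/-- One tree of leaves serves twice: its graph with suppressed root is the tree T with B(T)
isomorphic to (A, R), and its leaves padded to equal length give the embedding into some B_n. -/
theorem isOrderedBoronTree_of_describes {A : Type} [L.Structure A] [Finite A] [Nonempty A]
    {o : OBT A} (h : Describes A o) : IsOrderedBoronTree A := by
  classical
  have := Fintype.ofFinite A
  obtain ⟨f, hf, hlt, hT⟩ := o.exists_leafSet Finset.univ Finset.univ_nonempty
  simp only [Finset.mem_univ, true_imp_iff, Finset.coe_univ, Set.image_univ] at hf hlt hT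
  have hinj : Function.Injective f := by
    intro x y hxy
    apply h.reduced
    · rw [hlt, hxy, ← hlt]; exact o.lt_irrefl _
    · rw [hlt, hxy, ← hlt]; exact o.lt_irrefl _
  have hanti : ∀ x y, f x <+: f y → x = y := fun x y hxy =>
    hinj (hf.antichain _ ⟨x, rfl⟩ _ ⟨y, rfl⟩ hxy)
  constructor
  · by_cases hS : Set.range f = {[]}
    · right
      obtain ⟨a⟩ := (inferInstance : Nonempty A)
      have hall : ∀ x, f x = [] := fun x => by
        have : f x ∈ Set.range f := ⟨x, rfl⟩
        rwa [hS] at this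
      have hsub : ∀ x y : A, x = y := fun x y => hinj ((hall x).trans (hall y).symm)
      refine ⟨⟨⟨⟨a⟩, fun x => hsub x a⟩⟩, fun a b c d hR => ?_⟩
      have := ((h.rr a b c d).1 hR).1
      rw [hsub b a] at this
      simp at this
    · left
      have hF := hf.fullTree hS
      have hp : ∀ x, f x ≠ [] ∧ ∃ l ∈ Set.range f, f x <+: l := by
        intro x
        refine ⟨?_, f x, ⟨x, rfl⟩, List.prefix_refl _⟩
        intro hx
        apply hS
        ext t
        constructor
        · rintro ⟨y, rfl⟩
          rw [← hanti x y (by rw [hx]; exact List.nil_prefix)]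
          exact hx
        · rintro rfl
          exact ⟨x, hx⟩
      have hend : ∀ x, (⟨f x, hp x⟩ : {s // s ≠ [] ∧ ∃ l ∈ Set.range f, s <+: l}) ∈
          endpoints (seqGraph fun s => s ≠ [] ∧ ∃ l ∈ Set.range f, s <+: l) := by
        intro x
        rw [hF.mem_endpoints]
        rintro ⟨-, _, ⟨y, rfl⟩, hl⟩
        have hxy := hanti x y ((List.prefix_append _ _).trans hl)
        rw [hxy] at hl
        have := hl.length_le
        simp at this
      refine ⟨_, seqGraph fun s => s ≠ [] ∧ ∃ l ∈ Set.range f, s <+: l, ?_, hF.isBoronGraph,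
        Equiv.ofBijective (fun x => ⟨⟨f x, hp x⟩, hend x⟩) ⟨?_, ?_⟩, ?_⟩
      · have hfin : (⋃ l ∈ Set.range f, {s | s ∈ l.inits}).Finite :=
          (Set.finite_range f).biUnion (fun l _ => List.finite_toSet _)
        refine Set.Finite.subset hfin ?_
        rintro s ⟨-, l, hl, hsl⟩
        simp only [Set.mem_iUnion]
        exact ⟨l, hl, (List.mem_inits _ _).2 hsl⟩
      · intro x y hxy
        simp only [Subtype.mk.injEq] at hxy
        exact hinj hxy
      · rintro ⟨⟨s, hs0, hs⟩, hs'⟩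
        rw [hF.mem_endpoints] at hs'
        rcases hf.mem_or_extend hs with ⟨x, rfl⟩ | hs
        · exact ⟨x, rfl⟩
        · exact absurd ⟨by simp, hs⟩ hs'
      · intro a b c d
        rw [h.rr]
        refine Iff.trans ?_ (hF.quartet_iff (hend a) (hend b) (hend c) (hend d)).symm
        simp only [hT]
        rw [← List.nodup_map_iff (f := fun x => (⟨f x, hp x⟩ :
          {s // s ≠ [] ∧ ∃ l ∈ Set.range f, s <+: l})) (fun x y hxy => hinj (by simpa using hxy))]
        rfl
  · obtain ⟨K, hK⟩ : ∃ K, ∀ x, (f x).length < K := by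
      obtain ⟨K, hK⟩ := (Set.finite_range fun x => (f x).length).bddAbove
      exact ⟨K + 1, fun x => Nat.lt_succ_of_le (hK ⟨x, rfl⟩)⟩
    -- Zeros are appended up to a length K exceeding all lengths, so that every sequence becomes an
    -- endpoint of T_(K+1). Meets of distinct leaves do not change.
    let g : A → List Bool := fun x => f x ++ List.replicate (K - (f x).length) false
    have hg : ∀ x, (g x).length = K := by
      intro x
      have := hK x
      simp [g]; omega
    obtain ⟨a0⟩ := (inferInstance : Nonempty A)
    have hK0 : 1 ≤ K := by have := hK a0; omega
    have hgp : ∀ x, g x ≠ [] ∧ (g x).length < K + 1 := fun x =>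
      ⟨by rw [← List.length_pos_iff, hg]; omega, by rw [hg]; omega⟩
    have hgend : ∀ x, (⟨g x, hgp x⟩ : BinVertex (K + 1)) ∈ endpoints (binTree (K + 1)) := by
      intro x
      rw [mem_endpoints_binTree (by omega)]
      simp [hg]
    have hpre : ∀ x y, x ≠ y → ¬ f x <+: f y := fun x y hxy h => hxy (hanti x y h)
    have hmeet : ∀ x y, x ≠ y → meet (g x) (g y) = meet (f x) (f y) := fun x y hxy =>
      meet_append (hpre x y hxy) (hpre y x hxy.symm) _ _
    have hglt : ∀ x y, o.lt x y ↔ LexLT (g x) (g y) := by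
      intro x y
      by_cases hxy : x = y
      · subst hxy
        simp only [o.lt_irrefl, false_iff, lexLT_iff]
        rintro ⟨h1, h2⟩
        rw [h1] at h2
        simp at h2
      · rw [hlt]
        exact (lexLT_append (hpre x y hxy) (hpre y x (Ne.symm hxy)) _ _).symm
    have hginj : Function.Injective g := by
      intro x y hxy
      apply h.reduced
      · rw [hglt, hxy, ← hglt]; exact o.lt_irrefl _
      · rw [hglt, hxy, ← hglt]; exact o.lt_irrefl _
    have hlen : ∀ x y, x ≠ y → (meet (g x) (g y)).length < K := by
      intro x y hxy
      rw [hmeet x y hxy]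
      exact lt_of_le_of_lt meet_prefix_left.length_le (hK x)
    have hgT : ∀ x y z, o.T x y z ↔ (meet (g x) (g z)).length < (meet (g x) (g y)).length := by
      intro x y z
      by_cases hxz : x = z
      · subst hxz
        simp only [o.not_T_left, false_iff, meet_self, hg, not_lt]
        rw [← hg x]
        exact meet_prefix_left.length_le
      · by_cases hxy : x = y
        · subst hxy
          simp only [meet_self, hg]
          refine iff_of_true ?_ (hlen _ _ hxz)
          rw [o.T_self]
          by_contra! h'
          exact hxz (h.reduced _ _ h'.1 h'.2)
        · rw [hT, hmeet _ _ hxz, hmeet _ _ hxy]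
    refine ⟨K + 1, fun x => ⟨⟨g x, hgp x⟩, hgend x⟩, ?_, ?_, ?_, ?_⟩
    · intro x y hxy
      simp only [Subtype.mk.injEq] at hxy
      exact hginj hxy
    · intro a b c d
      rw [h.rr]
      refine Iff.trans ?_ ((fullTree_length (by omega)).quartet_iff (hgend a) (hgend b) (hgend c)
        (hgend d)).symm
      simp only [hgT]
      rw [← List.nodup_map_iff (f := fun x => (⟨g x, hgp x⟩ : BinVertex (K + 1)))
        (fun x y hxy => hginj (by simpa using hxy))]
      rfl
    · intro a b
      rw [h.lexLE, hglt]
      simp [hginj.eq_iff]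
    · intro a b c
      rw [h.ss, hglt, hglt, o.T_comm, hgT, meet_comm (s := g b) (t := g a)]

/-- A structure is an ordered boron tree if and only if it is finite, nonempty and its relations
are given by an order and a branching relation. -/
theorem isOrderedBoronTree_iff {A : Type} [L.Structure A] :
    IsOrderedBoronTree A ↔ Finite A ∧ Nonempty A ∧ ∃ o : OBT A, Describes A o :=
  ⟨fun h => ⟨h.1.finite_nonempty.1, h.1.finite_nonempty.2, h.exists_describes⟩,
    fun ⟨_, _, _, h⟩ => isOrderedBoronTree_of_describes h⟩

/-! ### One-point extensions -/

namespace OBT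

theorem ext' {X : Type*} {o o' : OBT X} (hlt : ∀ x y, o.lt x y ↔ o'.lt x y)
    (hT : ∀ x y z, o.T x y z ↔ o'.T x y z) : o = o' := by
  obtain ⟨lt, T, _⟩ := o
  obtain ⟨lt', T', _⟩ := o'
  obtain rfl : lt = lt' := by ext; exact hlt _ _
  obtain rfl : T = T' := by ext; exact hT _ _ _
  rfl

theorem lt_of_eq {X : Type*} {o o' : OBT X} (h : o = o') (x y : X) : o.lt x y ↔ o'.lt x y := by
  rw [h]

theorem T_of_eq {X : Type*} {o o' : OBT X} (h : o = o') (x y z : X) :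
    o.T x y z ↔ o'.T x y z := by
  rw [h]

theorem lt_congr {X : Type*} (o : OBT X) {x x' : X} (h : ¬ o.lt x x' ∧ ¬ o.lt x' x) (y : X) :
    (o.lt x y ↔ o.lt x' y) ∧ (o.lt y x ↔ o.lt y x') := by
  have := o.lt_split
  have := o.lt_asymm
  grind

theorem T_congr {X : Type*} (o : OBT X) {x x' : X} (h : ¬ o.lt x x' ∧ ¬ o.lt x' x) (y z : X) :
    (o.T x y z ↔ o.T x' y z) ∧ (o.T y x z ↔ o.T y x' z) ∧ (o.T y z x ↔ o.T y z x') := by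
  have h1 := o.T_symm
  have h2 := o.T_split
  have h3 := o.T_asymm
  have h4 := o.T_self
  have h5 : ∀ w, ¬ o.T w x x' ∧ ¬ o.T w x' x := by
    intro w
    constructor
    · intro hw
      have := o.T_ne (o.T_symm _ _ _ hw)
      tauto
    · intro hw
      have := o.T_ne (o.T_symm _ _ _ hw)
      tauto
  have h6 : (o.T y x z ↔ o.T y x' z) ∧ (o.T y z x ↔ o.T y z x') := by
    have := h5 y
    have := h2 y x z x'
    have := h2 y x' z x
    have := h2 y z x x'
    have := h2 y z x' x
    tauto
  exact ⟨by rw [o.T_comm, h6.1, o.T_comm], h6.1, h6.2⟩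

/-- A one-point extension is determined by the position of the new point on the branch to a nearest
old point. -/
theorem option_ext {ι : Type*} {q q' : OBT (Option ι)} (h : q.comap some = q'.comap some) (i : ι)
    (near : ∀ j, ¬ q.T none (some j) (some i))
    (above : ∀ j, q.T (some i) none (some j) ↔ q'.T (some i) none (some j))
    (below : ∀ j, q.T (some i) (some j) none ↔ q'.T (some i) (some j) none)
    (left : q.lt none (some i) ↔ q'.lt none (some i))
    (right : q.lt (some i) none ↔ q'.lt (some i) none) : q = q' := by
  have hlt : ∀ x y, q.lt (some x) (some y) ↔ q'.lt (some x) (some y) := fun x y =>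
    lt_of_eq h x y
  have hT : ∀ x y z, q.T (some x) (some y) (some z) ↔ q'.T (some x) (some y) (some z) :=
    fun x y z => T_of_eq h x y z
  by_cases hi : q.lt none (some i) ∨ q.lt (some i) none
  · have hlev : ∀ j, q.T (some i) none (some j) ∨ q.T (some i) (some j) none := by
      intro j
      by_contra! hc
      exact near j (q.T_of_level hc.1 hc.2 ((q.T_self _ _).2 hi.symm))
    have hirr := fun x y => q.T_irrefl x y
    have hirr' := fun x y => q'.T_irrefl x y
    have hi1 := hirr none none
    have hi2 := hirr' none none
    apply ext'
    · intro x y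
      by_cases hxy : q.T (some i) x y ∨ q.T (some i) y x
      · have hxy' : q'.T (some i) x y ∨ q'.T (some i) y x := by
          rcases x with _ | x <;> rcases y with _ | y <;> grind
        rw [q.lt_iff_of_branch hxy, q'.lt_iff_of_branch hxy']
        rcases x with _ | x <;> rcases y with _ | y <;> grind
      · rcases x with _ | x <;> rcases y with _ | y
        · simp [lt_irrefl]
        · have := hlev y; grind
        · have := hlev x; grind
        · exact hlt _ _
    · intro x y z
      by_cases hxy : q.T (some i) x y ∨ q.T (some i) y x ∨ q.T (some i) y z ∨ q.T (some i) z y ∨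
          q.T (some i) x z ∨ q.T (some i) z x
      · have hxy' : q'.T (some i) x y ∨ q'.T (some i) y x ∨ q'.T (some i) y z ∨
            q'.T (some i) z y ∨ q'.T (some i) x z ∨ q'.T (some i) z x := by
          rcases x with _ | x <;> rcases y with _ | y <;> rcases z with _ | z <;> grind
        rw [q.T_iff_of_branch hxy, q'.T_iff_of_branch hxy']
        rcases x with _ | x <;> rcases y with _ | y <;> rcases z with _ | z <;> grind
      · rcases x with _ | x <;> rcases y with _ | y <;> rcases z with _ | z
        · grind
        · have := hlev z; grind
        · have := hlev y; grind
        · have := hlev y; grind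
        · have := hlev x; grind
        · have := hlev x; grind
        · have := hlev x; grind
        · exact hT _ _ _
  · have hq : ¬ q.lt none (some i) ∧ ¬ q.lt (some i) none := by tauto
    have hq' : ¬ q'.lt none (some i) ∧ ¬ q'.lt (some i) none := by tauto
    have c1 := fun y => q.lt_congr hq y
    have c2 := fun y => q'.lt_congr hq' y
    have d1 := fun y z => q.T_congr hq y z
    have d2 := fun y z => q'.T_congr hq' y z
    apply ext'
    · intro x y
      rcases x with _ | x <;> rcases y with _ | y
      · simp [lt_irrefl]
      · rw [(c1 _).1, (c2 _).1, hlt]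
      · rw [(c1 _).2, (c2 _).2, hlt]
      · exact hlt _ _
    · intro x y z
      have hn := fun x y => q.not_T_left x y
      have hn' := fun x y => q'.not_T_left x y
      rcases x with _ | x <;> rcases y with _ | y <;> rcases z with _ | z
      · simp [T_irrefl]
      · rw [(d1 _ _).1, (d1 _ _).2.1, (d2 _ _).1, (d2 _ _).2.1, hT]
      · simp [not_T_left]
      · rw [(d1 _ _).1, (d2 _ _).1, hT]
      · simp [T_irrefl]
      · rw [(d1 _ _).2.1, (d2 _ _).2.1, hT]
      · rw [(d1 _ _).2.2, (d2 _ _).2.2, hT]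
      · exact hT _ _ _

/-- Every one-point extension of a finite substructure is realized. -/
def HasExtensions {X : Type*} (o : OBT X) : Prop :=
  ∀ (ι : Type) [Finite ι] (q : OBT (Option ι)) (φ : ι → X), o.comap φ = q.comap some →
    ∃ m, o.comap (fun x => x.elim m φ) = q

end OBT

/-! ### Construction of the universal ordered boron tree -/

/-- A countable dense set of places, with two dense colours. -/
abbrev Place : Type := {x : ℝ // ∃ q : ℚ, x = q ∨ x = q + √2}

instance : Countable Place := by
  have h : {x : ℝ | ∃ q : ℚ, x = q ∨ x = q + √2} ⊆
      Set.range (fun q : ℚ => (q : ℝ)) ∪ Set.range (fun q : ℚ => (q : ℝ) + √2) := by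
    rintro x ⟨q, rfl | rfl⟩
    · exact Or.inl ⟨q, rfl⟩
    · exact Or.inr ⟨q, rfl⟩
  exact ((Set.countable_range _).union (Set.countable_range _)).mono h |>.to_subtype

open Classical in
/-- The colour of a place. -/
noncomputable def Place.color (p : Place) : Bool := decide (∃ q : ℚ, p.1 = q)

/-- Rationals and rationals shifted by √2 are both dense and are disjoint because √2 is irrational.
-/
theorem Place.exists_between (c : Bool) (lo hi : Finset Place) (h : ∀ x ∈ lo, ∀ y ∈ hi, x < y) :
    ∃ p : Place, p.color = c ∧ (∀ x ∈ lo, x < p) ∧ ∀ y ∈ hi, p < y := by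
  classical
  obtain ⟨a, ha, ha'⟩ := Order.exists_between_finsets (lo.image Subtype.val)
    (hi.image Subtype.val) (by simpa using fun x hx hx' y hy hy' => h ⟨x, hx⟩ hx' ⟨y, hy⟩ hy')
  obtain ⟨b, hb, hb'⟩ := Order.exists_between_finsets (insert a (lo.image Subtype.val))
    (hi.image Subtype.val) (by
      intro x hx y hy
      rw [Finset.mem_insert] at hx
      rcases hx with rfl | hx
      · exact ha' _ hy
      · exact (ha _ hx).trans (ha' _ hy))
  have hab : a < b := hb _ (Finset.mem_insert_self _ _)
  have key : ∀ p : Place, a < p.1 → p.1 < b → (∀ x ∈ lo, x < p) ∧ ∀ y ∈ hi, p < y :=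
    fun p h1 h2 => ⟨fun x hx => (ha _ (Finset.mem_image_of_mem _ hx)).trans h1,
      fun y hy => h2.trans (hb' _ (Finset.mem_image_of_mem _ hy))⟩
  cases c with
  | true =>
    obtain ⟨q, h1, h2⟩ := exists_rat_btwn hab
    exact ⟨⟨q, q, Or.inl rfl⟩, by simp [color], key _ h1 h2⟩
  | false =>
    obtain ⟨q, h1, h2⟩ := exists_rat_btwn (sub_lt_sub_right hab √2)
    refine ⟨⟨q + √2, q, Or.inr rfl⟩, ?_, key _ (by simp; linarith) (by simp; linarith)⟩
    simp only [color, decide_eq_false_iff_not]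
    rintro ⟨r, hr⟩
    exact (irrational_sqrt_two.ratCast_add q) ⟨r, hr.symm⟩

-- Finite sets of places are compared at their first place of difference, the digit being membership
-- twisted by the colour. To add a point distinct from the old ones, change membership of one place
-- p in the set of a nearest old point: the position of p gives the place of branching, its colour
-- the side.
open scoped Classical in
theorem exists_OBT_hasExtensions : ∃ o : OBT (Finset Place), o.Reduced ∧ o.HasExtensions := by
  let δ : Finset Place → Finset Place → WithTop Place := fun s t => (symmDiff s t).min
  let bit : Finset Place → WithTop Place → Bool := fun s q =>
    WithTop.recTopCoe (C := fun _ => Bool) false (fun p => xor (decide (p ∈ s)) p.color) q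
  have hδ : ∀ s t (p : Place), δ s t = p ↔
      ((p ∈ s ∧ p ∉ t) ∨ (p ∈ t ∧ p ∉ s)) ∧ ∀ r < p, (r ∈ s ↔ r ∈ t) := by
    intro s t p
    constructor
    · intro h
      have h1 := Finset.mem_of_min h
      rw [Finset.mem_symmDiff] at h1
      refine ⟨h1, fun r hr => ?_⟩
      by_contra hc
      have : r ∈ symmDiff s t := by rw [Finset.mem_symmDiff]; tauto
      exact absurd (Finset.min_le_of_eq this h) (not_le.2 hr)
    · rintro ⟨h1, h2⟩
      have hp : p ∈ symmDiff s t := by rw [Finset.mem_symmDiff]; tauto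
      apply le_antisymm (Finset.min_le hp)
      apply Finset.le_min
      intro r hr
      rw [WithTop.coe_le_coe]
      by_contra! hc
      rw [Finset.mem_symmDiff] at hr
      have := h2 r hc
      tauto
  have hδtop : ∀ s t, δ s t = ⊤ ↔ s = t := by
    intro s t
    simp [δ, Finset.min_eq_top]
  have symm : ∀ x y, δ x y = δ y x := fun x y => by simp only [δ, symmDiff_comm]
  have hagree : ∀ x y (q : Place), q < δ x y → (q ∈ x ↔ q ∈ y) := by
    intro x y q hq
    by_contra hc
    have : q ∈ symmDiff x y := by rw [Finset.mem_symmDiff]; tauto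
    exact absurd (Finset.min_le this) (not_le.2 hq)
  obtain ⟨o, ho, hlt, hT⟩ := exists_OBT_of_bits δ bit symm (by
      intro x y q hq
      induction q using WithTop.recTopCoe with
      | top => rfl
      | coe q => simp only [bit, WithTop.recTopCoe_coe, hagree x y q hq]) (by
      intro x y hxy
      have hne : δ x y ≠ ⊤ := fun h => hxy ((hδtop _ _).1 h)
      obtain ⟨p, hp⟩ := WithTop.ne_top_iff_exists.1 hne
      have := ((hδ _ _ _).1 hp.symm).1
      rw [← hp]
      simp only [bit, WithTop.recTopCoe_coe]
      rcases this with ⟨h1, h2⟩ | ⟨h1, h2⟩ <;> simp [h1, h2]) (by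
      intro x y hxy
      rw [(hδtop x x).2 rfl, lt_top_iff_ne_top]
      exact fun h => hxy ((hδtop _ _).1 h))
  refine ⟨o, ho, ?_⟩
  intro ι _ q φ hφ
  have hφlt : ∀ x y, o.lt (φ x) (φ y) ↔ q.lt (some x) (some y) := fun x y => OBT.lt_of_eq hφ x y
  have hφT : ∀ x y z, o.T (φ x) (φ y) (φ z) ↔ q.T (some x) (some y) (some z) :=
    fun x y z => OBT.T_of_eq hφ x y z
  rcases isEmpty_or_nonempty ι with hι | hι
  · refine ⟨∅, OBT.ext' ?_ ?_⟩
    · intro x y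
      obtain rfl : x = none := by cases x; rfl; exact hι.elim ‹_›
      obtain rfl : y = none := by cases y; rfl; exact hι.elim ‹_›
      exact iff_of_false (OBT.lt_irrefl _ _) (OBT.lt_irrefl _ _)
    · intro x y z
      obtain rfl : x = none := by cases x; rfl; exact hι.elim ‹_›
      obtain rfl : y = none := by cases y; rfl; exact hι.elim ‹_›
      obtain rfl : z = none := by cases z; rfl; exact hι.elim ‹_›
      exact iff_of_false (OBT.T_irrefl _ _ _) (OBT.T_irrefl _ _ _)
  obtain ⟨i, -, near⟩ := OBT.exists_max (fun i j => q.T none (some j) (some i))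
    (fun x y => q.T_asymm _ _ _) (fun x y z h => (q.T_split _ _ _ _ h).symm) (Set.univ : Set ι)
    Set.finite_univ Set.univ_nonempty
  simp only [Set.mem_univ, true_imp_iff] at near
  by_cases hi : q.lt none (some i) ∨ q.lt (some i) none
  · have hlev : ∀ j, q.T (some i) none (some j) ∨ q.T (some i) (some j) none := by
      intro j
      by_contra! hc
      exact near j (q.T_of_level hc.1 hc.2 ((q.T_self _ _).2 hi.symm))
    have := Fintype.ofFinite ι
    let lo : Finset Place := Finset.univ.biUnion fun j : ι =>
      if q.T (some i) none (some j) then symmDiff (φ i) (φ j) |>.filter (fun p => δ (φ i) (φ j) = p)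
        else ∅
    have hlo : ∀ p, p ∈ lo ↔ ∃ j, q.T (some i) none (some j) ∧ δ (φ i) (φ j) = p := by
      intro p
      simp only [lo, Finset.mem_biUnion, Finset.mem_univ, true_and]
      refine exists_congr fun j => ?_
      split_ifs with h
      · simp only [Finset.mem_filter, h, true_and]
        exact ⟨fun h => h.2, fun h => ⟨Finset.mem_of_min h, h⟩⟩
      · simp [h]
    let hi0 : Finset Place := Finset.univ.biUnion fun j : ι =>
      if q.T (some i) (some j) none then symmDiff (φ i) (φ j) |>.filter (fun p => δ (φ i) (φ j) = p)
        else ∅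
    have hhi0 : ∀ p, p ∈ hi0 ↔ ∃ j, q.T (some i) (some j) none ∧ δ (φ i) (φ j) = p := by
      intro p
      simp only [hi0, Finset.mem_biUnion, Finset.mem_univ, true_and]
      refine exists_congr fun j => ?_
      split_ifs with h
      · simp only [Finset.mem_filter, h, true_and]
        exact ⟨fun h => h.2, fun h => ⟨Finset.mem_of_min h, h⟩⟩
      · simp [h]
    -- Bounding p also by the later elements of φ i ensures that p is not in φ i.
    let hi1 : Finset Place := hi0 ∪ (φ i).filter (fun p => ∀ r ∈ lo, r < p)
    -- As p is not in φ i, the digit of φ i at p is the colour, and it must be 0 exactly when the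
    -- new point goes to the right.
    obtain ⟨p, hpc, hplo, hphi⟩ := Place.exists_between (decide (q.lt (some i) none) |> not) lo hi1 (by
      intro x hx y hy
      rcases Finset.mem_union.1 hy with hy | hy
      · obtain ⟨j, hj, hj'⟩ := (hlo x).1 hx
        obtain ⟨k, hk, hk'⟩ := (hhi0 y).1 hy
        have h1 := q.T_trans hk hj
        rw [← hφT, hT, hj', hk'] at h1
        exact WithTop.coe_lt_coe.1 h1
      · exact (Finset.mem_filter.1 hy).2 x hx)
    have hpi : p ∉ φ i := by
      intro h
      have : p ∈ hi1 := Finset.mem_union_right _ (Finset.mem_filter.2 ⟨h, hplo⟩)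
      exact lt_irrefl _ (hphi p this)
    have hδm : δ (φ i) (symmDiff (φ i) {p}) = p := by
      simp only [δ, symmDiff_symmDiff_cancel_left, Finset.min_singleton]
    have hmne : φ i ≠ symmDiff (φ i) {p} := fun h => by
      have := (hδtop (φ i) (φ i)).2 rfl
      rw [← h, this] at hδm
      exact WithTop.top_ne_coe hδm
    have hpm : p ∈ symmDiff (φ i) {p} := by
      rw [Finset.mem_symmDiff]; simp [hpi]
    have hlow : ∀ j, q.T (some i) none (some j) → δ (φ i) (φ j) < p := by
      intro j hj
      have hne : δ (φ i) (φ j) ≠ ⊤ := by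
        intro h
        have h1 := (hδtop _ _).1 h
        have h2 := q.T_ne hj
        rw [← hφlt, ← hφlt, h1] at h2
        exact h2.elim (o.lt_irrefl _) (o.lt_irrefl _)
      obtain ⟨r, hr⟩ := WithTop.ne_top_iff_exists.1 hne
      rw [← hr, WithTop.coe_lt_coe]
      exact hplo _ ((hlo _).2 ⟨j, hj, hr.symm⟩)
    have hhigh : ∀ j, q.T (some i) (some j) none → p < δ (φ i) (φ j) := by
      intro j hj
      by_cases hne : δ (φ i) (φ j) = ⊤
      · rw [hne]; exact WithTop.coe_lt_top _
      obtain ⟨r, hr⟩ := WithTop.ne_top_iff_exists.1 hne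
      rw [← hr, WithTop.coe_lt_coe]
      exact hphi _ (Finset.mem_union_left _ ((hhi0 _).2 ⟨j, hj, hr.symm⟩))
    refine ⟨symmDiff (φ i) {p}, (OBT.option_ext (i := i) ?_ near ?_ ?_ ?_ ?_).symm⟩
    · rw [← hφ]; rfl
    · intro j
      change _ ↔ o.T (φ i) (symmDiff (φ i) {p}) (φ j)
      rw [hT, hδm]
      refine ⟨hlow j, fun h => (hlev j).resolve_right fun h' => lt_asymm h (hhigh j h')⟩
    · intro j
      change _ ↔ o.T (φ i) (φ j) (symmDiff (φ i) {p})
      rw [hT, hδm]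
      refine ⟨hhigh j, fun h => (hlev j).resolve_left fun h' => lt_asymm h (hlow j h')⟩
    · change _ ↔ o.lt (symmDiff (φ i) {p}) (φ i)
      rw [hlt, symm, hδm]
      have := q.lt_asymm none (some i)
      simp only [bit, WithTop.recTopCoe_coe, hpi, hpm, hpc]
      by_cases hq : q.lt (some i) none <;> simp [hq] <;> grind
    · change _ ↔ o.lt (φ i) (symmDiff (φ i) {p})
      rw [hlt, hδm]
      simp only [bit, WithTop.recTopCoe_coe, hpi, hpm, hpc]
      by_cases hq : q.lt (some i) none <;> simp [hq]; exact hmne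
  · push Not at hi
    have d1 := fun y z => q.T_congr hi y z
    refine ⟨φ i, (OBT.option_ext (i := i) ?_ near ?_ ?_ ?_ ?_).symm⟩
    · rw [← hφ]; rfl
    · intro j
      rw [(d1 _ _).2.1, ← hφT]; rfl
    · intro j
      rw [(d1 _ _).2.2, ← hφT]; rfl
    · exact iff_of_false hi.1 (o.lt_irrefl _)
    · exact iff_of_false hi.2 (o.lt_irrefl _)

theorem OBT.HasExtensions.exists_comap_eq {X : Type*} {o : OBT X} (h : o.HasExtensions)
    {ι : Type} [Finite ι] (q : OBT ι) : ∃ φ : ι → X, o.comap φ = q := by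
  revert q
  refine Finite.induction_empty_option
    (P := fun ι => ∀ q : OBT ι, ∃ φ : ι → X, o.comap φ = q) ?_ ?_ ?_ ι
  · intro α β e ih q
    obtain ⟨φ, hφ⟩ := ih (q.comap e)
    refine ⟨φ ∘ e.symm, OBT.ext' (fun x y => ?_) (fun x y z => ?_)⟩
    · simpa [OBT.comap] using OBT.lt_of_eq hφ (e.symm x) (e.symm y)
    · simpa [OBT.comap] using OBT.T_of_eq hφ (e.symm x) (e.symm y) (e.symm z)
  · exact fun q => ⟨fun x => x.elim, OBT.ext' (fun x => x.elim) (fun x => x.elim)⟩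
  · intro α _ ih q
    obtain ⟨φ, hφ⟩ := ih (q.comap some)
    obtain ⟨m, hm⟩ := h α q φ hφ
    exact ⟨_, hm⟩

variable {M N : Type} [L.Structure M] [L.Structure N] {o : OBT M} {o' : OBT N}

namespace Describes

/-- Maps inducing the given description are embeddings. -/
def embeddingOfComap (h : Describes M o) (h' : Describes N o') (f : M → N) (hf : o'.comap f = o) :
    M ↪[L] N :=
  h.embedding h' f (OBT.lt_of_eq hf) (OBT.T_of_eq hf)

theorem comap_eq (h : Describes M o) (h' : Describes N o') (f : M ↪[L] N) : o'.comap f = o :=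
  OBT.ext' (h.map_lt h' f) (h.map_T h' f)

/-- In a relational language, the substructure generated by S and one point only adds that point.
Since m may already belong to S, points of S keep their old index through `r`. -/
theorem isExtensionPair (h : Describes M o) (ho : o.HasExtensions) : L.IsExtensionPair M M := by
  classical
  rw [Language.isExtensionPair_iff_exists_embedding_closure_singleton_sup]
  intro S hS f m
  have hfin : Finite S := hS.finite
  have hSd : Describes S (o.comap Subtype.val) := h.comap S.subtype
  obtain ⟨m', hm'⟩ := ho S (o.comap (fun x => x.elim m Subtype.val)) f (hSd.comap_eq h f)
  have hmem : ∀ x ∈ (Language.Substructure.closure L {m} ⊔ S), x = m ∨ x ∈ S := by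
    intro x hx
    rw [← Language.Substructure.closure_eq S, ← Language.Substructure.closure_union,
      Language.Substructure.mem_closure_iff_of_isRelational] at hx
    exact hx
  let S' := Language.Substructure.closure L {m} ⊔ S
  let r : S' → Option S := fun x => if hx : x.1 ∈ S then some ⟨x.1, hx⟩ else none
  have hr : ∀ x, (r x).elim m Subtype.val = x.1 := by
    intro x
    by_cases hx : x.1 ∈ S
    · simp [r, hx]
    · simp only [r, hx, dite_false]
      exact ((hmem x.1 x.2).resolve_right hx).symm
  have hS'd : Describes S' (o.comap Subtype.val) := h.comap S'.subtype
  refine ⟨hS'd.embeddingOfComap h (fun x => (r x).elim m' f) ?_, ?_⟩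
  · refine OBT.ext' (fun x y => ?_) (fun x y z => ?_)
    · refine (OBT.lt_of_eq hm' (r x) (r y)).trans ?_
      simp only [OBT.comap, hr]
    · refine (OBT.T_of_eq hm' (r x) (r y) (r z)).trans ?_
      simp only [OBT.comap, hr]
  · ext x
    have hx : r (Language.Substructure.inclusion le_sup_right x) = some x := by
      simp [r]
    change f x = (r _).elim m' f
    rw [hx]
    rfl

theorem isUniversal [Countable M] (h : Describes M o) (ho : o.HasExtensions) :
    IsUniversalOrderedBoronTree M := by
  refine ⟨inferInstance, ?_, ?_⟩
  · rw [Language.isUltrahomogeneous_iff_IsExtensionPair Language.Structure.cg_of_countable]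
    exact h.isExtensionPair ho
  · ext N
    rw [Language.age, Set.mem_ofPred_eq, Language.Structure.fg_iff_finite]
    constructor
    · rintro ⟨hfin, ⟨f⟩⟩
      rcases isEmpty_or_nonempty N with hN | hN
      · exact Or.inl hN
      · exact Or.inr (isOrderedBoronTree_of_describes (h.comap f))
    · rintro (hN | hN)
      · have hN' : IsEmpty N := hN
        have hd : Describes N (o.comap isEmptyElim) :=
          ⟨fun x => hN'.elim x, fun x => hN'.elim x, fun x => hN'.elim x, fun x => hN'.elim x⟩
        exact ⟨inferInstance, ⟨hd.embeddingOfComap h _ rfl⟩⟩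
      · obtain ⟨hfin, -, q, hq⟩ := isOrderedBoronTree_iff.1 hN
        obtain ⟨φ, hφ⟩ := ho.exists_comap_eq q
        exact ⟨hfin, ⟨hq.embeddingOfComap h φ hφ⟩⟩

end Describes

/-- The universal ordered boron tree exists. -/
theorem exists_universal : ∃ (M : Type) (_ : L.Structure M), IsUniversalOrderedBoronTree M := by
  obtain ⟨o, ho, hoe⟩ := exists_OBT_hasExtensions
  let := o.toStructure
  exact ⟨Finset Place, o.toStructure, (o.describes ho).isUniversal hoe⟩

/-- The structure `M` is described by `o`, realizes all finite trees and is homogeneous. -/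
structure Generic (M : Type) [L.Structure M] (o : OBT M) : Prop where
  countable : Countable M
  describes : Describes M o
  realize : ∀ {ι : Type} [Finite ι] (q : OBT ι), ∃ φ : ι → M, o.comap φ = q
  homog : ∀ {ι : Type} [Finite ι] (φ ψ : ι → M), o.comap φ = o.comap ψ →
    ∃ g : M ≃[L] M, ∀ i, g (φ i) = ψ i

/-- The families may repeat points. Choosing an index for each point of the range of φ is harmless,
since equal types in a reduced structure force equal values of ψ. -/
theorem Describes.homogeneous (h : Describes M o) (hM : L.IsUltrahomogeneous M) {ι : Type}
    [Finite ι] (φ ψ : ι → M) (hφ : o.comap φ = o.comap ψ) :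
    ∃ g : M ≃[L] M, ∀ i, g (φ i) = ψ i := by
  let S : L.Substructure M := Language.Substructure.closure L (Set.range φ)
  have hS : ∀ x, x ∈ S ↔ ∃ i, φ i = x := fun x =>
    Language.Substructure.mem_closure_iff_of_isRelational L _ _
  have hSd : Describes S (o.comap Subtype.val) := h.comap S.subtype
  choose r hr using fun x : S => (hS x).1 x.2
  obtain ⟨g, hg⟩ := hM S (Language.Substructure.fg_closure (Set.finite_range φ))
    (hSd.embeddingOfComap h (fun x => ψ (r x)) (by
      refine OBT.ext' (fun x y => ?_) (fun x y z => ?_)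
      · refine (OBT.lt_of_eq hφ (r x) (r y)).symm.trans ?_
        simp only [OBT.comap, hr]
      · refine (OBT.T_of_eq hφ (r x) (r y) (r z)).symm.trans ?_
        simp only [OBT.comap, hr]))
  refine ⟨g, fun i => ?_⟩
  have h1 := DFunLike.congr_fun hg ⟨φ i, (hS _).2 ⟨i, rfl⟩⟩
  refine h1.symm.trans ?_
  change ψ (r _) = ψ i
  have h2 := hr ⟨φ i, (hS _).2 ⟨i, rfl⟩⟩
  simp only at h2
  apply h.reduced
  · intro h3
    have h4 := (OBT.lt_of_eq hφ _ i).2 h3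
    simp only [OBT.comap, h2] at h4
    exact o.lt_irrefl _ h4
  · intro h3
    have h4 := (OBT.lt_of_eq hφ i _).2 h3
    simp only [OBT.comap, h2] at h4
    exact o.lt_irrefl _ h4

/-- By uniqueness of the Fraïssé limit, the description of the explicit model can be carried over to
M. -/
theorem IsUniversalOrderedBoronTree.generic (h : IsUniversalOrderedBoronTree M) :
    ∃ o : OBT M, Generic M o := by
  obtain ⟨o', ho', hoe⟩ := exists_OBT_hasExtensions
  let := o'.toStructure
  obtain ⟨hc', h0⟩ := (o'.describes ho').isUniversal hoe
  obtain ⟨hc, hM⟩ := h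
  obtain ⟨e⟩ := hM.nonempty_equiv h0
  have hd : Describes M (o'.comap e) := (o'.describes ho').comap e.toEmbedding
  refine ⟨o'.comap e, hc, hd, ?_, fun φ ψ => hd.homogeneous hM.ultrahomogeneous φ ψ⟩
  intro ι _ q
  obtain ⟨φ, hφ⟩ := hoe.exists_comap_eq q
  refine ⟨fun i => e.symm (φ i), ?_⟩
  rw [← hφ]
  simp [OBT.comap]

/-! ### Automorphisms and amalgamation over orbits -/

namespace OBT

variable {X : Type} {o : OBT X}

/-- The automorphism group. -/
def Aut (o : OBT X) : Subgroup (Equiv.Perm X) where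
  carrier := {g | (∀ x y, o.lt (g x) (g y) ↔ o.lt x y) ∧
    ∀ x y z, o.T (g x) (g y) (g z) ↔ o.T x y z}
  one_mem' := ⟨fun _ _ => Iff.rfl, fun _ _ _ => Iff.rfl⟩
  mul_mem' {g h} hg hh := ⟨fun x y => (hg.1 (h x) (h y)).trans (hh.1 x y),
    fun x y z => (hg.2 (h x) (h y) (h z)).trans (hh.2 x y z)⟩
  inv_mem' {g} hg := ⟨fun x y => by simpa using (hg.1 (g⁻¹ x) (g⁻¹ y)).symm,
    fun x y z => by simpa using (hg.2 (g⁻¹ x) (g⁻¹ y) (g⁻¹ z)).symm⟩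

theorem lt_smul (g : o.Aut) (x y : X) : o.lt (g • x) (g • y) ↔ o.lt x y := g.2.1 x y

theorem T_smul (g : o.Aut) (x y z : X) : o.T (g • x) (g • y) (g • z) ↔ o.T x y z := g.2.2 x y z

theorem comap_smul {ι : Type*} (g : o.Aut) (φ : ι → X) :
    o.comap (fun i => g • φ i) = o.comap φ :=
  ext' (fun _ _ => lt_smul g _ _) (fun _ _ _ => T_smul g _ _ _)

/-- A homogeneous tree in which all finite trees are realized. -/
structure Universal (o : OBT X) : Prop where
  reduced : o.Reduced
  realize : ∀ {ι : Type} [Finite ι] (q : OBT ι), ∃ φ : ι → X, o.comap φ = q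
  homog : ∀ {ι : Type} [Finite ι] (φ ψ : ι → X), o.comap φ = o.comap ψ →
    ∃ g : o.Aut, ∀ i, g • φ i = ψ i

/-- `h` agrees with `g` on `D`. -/
def Agree (D : Finset X) (g h : o.Aut) : Prop := ∀ x ∈ D, h • x = g • x

theorem Agree.mono {D D' : Finset X} {g h : o.Aut} (h' : Agree D' g h) (hD : D ⊆ D') :
    Agree D g h := fun x hx => h' x (hD hx)

theorem Agree.refl (D : Finset X) (g : o.Aut) : Agree D g g := fun _ _ => rfl

theorem Agree.symm {D : Finset X} {g h : o.Aut} (h' : Agree D g h) : Agree D h g :=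
  fun x hx => (h' x hx).symm

theorem Agree.trans {D : Finset X} {g h k : o.Aut} (h1 : Agree D g h) (h2 : Agree D h k) :
    Agree D g k := fun x hx => (h2 x hx).trans (h1 x hx)

/-- The points of the orbits of the points of `B`. -/
def orb (g : o.Aut) (B : Finset X) (p : ℤ × B) : X := (g ^ p.1) • p.2.1

/-- The restriction of `g` to `D` determines the structure of the orbits of the points of `B`, and
every point has a nearest point among these orbits. -/
structure Good (B D : Finset X) (g : o.Aut) : Prop where
  comap_eq : ∀ h, Agree D g h → o.comap (orb h B) = o.comap (orb g B)
  near : ∀ h, Agree D g h → ∀ x, ∃ i, ∀ j, ¬ o.T x (orb h B j) (orb h B i)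

/-- The successor map on the indices of orbits. -/
def shift (B : Finset X) : ℤ × B ≃ ℤ × B := (Equiv.addRight 1).prodCongr (Equiv.refl _)

theorem orb_shift (g : o.Aut) (B : Finset X) (p : ℤ × B) : orb g B (shift B p) = g • orb g B p := by
  change (g ^ (p.1 + 1)) • p.2.1 = g • (g ^ p.1) • p.2.1
  rw [← mul_smul, add_comm, zpow_one_add]

/-- Goodness makes the orbits of B under g1 and g2 isomorphic as families, so two copies of the tree
can be amalgamated over them. Both automorphisms shift the indices in the same way and therefore act
together on the amalgam; a finite part of this action is then realized in the tree by homogeneity.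
-/
theorem Good.amalg (H : o.Universal) {B D : Finset X} {g g1 g2 : o.Aut} (hg : Good B D g)
    (h1 : Agree D g g1) (h2 : Agree D g g2) (D1 D2 : Finset X) :
    ∃ k h : o.Aut, (∀ b ∈ B, k • b = b) ∧ (∀ x ∈ D1, h • x = g1 • x) ∧
      ∀ y ∈ D2, h • (k • y) = k • (g2 • y) := by
  classical
  have hc : o.comap (orb g1 B) = o.comap (orb g2 B) :=
    (hg.comap_eq _ h1).trans (hg.comap_eq _ h2).symm
  let d : AmalgData X X (ℤ × B) :=
    { oB := o, oC := o, u := orb g1 B, v := orb g2 B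
      lt_iff := lt_of_eq hc
      T_iff := T_of_eq hc
      nearC := hg.near _ h2 }
  have hT := AmalgData.amalg_T_map (d := d) (f := (g1 • ·)) (g := (g2 • ·)) (σ := shift B)
    (orb_shift g1 B) (orb_shift g2 B) (T_smul g1) (T_smul g2)
  have hlt := AmalgData.amalg_lt_map (d := d) (f := (g1 • ·)) (g := (g2 • ·)) (σ := shift B)
    (orb_shift g1 B) (orb_shift g2 B) (T_smul g1) (T_smul g2) (lt_smul g1) (lt_smul g2)
  let F1 : Finset X := D1 ∪ D1.image (g1 • ·) ∪ B
  let F2 : Finset X := D2 ∪ D2.image (g2 • ·) ∪ B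
  obtain ⟨φ, hφ⟩ := H.realize (d.amalg.comap (Sum.map Subtype.val Subtype.val : F1 ⊕ F2 → X ⊕ X))
  have hφlt := lt_of_eq hφ
  have hφT := T_of_eq hφ
  -- The automorphism a returns the realized left copy to its original position; k then carries the
  -- right part onto its realized copy.
  obtain ⟨a, ha⟩ := H.homog (fun x : F1 => φ (.inl x)) Subtype.val (ext'
    (fun x y => (hφlt (.inl x) (.inl y)).trans AmalgData.amalgLt_inl)
    (fun x y z => (hφT (.inl x) (.inl y) (.inl z)).trans AmalgData.amalgT_inl))
  obtain ⟨k, hk⟩ := H.homog Subtype.val (fun y : F2 => a • φ (.inr y)) (by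
    rw [comap_smul]
    exact ext' (fun x y => ((hφlt (.inr x) (.inr y)).trans AmalgData.amalgLt_inr).symm)
      (fun x y z => ((hφT (.inr x) (.inr y) (.inr z)).trans AmalgData.amalgT_inr).symm))
  have m1 : ∀ x ∈ D1, x ∈ F1 ∧ g1 • x ∈ F1 := fun x hx =>
    ⟨Finset.mem_union_left _ (Finset.mem_union_left _ hx),
      Finset.mem_union_left _ (Finset.mem_union_right _ (Finset.mem_image_of_mem _ hx))⟩
  have m2 : ∀ x ∈ D2, x ∈ F2 ∧ g2 • x ∈ F2 := fun x hx =>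
    ⟨Finset.mem_union_left _ (Finset.mem_union_left _ hx),
      Finset.mem_union_left _ (Finset.mem_union_right _ (Finset.mem_image_of_mem _ hx))⟩
  let e : D1 ⊕ D2 → F1 ⊕ F2 := Sum.map (fun x => ⟨x.1, (m1 x.1 x.2).1⟩) fun x => ⟨x.1, (m2 x.1 x.2).1⟩
  let e' : D1 ⊕ D2 → F1 ⊕ F2 :=
    Sum.map (fun x => ⟨g1 • x.1, (m1 x.1 x.2).2⟩) fun x => ⟨g2 • x.1, (m2 x.1 x.2).2⟩
  have he : ∀ x, (Sum.map Subtype.val Subtype.val (e' x) : X ⊕ X) =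
      (Sum.map Subtype.val Subtype.val (e x)).map (g1 • ·) (g2 • ·) := by
    rintro (x | x) <;> rfl
  obtain ⟨h, hh⟩ := H.homog (fun x => a • φ (e x)) (fun x => a • φ (e' x)) (by
    rw [comap_smul, comap_smul]
    refine ext' (fun x y => ?_) (fun x y z => ?_)
    · refine (hφlt (e x) (e y)).trans (Iff.trans ?_ (hφlt (e' x) (e' y)).symm)
      simp only [comap, he]
      exact (hlt _ _).symm
    · refine (hφT (e x) (e y) (e z)).trans (Iff.trans ?_ (hφT (e' x) (e' y) (e' z)).symm)
      simp only [comap, he]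
      exact (hT _ _ _).symm)
  refine ⟨k, h, fun b hb => ?_, fun x hx => ?_, fun y hy => ?_⟩
  · have b1 : b ∈ F1 := Finset.mem_union_right _ hb
    have b2 : b ∈ F2 := Finset.mem_union_right _ hb
    have hb' : φ (.inl ⟨b, b1⟩) = φ (.inr ⟨b, b2⟩) := by
      have h3 := AmalgData.not_amalg_lt_of_common (d := d) (0, ⟨b, hb⟩)
      have hu : d.u (0, ⟨b, hb⟩) = b := by simp [d, orb]
      have hv : d.v (0, ⟨b, hb⟩) = b := by simp [d, orb]
      rw [hu, hv] at h3
      apply H.reduced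
      · exact fun h4 => h3.1 ((hφlt _ _).1 h4)
      · exact fun h4 => h3.2 ((hφlt _ _).1 h4)
    have h5 := hk ⟨b, b2⟩
    simp only [← hb', ha ⟨b, b1⟩] at h5
    exact h5
  · have h3 := hh (.inl ⟨x, hx⟩)
    simp only [e, e', Sum.map_inl, ha] at h3
    exact h3
  · have h3 := hh (.inr ⟨y, hy⟩)
    simp only [e, e', Sum.map_inr, ← hk] at h3
    exact h3

end OBT

namespace OBT

variable {X : Type} {o : OBT X}

theorem lt_congr_of_T {x y z : X} (h : o.T x y z) : (o.lt x z ↔ o.lt y z) ∧ (o.lt z x ↔ o.lt z y) :=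
  ⟨⟨o.T_lt _ _ _ h, o.T_lt _ _ _ (o.T_symm _ _ _ h)⟩,
    ⟨o.T_gt _ _ _ h, o.T_gt _ _ _ (o.T_symm _ _ _ h)⟩⟩

theorem T_congr_right {x y z w : X} (h : ¬ o.T x z w) (h' : ¬ o.T x w z) :
    o.T x y z ↔ o.T x y w := by
  have := o.T_split x y z w
  have := o.T_split x y w z
  tauto

/-! ### Creating fixed points -/

/-- If the orbit of `a` branches off deeper and deeper, then `g` can be changed outside a finite
set so that it has a fixed point towards which the orbit goes. -/
theorem exists_fixed_of_deepening (H : o.Universal) (g : o.Aut) (a : X) (P : Finset X)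
    (ha : a ∈ P) (h : o.T (g • a) (g • g • a) a) :
    ∃ (g' : o.Aut) (f : X), Agree P g g' ∧ g' • f = f ∧ o.T f (g' • a) a := by
  classical
  let s : ℕ → X := fun n => (g ^ n) • a
  have s0 : s 0 = a := one_smul _ _
  have s1 : ∀ n, s (n + 1) = g • s n := fun n => by simp only [s, pow_succ', mul_smul]
  have hT : ∀ n, o.T (s (n + 1)) (s (n + 2)) (s n) := by
    intro n
    induction n with
    | zero => simpa only [s1, s0] using h
    | succ n ih =>
      rw [s1 (n + 1), s1 (n + 2), s1 n, T_smul, ← s1]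
      exact ih
  have hlt : ∀ n, (o.lt (s (n + 1)) (s n) ↔ o.lt (s (n + 2)) (s (n + 1))) ∧
      (o.lt (s n) (s (n + 1)) ↔ o.lt (s (n + 1)) (s (n + 2))) := by
    intro n
    have h1 := lt_smul g (s (n + 1)) (s n)
    have h2 := lt_smul g (s n) (s (n + 1))
    rw [← s1 n, ← s1 (n + 1)] at h1 h2
    exact ⟨h1.symm, h2.symm⟩
  -- The points that follow the orbit past all its branchings. Any other point eventually branches
  -- off from consecutive orbit points at the same place.
  let cap : X → Prop := fun x => ∀ n, o.T x (s (n + 1)) (s n)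
  have hcap : ∀ x, cap x ∨ ∃ N, ∀ n ≥ N, o.T (s n) (s (n + 1)) x := by
    intro x
    by_cases hx : cap x
    · exact Or.inl hx
    · right
      simp only [cap, not_forall] at hx
      obtain ⟨N, hN⟩ := hx
      refine ⟨N + 1, fun n hn => ?_⟩
      induction n, hn using Nat.le_induction with
      | base => exact (o.T_split _ _ _ x (hT N)).resolve_right fun h' => hN (o.T_symm _ _ _ h')
      | succ n hn ih => exact o.T_trans (hT n) (o.T_symm _ _ _ ih)
  let Q : Finset X := P ∪ P.image (g • ·)
  -- Beyond this N, the points s N and s (N + 1) stand in the same relations to Q. The bound 1 ≤ N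
  -- is needed so that the fixed point s N meets g • a below a.
  obtain ⟨N, hN⟩ : ∃ N, 1 ≤ N ∧ ∀ x ∈ Q, cap x ∨ o.T (s N) (s (N + 1)) x := by
    have : ∀ᶠ N in Filter.atTop, 1 ≤ N ∧ ∀ x ∈ Q, cap x ∨ o.T (s N) (s (N + 1)) x := by
      refine (Filter.eventually_ge_atTop 1).and ((Filter.eventually_all_finset _).2 fun x _ => ?_)
      rcases hcap x with hx | ⟨N, hx⟩
      · exact Filter.Eventually.of_forall fun _ => Or.inl hx
      · exact (Filter.eventually_ge_atTop N).mono fun n hn => Or.inr (hx n hn)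
    exact this.exists
  obtain ⟨hN1, hN⟩ := hN
  have c1 : ∀ x ∈ Q, (o.lt (s N) x ↔ o.lt (s (N + 1)) x) ∧
      (o.lt x (s N) ↔ o.lt x (s (N + 1))) := by
    intro x hx
    rcases hN x hx with h1 | h1
    · have h2 := lt_congr_of_T (h1 N)
      have h3 := lt_congr_of_T (h1 (N + 1))
      have h4 := hlt N
      tauto
    · exact lt_congr_of_T h1
  have c2 : ∀ x ∈ Q, ∀ y ∈ Q, (o.T (s N) x y ↔ o.T (s (N + 1)) x y) ∧
      (o.T x y (s N) ↔ o.T x y (s (N + 1))) := by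
    intro x hx y hy
    have esc : ∀ x, o.T (s N) (s (N + 1)) x → ∀ y,
        (o.T x y (s N) ↔ o.T x y (s (N + 1))) := by
      intro x hx y
      exact T_congr_right (fun h' => o.T_asymm _ _ _ hx (o.T_symm _ _ _ h'))
        fun h' => o.T_rot hx (o.T_symm _ _ _ h')
    have key : ∀ n, cap x → cap y → o.T x y (s n) := fun n h1 h2 =>
      o.T_of_deeper (o.T_symm _ _ _ (h1 n)) (o.T_symm _ _ _ (h2 n))
    rcases hN x hx with h1 | h1
    · rcases hN y hy with h2 | h2
      · exact ⟨iff_of_false (fun h' => o.T_rot h' (key _ h1 h2))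
          fun h' => o.T_rot h' (key _ h1 h2), iff_of_true (key _ h1 h2) (key _ h1 h2)⟩
      · refine ⟨o.T_iff_below _ h2, ?_⟩
        rw [o.T_comm, esc y h2, o.T_comm]
    · exact ⟨o.T_iff_above _ h1, esc x h1 y⟩
  have mP : ∀ x ∈ P, x ∈ Q := fun x hx => Finset.mem_union_left _ hx
  have mP' : ∀ x ∈ P, g • x ∈ Q := fun x hx =>
    Finset.mem_union_right _ (Finset.mem_image_of_mem _ hx)
  have gT : ∀ x y z, o.T (g • x) (g • y) (g • z) ↔ o.T x y z := T_smul g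
  -- The pattern of s N over P is that of s (N + 1) over g • P, hence that of s N over g • P. So s N
  -- may be fixed while P moves as under g.
  obtain ⟨g', hg'⟩ := H.homog (fun x : Option P => x.elim (s N) Subtype.val)
      (fun x : Option P => x.elim (s N) (fun y => g • y.1)) (by
    refine ext' (fun x y => ?_) (fun x y z => ?_)
    · rcases x with _ | x <;> rcases y with _ | y <;>
        simp only [comap, Option.elim_none, Option.elim_some, lt_smul]
      · rw [(c1 _ (mP' _ y.2)).1, s1, lt_smul]
      · rw [(c1 _ (mP' _ x.2)).2, s1, lt_smul]
    · rcases x with _ | x <;> rcases y with _ | y <;> rcases z with _ | z <;>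
        simp only [comap, Option.elim_none, Option.elim_some, T_smul, T_self, not_T_left, T_irrefl]
      · rw [(c1 _ (mP' _ z.2)).1, (c1 _ (mP' _ z.2)).2, s1, lt_smul, lt_smul]
      · rw [(c2 _ (mP' _ y.2) _ (mP' _ z.2)).1, s1, T_smul]
      · rw [o.T_comm (x := g • x.1), o.T_comm (x := x.1), (c2 _ (mP' _ x.2) _ (mP' _ z.2)).1, s1,
          T_smul]
      · rw [(c2 _ (mP' _ x.2) _ (mP' _ y.2)).2, s1, T_smul])
  have hga : g' • a = s 1 := by
    have := hg' (some ⟨a, ha⟩)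
    simpa only [Option.elim_some, s1, s0] using this
  refine ⟨g', s N, fun x hx => hg' (some ⟨x, hx⟩), hg' none, ?_⟩
  rw [hga, ← s0]
  clear hga hg' c1 c2 hN
  induction N, hN1 using Nat.le_induction with
  | base => exact o.T_self_of (hT 0)
  | succ n hn ih =>
    have key : ∀ n ≥ 1, o.T (s n) (s (n + 1)) (s 0) := by
      intro n hn
      induction n, hn using Nat.le_induction with
      | base => exact hT 0
      | succ n hn ih' => exact o.T_trans (hT n) (o.T_symm _ _ _ ih')
    exact o.T_of_deeper (key n hn) ih

end OBT

namespace OBT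

variable {X : Type} {o : OBT X}

/-- The orbit of `a` goes towards the fixed point `f` or away from it. -/
def Base (g : o.Aut) (f a : X) : Prop := g • f = f ∧ (o.T f a (g • a) ∨ o.T f (g • a) a)

/-- Every point of `B` is fixed or has a base in `B`. -/
def Based (B : Finset X) (g : o.Aut) : Prop := ∀ a ∈ B, g • a = a ∨ ∃ f ∈ B, Base g f a

theorem Base.congr {g h : o.Aut} {f a : X} (hb : Base g f a) (hf : h • f = g • f)
    (ha : h • a = g • a) : Base h f a := by
  unfold Base
  rw [hf, ha]
  exact hb

theorem Based.congr {B : Finset X} {g h : o.Aut} (hb : Based B g) (hg : Agree B g h) :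
    Based B h := by
  intro a ha
  rcases hb a ha with h1 | ⟨f, hf, h1⟩
  · exact Or.inl ((hg a ha).trans h1)
  · exact Or.inr ⟨f, hf, h1.congr (hg f hf) (hg a ha)⟩

/-- The order is preserved, so a, g • a, g • g • a are monotone. The middle point is therefore
grouped with one of its neighbours, and the orbit deepens under g or under its inverse. -/
theorem exists_base (H : o.Universal) (g : o.Aut) (a : X) (P : Finset X) (ha : a ∈ P)
    (hga : g • a ≠ a) : ∃ (g' : o.Aut) (f : X), Agree P g g' ∧ Base g' f a := by
  classical
  have hcases : o.T (g • a) (g • g • a) a ∨ o.T a (g • a) (g • g • a) := by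
    have h1 := lt_smul g a (g • a)
    have h2 := lt_smul g (g • a) a
    rcases (show o.lt a (g • a) ∨ o.lt (g • a) a by
      by_contra! hc
      exact hga (H.reduced _ _ hc.2 hc.1)) with h | h
    · rcases o.T_total _ _ (g • g • a) h with h3 | h3 | h3
      · exact Or.inr h3
      · exact absurd (o.T_lt _ _ _ h3 h) (o.lt_asymm _ _ (h1.2 h))
      · exact Or.inl h3
    · rcases o.T_total _ _ (g • g • a) h with h3 | h3 | h3
      · exact Or.inr (o.T_symm _ _ _ h3)
      · exact Or.inl h3
      · exact absurd (o.T_gt _ _ _ h3 h) (o.lt_asymm _ _ (h2.2 h))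
  rcases hcases with h | h
  · obtain ⟨g', f, h1, h2, h3⟩ := exists_fixed_of_deepening H g a P ha h
    exact ⟨g', f, h1, h2, Or.inr h3⟩
  · obtain ⟨k, f, h1, h2, h3⟩ := exists_fixed_of_deepening H g⁻¹ a (insert a (P.image (g • ·)))
      (Finset.mem_insert_self _ _) (by
        rw [← T_smul g, ← T_smul g, smul_inv_smul, smul_inv_smul, smul_inv_smul]
        exact o.T_symm _ _ _ h)
    refine ⟨k⁻¹, f, fun x hx => ?_, ?_, Or.inl ?_⟩
    · have := h1 (g • x) (Finset.mem_insert_of_mem (Finset.mem_image_of_mem _ hx))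
      rw [inv_smul_smul] at this
      rw [inv_smul_eq_iff, this]
    · rw [inv_smul_eq_iff, h2]
    · rw [← T_smul k, smul_inv_smul, h2]
      exact h3

/-- Each treatment of a moved point adds a fixed base and keeps the map on all earlier points, so
bases already found persist. -/
theorem exists_based (H : o.Universal) (P B : Finset X) (g : o.Aut) :
    ∃ (B' : Finset X) (g' : o.Aut), B ⊆ B' ∧ Agree P g g' ∧ Based B' g' := by
  classical
  induction B using Finset.induction_on with
  | empty => exact ⟨∅, g, subset_rfl, Agree.refl _ _, by simp [Based]⟩
  | insert a B _ ih =>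
    obtain ⟨B', g', hB, hg, hb⟩ := ih
    by_cases ha : g' • a = a
    · refine ⟨insert a B', g', Finset.insert_subset_insert _ hB, hg, fun x hx => ?_⟩
      rcases Finset.mem_insert.1 hx with rfl | hx
      · exact Or.inl ha
      · rcases hb x hx with h | ⟨f, hf, h⟩
        · exact Or.inl h
        · exact Or.inr ⟨f, Finset.mem_insert_of_mem hf, h⟩
    · obtain ⟨k, f, hk, hf⟩ := exists_base H g' a (insert a (P ∪ B')) (Finset.mem_insert_self _ _) ha
      have hkP : P ⊆ insert a (P ∪ B') := fun x hx => by simp [hx]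
      have hkB : B' ⊆ insert a (P ∪ B') := fun x hx => by simp [hx]
      refine ⟨insert f (insert a B'), k, ?_, hg.trans (hk.mono hkP), fun x hx => ?_⟩
      · exact (Finset.insert_subset_insert _ hB).trans (Finset.subset_insert _ _)
      · simp only [Finset.mem_insert] at hx
        rcases hx with rfl | rfl | hx
        · exact Or.inl hf.1
        · exact Or.inr ⟨f, by simp, hf⟩
        · rcases hb.congr (hk.mono hkB) x hx with h | ⟨f', hf', h⟩
          · exact Or.inl h
          · exact Or.inr ⟨f', by simp [hf'], h⟩

theorem zpow_smul_of_fixed {g : o.Aut} {f : X} (hf : g • f = f) (k : ℤ) : g ^ k • f = f := by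
  have : g ∈ MulAction.stabilizer o.Aut f := hf
  exact Subgroup.zpow_mem _ this k

theorem T_zpow_smul {g : o.Aut} {f : X} (hf : g • f = f) (k : ℤ) (x y : X) :
    o.T f (g ^ k • x) (g ^ k • y) ↔ o.T f x y := by
  rw [← T_smul (g ^ k) f x y, zpow_smul_of_fixed hf]

/-- The orbit of a point with a base is strictly monotone, as seen from the base. -/
theorem Base.strict {g : o.Aut} {f a : X} (h : Base g f a) :
    (∀ i j : ℤ, i < j → o.T f (g ^ i • a) (g ^ j • a)) ∨
      ∀ i j : ℤ, i < j → o.T f (g ^ j • a) (g ^ i • a) := by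
  obtain ⟨hf, h | h⟩ := h
  · left
    have key : ∀ i : ℤ, o.T f (g ^ i • a) (g ^ (i + 1) • a) := by
      intro i
      rw [zpow_add_one, mul_smul, T_zpow_smul hf]
      exact h
    intro i j hij
    induction j, hij using Int.leInduction with
    | base => exact key i
    | succ j _ ih => exact o.T_trans ih (key j)
  · right
    have key : ∀ i : ℤ, o.T f (g ^ (i + 1) • a) (g ^ i • a) := by
      intro i
      rw [zpow_add_one, mul_smul, T_zpow_smul hf]
      exact h
    intro i j hij
    induction j, hij using Int.leInduction with
    | base => exact key i
    | succ j _ ih => exact o.T_trans (key j) ih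

theorem Base.eq_of_level {g : o.Aut} {f a : X} (h : Base g f a) {i j : ℤ}
    (h1 : ¬ o.T f (g ^ i • a) (g ^ j • a)) (h2 : ¬ o.T f (g ^ j • a) (g ^ i • a)) : i = j := by
  by_contra hij
  rcases lt_or_gt_of_ne hij with h3 | h3 <;> rcases h.strict with h4 | h4
  · exact h1 (h4 _ _ h3)
  · exact h2 (h4 _ _ h3)
  · exact h2 (h4 _ _ h3)
  · exact h1 (h4 _ _ h3)

/-- Let f be a nearest fixed point of B to x. Orbit points nearer to x than f leave the branch to
the base of their orbit at one common place; orbits being strictly monotone there, each contributes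
at most one. A nearest one among finitely many exists. -/
theorem Based.near {B : Finset X} {g : o.Aut} (hb : Based B g) (hB : B.Nonempty) (x : X) :
    ∃ i, ∀ j, ¬ o.T x (orb g B j) (orb g B i) := by
  classical
  obtain ⟨f, ⟨hfB, hf⟩, hmax⟩ := exists_max (fun y z => o.T x z y) (fun y z => o.T_asymm _ _ _)
    (fun y z w h => (o.T_split _ _ _ _ h).symm) {f : X | f ∈ B ∧ g • f = f}
    (B.finite_toSet.subset fun f hf => hf.1) (by
      obtain ⟨a, ha⟩ := hB
      rcases hb a ha with h | ⟨f, hf, h⟩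
      · exact ⟨a, ha, h⟩
      · exact ⟨f, hf, h.1⟩)
  have hmax' : ∀ f' ∈ B, g • f' = f' → ¬ o.T x f' f := fun f' h1 h2 => hmax f' ⟨h1, h2⟩
  let S : Set (ℤ × B) := {p | o.T x (orb g B p) f}
  have hinj : Set.InjOn Prod.snd S := by
    rintro ⟨k, a⟩ hk ⟨l, b⟩ hl hab
    obtain rfl : a = b := hab
    simp only [S, Set.mem_ofPred_eq, orb] at hk hl
    rcases hb a a.2 with h | ⟨c, hc, h⟩
    · rw [zpow_smul_of_fixed h] at hk
      exact absurd hk (hmax' _ a.2 h)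
    · have h1 := hmax' c hc h.1
      have h2 := (o.T_split _ _ _ c hk).resolve_right h1
      have h3 := (o.T_split _ _ _ c hl).resolve_right h1
      have h4 := o.T_of_deeper h2 h3
      rw [Prod.mk.injEq]
      refine ⟨h.eq_of_level (fun h' => ?_) (fun h' => ?_), rfl⟩
      · exact o.T_asymm _ _ _ h4 (o.T_symm _ _ _ h')
      · exact o.T_rot h4 (o.T_symm _ _ _ h')
  have hfin : S.Finite := Set.Finite.of_finite_image (Set.toFinite _) hinj
  rcases S.eq_empty_or_nonempty with hS | hS
  · refine ⟨(0, ⟨f, hfB⟩), fun j hj => ?_⟩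
    have : j ∈ S := by simpa [S, orb] using hj
    rw [hS] at this
    exact this
  · obtain ⟨m, hm, hmS⟩ := exists_max (fun p q => o.T x (orb g B q) (orb g B p))
      (fun y z => o.T_asymm _ _ _) (fun y z w h => (o.T_split _ _ _ _ h).symm) S hfin hS
    refine ⟨m, fun j hj => ?_⟩
    by_cases hjS : j ∈ S
    · exact hmS j hjS hj
    · exact hjS (o.T_trans hj hm)

end OBT

namespace OBT

variable {X : Type} {o : OBT X}

/-! ### Deciding the structure of orbits by a finite part -/

/-- The first `n` iterates of the points of `B` under `g` and under `h` agree, in both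
directions. -/
def Near (B : Finset X) (n : ℕ) (g h : o.Aut) : Prop :=
  ∀ b ∈ B, ∀ j : ℤ, j.natAbs ≤ n → h ^ j • b = g ^ j • b

namespace Near

variable {B : Finset X} {m n : ℕ} {g h k : o.Aut}

theorem mono (h' : Near B n g h) (hm : m ≤ n) : Near B m g h := fun b hb j hj =>
  h' b hb j (hj.trans hm)

theorem refl (B : Finset X) (n : ℕ) (g : o.Aut) : Near B n g g := fun _ _ _ _ => rfl

theorem trans (h1 : Near B n g h) (h2 : Near B n h k) : Near B n g k := fun b hb j hj =>
  (h2 b hb j hj).trans (h1 b hb j hj)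

theorem agree (h' : Near B n g h) (hn : 1 ≤ n) : Agree B g h := fun b hb => by
  simpa using h' b hb 1 hn

end Near

/-- Near `g0`, the value of `P` is determined on a dense set by a finite restriction. -/
def Determined {α : Type*} (B : Finset X) (g0 : o.Aut) (P : o.Aut → α) : Prop :=
  ∀ n g, 1 ≤ n → Near B 1 g0 g → ∃ n' g', n ≤ n' ∧ Near B n g g' ∧ ∀ h, Near B n' g' h → P h = P g'

/-- Either the condition can be forced by extending the finite part, or it already fails for every
extension. -/
theorem Determined.of_isOpen {B : Finset X} {g0 : o.Aut} {P : o.Aut → Prop}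
    (hP : ∀ g, P g → ∃ n, ∀ h, Near B n g h → P h) : Determined B g0 P := by
  intro n g _ _
  by_cases hg : ∃ h, Near B n g h ∧ P h
  · obtain ⟨h, h1, h2⟩ := hg
    obtain ⟨m, hm⟩ := hP h h2
    exact ⟨max n m, h, le_max_left _ _, h1, fun k hk =>
      propext (iff_of_true (hm k (hk.mono (le_max_right _ _))) h2)⟩
  · push Not at hg
    exact ⟨n, g, le_rfl, Near.refl _ _ _, fun k hk =>
      propext (iff_of_false (hg k hk) (hg g (Near.refl _ _ _)))⟩

theorem Determined.pi {B : Finset X} {g0 : o.Aut} {ι : Type*} [Finite ι] {α : ι → Type*}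
    {P : ∀ i, o.Aut → α i} (hP : ∀ i, Determined B g0 (P i)) :
    Determined B g0 (fun h i => P i h) := by
  classical
  have := Fintype.ofFinite ι
  intro n g hn hg
  suffices ∀ s : Finset ι, ∃ n' g', n ≤ n' ∧ Near B n g g' ∧
      ∀ i ∈ s, ∀ h, Near B n' g' h → P i h = P i g' by
    obtain ⟨n', g', h1, h2, h3⟩ := this Finset.univ
    exact ⟨n', g', h1, h2, fun h hh => funext fun i => h3 i (Finset.mem_univ i) h hh⟩
  intro s
  induction s using Finset.induction_on with
  | empty => exact ⟨n, g, le_rfl, Near.refl _ _ _, by simp⟩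
  | insert i s _ ih =>
    obtain ⟨n1, g1, h1, h2, h3⟩ := ih
    obtain ⟨n2, g2, k1, k2, k3⟩ := hP i n1 g1 (hn.trans h1) (hg.trans (h2.mono hn))
    refine ⟨n2, g2, h1.trans k1, h2.trans (k2.mono h1), fun j hj h hh => ?_⟩
    rcases Finset.mem_insert.1 hj with rfl | hj
    · exact k3 h hh
    · rw [h3 j hj h (k2.trans (hh.mono k1)), h3 j hj g2 k2]

theorem iff_of_jump {Q : ℤ → Prop} (hQ : Monotone Q ∨ Antitone Q) {k : ℤ}
    (hk : ¬ (Q k ↔ Q (k + 1))) (n : ℤ) :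
    (n ≤ k → (Q n ↔ Q k)) ∧ (k + 1 ≤ n → (Q n ↔ Q (k + 1))) := by
  rcases hQ with hQ | hQ
  · have e1 : Q k → Q (k + 1) := hQ (by omega)
    refine ⟨fun hn => ?_, fun hn => ?_⟩
    · have e2 : Q n → Q k := hQ hn
      tauto
    · have e2 : Q (k + 1) → Q n := hQ hn
      tauto
  · have e1 : Q (k + 1) → Q k := hQ (by omega)
    refine ⟨fun hn => ?_, fun hn => ?_⟩
    · have e2 : Q k → Q n := hQ hn
      tauto
    · have e2 : Q n → Q (k + 1) := hQ hn
      tauto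

/-- If a jump can be made to occur, a finite part showing it fixes the whole function. If no
extension can jump, every extension gives a constant function, and the value at 0 is already known.
-/
theorem Determined.of_monotone {B : Finset X} {g0 : o.Aut} {P : o.Aut → ℤ → Prop}
    (hP : ∀ g h k n, Near B n g h → k.natAbs + 1 ≤ n → (P h k ↔ P g k))
    (hm : ∀ h, Near B 1 g0 h → Monotone (P h) ∨ Antitone (P h)) : Determined B g0 P := by
  intro n g hn hg
  by_cases hc : ∃ h k, Near B n g h ∧ ¬ (P h k ↔ P h (k + 1))
  · obtain ⟨h, k, h1, h2⟩ := hc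
    refine ⟨n + k.natAbs + 2, h, by omega, h1, fun f hf => funext fun l => propext ?_⟩
    have h3 := hP h f k _ hf (by omega)
    have h4 := hP h f (k + 1) _ hf (by omega)
    have m1 := hm h (hg.trans (h1.mono hn))
    have m2 := hm f (hg.trans ((h1.mono hn).trans (hf.mono (by omega))))
    have k1 := iff_of_jump m1 h2 l
    have k2 := iff_of_jump m2 (fun h5 => h2 (h3.symm.trans (h5.trans h4))) l
    rcases le_or_gt l k with hl | hl
    · exact (k2.1 hl).trans (h3.trans (k1.1 hl).symm)
    · exact (k2.2 hl).trans (h4.trans (k1.2 hl).symm)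
  · push Not at hc
    refine ⟨n, g, le_rfl, Near.refl _ _ _, fun f hf => funext fun l => propext ?_⟩
    have key : ∀ h, Near B n g h → (P h l ↔ P h 0) := by
      intro h hh
      induction l using Int.induction_on with
      | zero => rfl
      | succ n ih => exact (hc h _ hh).symm.trans ih
      | pred n ih =>
        have h1 := hc h (-(n : ℤ) - 1) hh
        rw [sub_add_cancel] at h1
        exact h1.trans ih
    exact (key f hf).trans ((hP g f 0 n hf (by simpa using hn)).trans (key g (Near.refl _ _ _)).symm)

theorem zpow_sub_smul (g : o.Aut) (i j : ℤ) (a : X) : g ^ i • a = g ^ j • g ^ (i - j) • a := by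
  rw [← mul_smul, ← zpow_add, add_sub_cancel]

/-- The values that determine the structure of the orbits. -/
def orbLt (B : Finset X) (p : B × B) (h : o.Aut) (k : ℤ) : Prop := o.lt (h ^ k • p.1.1) p.2.1

/-- The order between the branches to a fixed point. -/
def orbT (B : Finset X) (p : B × B × B) (h : o.Aut) (k : ℤ) : Prop :=
  h • p.1.1 = p.1.1 ∧ o.T p.1 (h ^ k • p.2.1.1) p.2.2.1

/-- The existence of three points of given orbits which branch off at the same level from the
branch to the base of the first one, and with a given relation. -/
def orbLevel (B : Finset X) (p : B × B × B × B) (h : o.Aut) : Prop :=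
  Base h p.1.1 p.2.1.1 ∧ ∃ i j k : ℤ,
    (¬ o.T p.1 (h ^ i • p.2.1.1) (h ^ j • p.2.2.1.1) ∧
      ¬ o.T p.1 (h ^ j • p.2.2.1.1) (h ^ i • p.2.1.1)) ∧
    (¬ o.T p.1 (h ^ i • p.2.1.1) (h ^ k • p.2.2.2.1) ∧
      ¬ o.T p.1 (h ^ k • p.2.2.2.1) (h ^ i • p.2.1.1)) ∧
    o.T (h ^ i • p.2.1.1) (h ^ j • p.2.2.1.1) (h ^ k • p.2.2.2.1)

/-- Moving the point by one step always goes in the same direction, so its comparison with a given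
point changes monotonically. -/
theorem determined_orbLt (B : Finset X) (g0 : o.Aut) (p : B × B) :
    Determined B g0 (orbLt B p) := by
  refine Determined.of_monotone (fun g h k n hh hk => ?_) fun h _ => ?_
  · simp only [orbLt, hh _ p.1.2 k (by omega)]
  · have key : ∀ k : ℤ, h ^ (k + 1) • p.1.1 = h ^ k • h • p.1.1 := fun k => by
      rw [zpow_add_one, mul_smul]
    by_cases h1 : o.lt p.1.1 (h • p.1.1)
    · right
      refine antitone_int_of_succ_le fun k hk => ?_
      simp only [orbLt, key] at hk ⊢
      exact o.lt_trans ((lt_smul (h ^ k) _ _).2 h1) hk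
    · left
      refine monotone_int_of_le_succ fun k hk => ?_
      simp only [orbLt, key] at hk ⊢
      exact (o.lt_split _ _ (h ^ k • h • p.1.1) hk).resolve_left
        fun h' => h1 ((lt_smul (h ^ k) _ _).1 h')

theorem determined_orbT (B : Finset X) (g0 : o.Aut) (p : B × B × B) :
    Determined B g0 (orbT B p) := by
  refine Determined.of_monotone (fun g h k n hh hk => ?_) fun h _ => ?_
  · simp only [orbT, hh _ p.2.1.2 k (by omega), hh.agree (by omega) _ p.1.2]
  · have key : ∀ k : ℤ, h ^ (k + 1) • p.2.1.1 = h ^ k • h • p.2.1.1 := fun k => by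
      rw [zpow_add_one, mul_smul]
    by_cases h1 : o.T p.1 p.2.1.1 (h • p.2.1.1)
    · right
      refine antitone_int_of_succ_le fun k hk => ?_
      simp only [orbT, key] at hk ⊢
      exact ⟨hk.1, o.T_trans ((T_zpow_smul hk.1 k _ _).2 h1) hk.2⟩
    · left
      refine monotone_int_of_le_succ fun k hk => ?_
      simp only [orbT, key] at hk ⊢
      exact ⟨hk.1, (o.T_split _ _ _ (h ^ k • h • p.2.1.1) hk.2).resolve_left
        fun h' => h1 ((T_zpow_smul hk.1 k _ _).1 h')⟩

theorem determined_orbLevel (B : Finset X) (g0 : o.Aut) (p : B × B × B × B) :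
    Determined B g0 (orbLevel B p) := by
  refine Determined.of_isOpen fun g hg => ?_
  obtain ⟨hb, i, j, k, hg⟩ := hg
  refine ⟨i.natAbs + j.natAbs + k.natAbs + 1, fun h hh =>
    ⟨hb.congr (hh.agree (by omega) _ p.1.2) (hh.agree (by omega) _ p.2.1.2), i, j, k, ?_⟩⟩
  rw [hh _ p.2.1.2 i (by omega), hh _ p.2.2.1.2 j (by omega), hh _ p.2.2.2.2 k (by omega)]
  exact hg

/-- The order and the comparisons seen from fixed points reduce, by a common shift, to functions of
one exponent. They give T for every triple of orbit points except those leaving the branch to the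
base at one place; for these, `orbLevel` decides. -/
theorem orb_congr_of_based {B : Finset X} {g h : o.Aut} (hb : Based B g) (hgh : Agree B g h)
    (h1 : ∀ p, orbLt B p h = orbLt B p g) (h2 : ∀ p, orbT B p h = orbT B p g)
    (h3 : ∀ p, orbLevel B p h ↔ orbLevel B p g) : o.comap (orb h B) = o.comap (orb g B) := by
  have hT : ∀ f ∈ B, g • f = f → ∀ (i j : ℤ) (a b : B),
      o.T f (h ^ i • a.1) (h ^ j • b.1) ↔ o.T f (g ^ i • a.1) (g ^ j • b.1) := by
    intro f hf hgf i j a b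
    have hhf : h • f = f := (hgh f hf).trans hgf
    have := congrFun (h2 (⟨f, hf⟩, a, b)) (i - j)
    simp only [orbT, hgf, hhf, true_and, eq_iff_iff] at this
    rw [zpow_sub_smul h i j, zpow_sub_smul g i j, T_zpow_smul hhf, T_zpow_smul hgf]
    exact this
  refine ext' ?_ ?_
  · rintro ⟨i, a⟩ ⟨j, b⟩
    have := congrFun (h1 (a, b)) (i - j)
    simp only [orbLt, eq_iff_iff] at this
    simp only [comap, orb]
    rw [zpow_sub_smul h i j, zpow_sub_smul g i j, lt_smul, lt_smul]
    exact this
  -- One implication suffices, since the hypotheses are symmetric in g and h.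
  · have half : ∀ g h : o.Aut, Based B g → Agree B g h →
        (∀ f ∈ B, g • f = f → ∀ (i j : ℤ) (a b : B),
          (o.T f (h ^ i • a.1) (h ^ j • b.1) ↔ o.T f (g ^ i • a.1) (g ^ j • b.1))) →
        (∀ p, orbLevel B p h ↔ orbLevel B p g) → ∀ (i j k : ℤ) (a b c : B),
        o.T (h ^ i • a.1) (h ^ j • b.1) (h ^ k • c.1) →
          o.T (g ^ i • a.1) (g ^ j • b.1) (g ^ k • c.1) := by
      intro g h hb hgh hT h3 i j k a b c hx
      rcases hb a a.2 with ha | ⟨f, hf, ha⟩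
      · rw [zpow_smul_of_fixed ha]
        rw [zpow_smul_of_fixed ((hgh a a.2).trans ha)] at hx
        exact (hT a a.2 ha _ _ _ _).1 hx
      · have ha' := ha.congr (hgh f hf) (hgh a a.2)
        have hT' := fun i j a b => hT f hf ha.1 i j a b
        by_cases hc : o.T f (h ^ i • a.1) (h ^ j • b.1) ∨ o.T f (h ^ j • b.1) (h ^ i • a.1) ∨
            o.T f (h ^ j • b.1) (h ^ k • c.1) ∨ o.T f (h ^ k • c.1) (h ^ j • b.1) ∨
            o.T f (h ^ i • a.1) (h ^ k • c.1) ∨ o.T f (h ^ k • c.1) (h ^ i • a.1)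
        · rw [o.T_iff_of_branch hc] at hx
          simp only [hT'] at hx hc
          rwa [o.T_iff_of_branch hc]
        · push Not at hc
          obtain ⟨-, i', j', k', l1, l2, hy⟩ := (h3 (⟨f, hf⟩, a, b, c)).1
            ⟨ha', i, j, k, ⟨hc.1, hc.2.1⟩, ⟨hc.2.2.2.2.1, hc.2.2.2.2.2⟩, hx⟩
          simp only [hT'] at hc
          simp only at l1 l2 hy
          have s := o.T_split f
          have move : ∀ (s : ℤ) (m n : ℤ) (x y : X), o.T f (g ^ (m + s) • x) (g ^ (n + s) • y) ↔
              o.T f (g ^ m • x) (g ^ n • y) := by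
            intro s m n x y
            rw [add_comm m, add_comm n, zpow_add, zpow_add, mul_smul, mul_smul, T_zpow_smul ha.1]
          -- Both triples are level and the orbit of a is strictly monotone from f, so the exponents
          -- can only differ by one common shift. T is invariant under it, which is why an
          -- existential condition is enough.
          have ej : i = i' + (j - j') := by
            have e1 := move (j - j') i' j' a b
            have e2 := move (j - j') j' i' b a
            rw [add_sub_cancel] at e1 e2
            apply ha.eq_of_level <;> grind
          have ek : i = i' + (k - k') := by
            have e1 := move (k - k') i' k' a c
            have e2 := move (k - k') k' i' c a
            rw [add_sub_cancel] at e1 e2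
            apply ha.eq_of_level <;> grind
          rw [← T_smul (g ^ (i - i')), ← mul_smul, ← mul_smul, ← mul_smul, ← zpow_add, ← zpow_add,
            ← zpow_add] at hy
          rw [show i - i' + i' = i by omega, show i - i' + j' = j by omega,
            show i - i' + k' = k by omega] at hy
          exact hy
    rintro ⟨i, a⟩ ⟨j, b⟩ ⟨k, c⟩
    refine ⟨half g h hb hgh hT h3 i j k a b c,
      half h g (hb.congr hgh) hgh.symm ?_ (fun p => (h3 p).symm) i j k a b c⟩
    intro f hf hhf i j a b
    exact (hT f hf (((hgh f hf).symm).trans hhf) i j a b).symm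

/-- Agreement on a segment of the orbits. -/
theorem zpow_smul_eq_of_agree {D : Finset X} {n : ℕ} {g h : o.Aut} {b : X}
    (hD : ∀ j : ℤ, -n ≤ j → j ≤ n → g ^ j • b ∈ D) (hh : Agree D g h) (j : ℤ) (hj : -n ≤ j)
    (hj' : j ≤ n + 1) : h ^ j • b = g ^ j • b := by
  have next : ∀ (g : o.Aut) (j : ℤ), g • g ^ j • b = g ^ (j + 1) • b := fun g j => by
    rw [← mul_smul, ← zpow_one_add, add_comm]
  have pos : ∀ k : ℕ, k ≤ n + 1 → h ^ (k : ℤ) • b = g ^ (k : ℤ) • b := by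
    intro k hk
    induction k with
    | zero => simp
    | succ k ih =>
      have h1 := hh _ (hD k (by omega) (by omega))
      rw [← ih (by omega), next, ih (by omega), next] at h1
      exact_mod_cast h1
  have neg : ∀ k : ℕ, k ≤ n → h ^ (-(k : ℤ)) • b = g ^ (-(k : ℤ)) • b := by
    intro k hk
    induction k with
    | zero => simp
    | succ k ih =>
      have h1 := hh _ (hD (-((k + 1 : ℕ) : ℤ)) (by omega) (by omega))
      rw [next g, show -((k + 1 : ℕ) : ℤ) + 1 = -(k : ℤ) by omega, ← ih (by omega),
        show -(k : ℤ) = -((k + 1 : ℕ) : ℤ) + 1 by omega, ← next h] at h1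
      exact (smul_left_cancel _ h1).symm
  rcases le_or_gt 0 j with h0 | h0
  · lift j to ℕ using h0
    exact pos j (by omega)
  · obtain ⟨k, rfl⟩ : ∃ k : ℕ, j = -(k : ℤ) := ⟨j.natAbs, by omega⟩
    exact neg k (by omega)

/-- Good triples are cofinal. -/
theorem exists_good (H : o.Universal) (D : Finset X) (g : o.Aut) :
    ∃ (B' D' : Finset X) (g' : o.Aut), D ⊆ D' ∧ D' ⊆ B' ∧ (∀ x ∈ D', g' • x ∈ B') ∧
      Agree D g g' ∧ (∃ f ∈ B', g' • f = f) ∧ Good B' D' g' := by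
  classical
  obtain ⟨x⟩ : Nonempty X := by
    -- The one-point structure is realized, so X is nonempty; this keeps B nonempty even if D is
    -- empty.
    obtain ⟨φ, -⟩ := H.realize (ι := Unit) ⟨fun _ _ => False, fun _ _ _ => False, by simp, by simp,
      by simp, by simp, by simp, by simp, by simp, by simp, by simp⟩
    exact ⟨φ ()⟩
  obtain ⟨B, g1, hB, hg1, hb⟩ := exists_based H D (insert x D) g
  obtain ⟨n2, g2, k1, k2, k3⟩ := Determined.pi (fun p => determined_orbLt B g1 p)
    1 g1 le_rfl (Near.refl _ _ _)
  obtain ⟨n3, g3, l1, l2, l3⟩ := Determined.pi (fun p => determined_orbT B g1 p) n2 g2 k1 k2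
  have b3 : Near B 1 g1 g3 := k2.trans (l2.mono k1)
  obtain ⟨n, g', m1, m2, m3⟩ := Determined.pi (fun p => determined_orbLevel B g1 p)
    n3 g3 (k1.trans l1) b3
  have b4 : Near B 1 g1 g' := b3.trans (m2.mono (k1.trans l1))
  have hne : B.Nonempty := ⟨x, hB (Finset.mem_insert_self _ _)⟩
  have hn : 1 ≤ n := k1.trans (l1.trans m1)
  have hb' : Based B g' := hb.congr (b4.agree le_rfl)
  have good : ∀ h, Near B n g' h → o.comap (orb h B) = o.comap (orb g' B) := by
    intro h hh
    have a3 : Near B n3 g3 h := m2.trans (hh.mono m1)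
    have a2 : Near B n2 g2 h := l2.trans (a3.mono l1)
    have e2 : Near B n2 g2 g' := l2.trans (m2.mono l1)
    refine orb_congr_of_based hb' (hh.agree hn) (fun p => ?_) (fun p => ?_) fun p => ?_
    · exact (congrFun (k3 h a2) p).trans (congrFun (k3 g' e2) p).symm
    · exact (congrFun (l3 h a3) p).trans (congrFun (l3 g' m2) p).symm
    · exact iff_of_eq (congrFun (m3 h hh) p)
  -- The domain is the segment up to n and the ambient set is the segment up to n + 1, so that g'
  -- maps the first into the second. Agreement on the domain controls the iterates up to n + 1.
  let seg : ℤ → Finset X := fun m => (Finset.Icc (-(n : ℤ)) m ×ˢ B).image fun p => g' ^ p.1 • p.2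
  have hseg : ∀ m x, x ∈ seg m ↔ ∃ j : ℤ, (-(n : ℤ) ≤ j ∧ j ≤ m) ∧ ∃ b ∈ B, g' ^ j • b = x := by
    intro m x
    simp only [seg, Finset.mem_image, Finset.mem_product, Finset.mem_Icc, Prod.exists]
    constructor
    · rintro ⟨j, b, ⟨hj, hb⟩, rfl⟩
      exact ⟨j, hj, b, hb, rfl⟩
    · rintro ⟨j, hj, b, hb, rfl⟩
      exact ⟨j, b, ⟨hj, hb⟩, rfl⟩
  have hsub : ∀ m ≥ 0, B ⊆ seg m := fun m hm b hb =>
    (hseg _ _).2 ⟨0, ⟨by omega, hm⟩, b, hb, by simp⟩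
  have hagree : ∀ h, Agree (seg n) g' h → ∀ b ∈ B, ∀ j : ℤ, -(n : ℤ) ≤ j → j ≤ n + 1 →
      h ^ j • b = g' ^ j • b := fun h hh b hb =>
    zpow_smul_eq_of_agree (fun j hj hj' => (hseg _ _).2 ⟨j, ⟨hj, hj'⟩, b, hb, rfl⟩) hh
  have hnear : ∀ h, Agree (seg n) g' h → Near B n g' h := fun h hh b hb j hj =>
    hagree h hh b hb j (by omega) (by omega)
  choose! e he e' he' hee using fun x (hx : x ∈ seg (n + 1)) => (hseg (n + 1) x).1 hx
  -- Each point of the segment is an iterate of a point of B, so its orbit is a reindexed orbit of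
  -- B, uniformly for all h agreeing with g'.
  let τ : ℤ × seg (n + 1) → ℤ × B := fun p => (p.1 + e p.2.1, ⟨e' p.2.1, he' _ p.2.2⟩)
  have hτ : ∀ h, Agree (seg n) g' h → ∀ p, orb h (seg (n + 1)) p = orb h B (τ p) := by
    intro h hh p
    simp only [orb, τ]
    rw [zpow_add, mul_smul, hagree h hh _ (he' _ p.2.2) _ (he _ p.2.2).1 (he _ p.2.2).2,
      hee _ p.2.2]
  have hDB : D ⊆ B := (Finset.subset_insert _ _).trans hB
  refine ⟨seg (n + 1), seg n, g', hDB.trans (hsub n (by omega)), ?_, ?_, ?_, ?_, ?_, ?_⟩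
  · intro x hx
    obtain ⟨j, hj, hx⟩ := (hseg _ _).1 hx
    exact (hseg _ _).2 ⟨j, by omega, hx⟩
  · intro x hx
    obtain ⟨j, hj, b, hb, rfl⟩ := (hseg _ _).1 hx
    exact (hseg _ _).2 ⟨j + 1, by omega, b, hb, by rw [add_comm, zpow_one_add, mul_smul]⟩
  · exact hg1.trans ((b4.agree le_rfl).mono hDB)
  · obtain ⟨a, ha⟩ := hne
    rcases hb' a ha with h | ⟨f, hf, h⟩
    · exact ⟨a, hsub _ (by omega) ha, h⟩
    · exact ⟨f, hsub _ (by omega) hf, h.1⟩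
  · intro h hh
    rw [funext (hτ h hh), funext (hτ g' (Agree.refl _ _))]
    exact congrArg (fun q => q.comap τ) (good h (hnear h hh))
  · intro h hh y
    obtain ⟨⟨k, b⟩, hi⟩ := (hb'.congr ((hnear h hh).agree hn)).near hne y
    refine ⟨(k, ⟨b, hsub _ (by omega) b.2⟩), fun j => ?_⟩
    rw [hτ h hh j]
    exact hi _

theorem good_singleton {f : X} {g : o.Aut} (hf : g • f = f) : Good {f} {f} g := by
  have key : ∀ h, Agree {f} g h → ∀ p, orb h {f} p = f := by
    rintro h hh ⟨k, a, ha⟩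
    obtain rfl := Finset.mem_singleton.1 ha
    exact zpow_smul_of_fixed ((hh _ ha).trans hf) k
  refine ⟨fun h hh => ?_, fun h hh x => ⟨(0, ⟨f, by simp⟩), fun j => ?_⟩⟩
  · rw [funext (key h hh), funext (key g (Agree.refl _ _))]
  · rw [key h hh, key h hh]
    exact o.T_irrefl _ _

/-- Any two finite partial automorphisms can be joined. -/
theorem joint (H : o.Universal) (g1 g2 : o.Aut) (D1 D2 : Finset X) :
    ∃ k h : o.Aut, (∀ x ∈ D1, h • x = g1 • x) ∧ ∀ y ∈ D2, h • (k • y) = k • (g2 • y) := by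
  have fixed : ∀ (g : o.Aut) (D : Finset X), ∃ (g' : o.Aut) (f : X), Agree D g g' ∧ g' • f = f := by
    intro g D
    obtain ⟨B, -, g', -, -, -, hg, ⟨f, -, hf⟩, -⟩ := exists_good H D g
    exact ⟨g', f, hg, hf⟩
  obtain ⟨k1, f1, h1, e1⟩ := fixed g1 D1
  obtain ⟨k2, f2, h2, e2⟩ := fixed g2 D2
  obtain ⟨m, hm⟩ := H.homog (fun _ : Unit => f2) (fun _ => f1)
    (ext' (fun _ _ => iff_of_false (o.lt_irrefl _) (o.lt_irrefl _))
      fun _ _ _ => iff_of_false (o.T_irrefl _ _) (o.T_irrefl _ _))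
  classical
  -- After conjugation by m both automorphisms fix f1, and the orbit of a fixed point is trivially
  -- good.
  obtain ⟨k, h, -, i1, i2⟩ := (good_singleton e1).amalg H (Agree.refl _ _)
    (g2 := m * k2 * m⁻¹) (by
      intro x hx
      obtain rfl := Finset.mem_singleton.1 hx
      rw [mul_smul, mul_smul, inv_smul_eq_iff.2 (hm ()).symm, e2, hm (), e1]) D1 (D2.image (m • ·))
  refine ⟨k * m, h, fun x hx => (i1 x hx).trans (h1 x hx), fun y hy => ?_⟩
  have := i2 (m • y) (Finset.mem_image_of_mem _ hy)
  rw [mul_smul, mul_smul, inv_smul_smul, h2 y hy] at this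
  rw [mul_smul, mul_smul, this]

end OBT

variable {M : Type} [L.Structure M] {o : OBT M}

/-! ### Cofinal amalgamation for partial automorphisms -/

/-- An automorphism of the structure preserves its description. -/
def Describes.toAut (h : Describes M o) (e : M ≃[L] M) : o.Aut :=
  ⟨e.toEquiv, h.map_lt h e.toEmbedding, h.map_T h e.toEmbedding⟩

/-- A permutation that preserves the description is an automorphism of the structure. -/
def Describes.ofAut (h : Describes M o) (g : o.Aut) : M ≃[L] M where
  toEquiv := g.1
  map_fun' := (h.embedding h g.1 (OBT.lt_smul g) (OBT.T_smul g)).map_fun'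
  map_rel' := (h.embedding h g.1 (OBT.lt_smul g) (OBT.T_smul g)).map_rel'

theorem Generic.universal (h : Generic M o) : o.Universal where
  reduced := h.describes.reduced
  realize := h.realize
  homog φ ψ hφ := by
    obtain ⟨g, hg⟩ := h.homog φ ψ hφ
    exact ⟨h.describes.toAut g, hg⟩

/-- The map `φ` carries the partial automorphism of `X` to a restriction of `g`. -/
def Realizes (X : PartialAut L) (φ : X.carrier ↪[L] M) (g : o.Aut) : Prop :=
  ∀ x : X.p.dom, g • φ x = φ (X.p.toEquiv x)

/-- Embeddings into the universal tree move by automorphisms. -/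
def Describes.smulEmb (h : Describes M o) (g : o.Aut) {A : Type} [L.Structure A] (φ : A ↪[L] M) :
    A ↪[L] M := (h.ofAut g).toEmbedding.comp φ

theorem Describes.smulEmb_apply (h : Describes M o) (g : o.Aut) {A : Type} [L.Structure A]
    (φ : A ↪[L] M) (x : A) : h.smulEmb g φ x = g • φ x := rfl

theorem Realizes.conj (h : Describes M o) {X : PartialAut L} {φ : X.carrier ↪[L] M} {g : o.Aut}
    (hφ : Realizes X φ g) (a : o.Aut) : Realizes X (h.smulEmb a φ) (a * g * a⁻¹) := by
  intro x
  rw [h.smulEmb_apply, h.smulEmb_apply, mul_smul, mul_smul, inv_smul_smul, hφ x]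

/-- Realize the carrier in the universal tree; homogeneity extends the transported partial
automorphism to an automorphism. -/
theorem exists_realizes (H : o.Universal) (h : Describes M o) (X : PartialAut L)
    (hX : IsOrderedBoronTree X.carrier) :
    ∃ (φ : X.carrier ↪[L] M) (g : o.Aut), Realizes X φ g := by
  obtain ⟨hfin, -, q, hq⟩ := isOrderedBoronTree_iff.1 hX
  obtain ⟨φ, hφ⟩ := H.realize q
  let φ' := hq.embeddingOfComap h φ hφ
  have hd : Describes X.p.dom (q.comap Subtype.val) := hq.comap X.p.dom.subtype
  obtain ⟨g, hg⟩ := H.homog (fun x : X.p.dom => φ' x) (fun x : X.p.dom => φ' (X.p.toEquiv x))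
    ((hd.comap_eq h (φ'.comp X.p.dom.subtype)).trans
      (hd.comap_eq h (φ'.comp X.p.toEmbedding)).symm)
  exact ⟨φ', g, hg⟩

theorem exists_partialAut (h : Describes M o) (B D : Finset M) (g : o.Aut)
    (hgD : ∀ x ∈ D, g • x ∈ B) (hB : B.Nonempty) :
    ∃ (Y : PartialAut L) (ψ : Y.carrier ↪[L] M), IsOrderedBoronTree Y.carrier ∧
      (∀ x, x ∈ B ↔ ∃ a, ψ a = x) ∧ (∀ a, a ∈ Y.p.dom ↔ ψ a ∈ D) ∧ Realizes Y ψ g := by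
  let q : OBT B := o.comap Subtype.val
  let S : L.Structure B := q.toStructure
  have hq : Describes B q := q.describes fun x y h1 h2 => Subtype.ext (h.reduced _ _ h1 h2)
  let ψ : B ↪[L] M := hq.embeddingOfComap h Subtype.val rfl
  let dom : L.Substructure B := Language.Substructure.closure L {x | x.1 ∈ D}
  have hdom : ∀ x, x ∈ dom ↔ x.1 ∈ D := fun x =>
    Language.Substructure.mem_closure_iff_of_isRelational L _ _
  have hd : Describes dom (q.comap Subtype.val) := hq.comap dom.subtype
  let f : dom ↪[L] B := hd.embeddingOfComap hq (fun x => ⟨g • x.1.1, hgD _ ((hdom _).1 x.2)⟩)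
    (OBT.ext' (fun _ _ => OBT.lt_smul g _ _) fun _ _ _ => OBT.T_smul g _ _ _)
  refine ⟨⟨⟨B, S⟩, ⟨dom, f.toHom.range, f.equivRange⟩⟩, ψ, ?_, ?_, hdom, ?_⟩
  · have : Nonempty B := hB.to_subtype
    exact isOrderedBoronTree_of_describes hq
  · exact fun x => ⟨fun hx => ⟨⟨x, hx⟩, rfl⟩, fun ⟨a, ha⟩ => ha ▸ a.2⟩
  · intro x
    rfl

theorem exists_emb (h : Describes M o) {X Y : PartialAut L} {g : o.Aut} {B D : Finset M}
    {ψ : Y.carrier ↪[L] M} (hB : ∀ x, x ∈ B ↔ ∃ a, ψ a = x) (hD : ∀ a, a ∈ Y.p.dom ↔ ψ a ∈ D)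
    (hψ : Realizes Y ψ g) (φ : X.carrier ↪[L] M) (hφB : ∀ x, φ x ∈ B)
    (hφD : ∀ x : X.p.dom, φ x ∈ D) (hφ : Realizes X φ g) :
    ∃ e : X.Emb Y, ∀ x, ψ (e.toEmbedding x) = φ x := by
  choose f hf using fun x => (hB _).1 (hφB x)
  have hX : Describes X.carrier (o.comap φ) := h.comap φ
  have hY : Describes Y.carrier (o.comap ψ) := h.comap ψ
  let e : X.carrier ↪[L] Y.carrier := hX.embeddingOfComap hY f
    (OBT.ext' (fun _ _ => by simp only [OBT.comap, hf]) fun _ _ _ => by simp only [OBT.comap, hf])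
  have he : ∀ x, ψ (e x) = φ x := hf
  have hdom : ∀ x : X.p.dom, e x ∈ Y.p.dom := fun x => by
    rw [hD, he]
    exact hφD x
  refine ⟨⟨e, hdom, fun x => ψ.injective ?_⟩, he⟩
  rw [he, ← hφ x, ← hψ ⟨e x, hdom x⟩, he]

/-- The partial automorphisms that decide the structure of their orbits. -/
def goodAuts (o : OBT M) : Set (PartialAut L) :=
  {X | IsOrderedBoronTree X.carrier ∧ ∃ (φ : X.carrier ↪[L] M) (g : o.Aut) (B D : Finset M),
    (∀ x, x ∈ B ↔ ∃ a, φ a = x) ∧ (∀ a, a ∈ X.p.dom ↔ φ a ∈ D) ∧ D ⊆ B ∧ Realizes X φ g ∧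
      OBT.Good B D g}

/-- A single good member absorbs all partial automorphisms realized by g inside P. This gives
cofinality, and it also returns amalgams to the subclass. -/
theorem exists_goodAut (H : o.Universal) (h : Describes M o) (P : Finset M) (g : o.Aut) :
    ∃ Y ∈ goodAuts o, ∃ ψ : Y.carrier ↪[L] M, ∀ (X : PartialAut L) (φ : X.carrier ↪[L] M),
      (∀ x, φ x ∈ P) → Realizes X φ g → ∃ e : X.Emb Y, ∀ x, ψ (e.toEmbedding x) = φ x := by
  obtain ⟨B, D, g', hPD, hDB, hgD, hg, ⟨f, hf, -⟩, hgood⟩ := OBT.exists_good H P g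
  obtain ⟨Y, ψ, hY, hYB, hYD, hψ⟩ := exists_partialAut h B D g' hgD ⟨f, hf⟩
  refine ⟨Y, ⟨hY, ψ, g', B, D, hYB, hYD, hDB, hψ, hgood⟩, ψ, fun X φ hφ hφg => ?_⟩
  exact exists_emb h hYB hYD hψ φ (fun x => hDB (hPD (hφ x))) (fun x => hPD (hφ x))
    fun x => (hg _ (hφ _)).trans (hφg x)

/-- Both extensions are moved so that they restrict to the given copy of X and are then joined by
`Good.amalg`. As k fixes the whole copy of X, the resulting square commutes. -/
theorem hasAP_goodAuts (H : o.Universal) (h : Describes M o) : HasAP (goodAuts o) := by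
  classical
  rintro X ⟨hX, φ, g, B, D, hB, hD, hDB, hφ, hgood⟩ Y ⟨hY, φY, gY, -, -, -, -, -, hφY, -⟩ Z
    ⟨hZ, φZ, gZ, -, -, -, -, -, hφZ, -⟩ α β
  have hXf : Finite X.carrier := hX.1.finite_nonempty.1
  have hYf : Finite Y.carrier := hY.1.finite_nonempty.1
  have hZf : Finite Z.carrier := hZ.1.finite_nonempty.1
  have move : ∀ (Y : PartialAut L) (φY : Y.carrier ↪[L] M) (gY : o.Aut) (α : X.Emb Y),
      Realizes Y φY gY → ∃ (φ' : Y.carrier ↪[L] M) (g' : o.Aut), Realizes Y φ' g' ∧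
        (∀ x, φ' (α.toEmbedding x) = φ x) ∧ OBT.Agree D g g' := by
    intro Y φY gY α hφY
    obtain ⟨a, ha⟩ := H.homog (fun x => φY (α.toEmbedding x)) φ
      (((h.comap φ).comap_eq h (φY.comp α.toEmbedding)).trans ((h.comap φ).comap_eq h φ).symm)
    have hr := hφY.conj h a
    refine ⟨h.smulEmb a φY, a * gY * a⁻¹, hr, ha, fun x hx => ?_⟩
    obtain ⟨y, rfl⟩ := (hB x).1 (hDB hx)
    have hy : y ∈ X.p.dom := (hD y).2 hx
    have h1 := hr ⟨α.toEmbedding y, α.map_dom ⟨y, hy⟩⟩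
    rw [← α.comm ⟨y, hy⟩] at h1
    have h2 : ∀ x, h.smulEmb a φY (α.toEmbedding x) = φ x := ha
    rw [h2, h2] at h1
    exact h1.trans (hφ ⟨y, hy⟩).symm
  obtain ⟨φ1, g1, r1, e1, a1⟩ := move Y φY gY α hφY
  obtain ⟨φ2, g2, r2, e2, a2⟩ := move Z φZ gZ β hφZ
  have := Fintype.ofFinite Y.carrier
  have := Fintype.ofFinite Z.carrier
  obtain ⟨k, m, hk, hm1, hm2⟩ := hgood.amalg H a1 a2 (Finset.univ.image φ1) (Finset.univ.image φ2)
  have mem1 : ∀ y, φ1 y ∈ Finset.univ.image φ1 := fun y =>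
    Finset.mem_image_of_mem _ (Finset.mem_univ _)
  have mem2 : ∀ y, φ2 y ∈ Finset.univ.image φ2 := fun y =>
    Finset.mem_image_of_mem _ (Finset.mem_univ _)
  obtain ⟨W, hW, ψ, hψ⟩ := exists_goodAut H h
    (Finset.univ.image φ1 ∪ Finset.univ.image (h.smulEmb k φ2)) m
  obtain ⟨γ, hγ⟩ := hψ Y φ1 (fun y => Finset.mem_union_left _ (mem1 y))
    fun y => (hm1 _ (mem1 _)).trans (r1 y)
  obtain ⟨δ, hδ⟩ := hψ Z (h.smulEmb k φ2)
    (fun y => Finset.mem_union_right _ (Finset.mem_image_of_mem _ (Finset.mem_univ _)))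
    fun y => by
      rw [h.smulEmb_apply, hm2 _ (mem2 _), r2 y]
      rfl
  refine ⟨W, hW, γ, δ, fun x => ψ.injective ?_⟩
  rw [hγ, hδ, e1, h.smulEmb_apply, e2, hk _ ((hB _).2 ⟨x, rfl⟩)]

theorem hasCAP (H : o.Universal) (h : Describes M o) : HasCAP (partialAuts SB) := by
  classical
  refine ⟨goodAuts o, fun X hX => hX.1, fun X hX => ?_, hasAP_goodAuts H h⟩
  obtain ⟨φ, g, hφ⟩ := exists_realizes H h X hX
  have hXf : Finite X.carrier := (isOrderedBoronTree_iff.1 hX).1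
  have := Fintype.ofFinite X.carrier
  obtain ⟨Y, hY, ψ, hψ⟩ := exists_goodAut H h (Finset.univ.image φ) g
  obtain ⟨e, -⟩ := hψ X φ (fun x => Finset.mem_image_of_mem _ (Finset.mem_univ _)) hφ
  exact ⟨Y, hY, ⟨e⟩⟩

/-! ### Generic automorphisms and back-and-forth -/

namespace OBT

variable {X : Type} {o : OBT X}

/-- Any two extensions of `g` restricted to `D` can be amalgamated over `B`. -/
def Amalgable (B D : Finset X) (g : o.Aut) : Prop :=
  ∀ g1 g2, Agree D g g1 → Agree D g g2 → ∀ D1 D2 : Finset X, ∃ k h : o.Aut,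
    (∀ b ∈ B, k • b = b) ∧ (∀ x ∈ D1, h • x = g1 • x) ∧ ∀ y ∈ D2, h • (k • y) = k • (g2 • y)

theorem Amalgable.congr {B D : Finset X} {g g' : o.Aut} (h : Amalgable B D g)
    (hg : Agree D g g') : Amalgable B D g' := fun g1 g2 h1 h2 =>
  h g1 g2 (hg.trans h1) (hg.trans h2)

theorem Agree.conj [DecidableEq X] {D : Finset X} {g h : o.Aut} (m : o.Aut) (h' : Agree D g h) :
    Agree (D.image (m • ·)) (m * g * m⁻¹) (m * h * m⁻¹) := by
  intro x hx
  obtain ⟨y, hy, rfl⟩ := Finset.mem_image.1 hx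
  simp only [mul_smul, inv_smul_smul, h' y hy]

theorem Agree.of_conj [DecidableEq X] {D : Finset X} {g h : o.Aut} (m : o.Aut)
    (h' : Agree (D.image (m • ·)) (m * g * m⁻¹) h) : Agree D g (m⁻¹ * h * m) := by
  intro x hx
  have := h' (m • x) (Finset.mem_image_of_mem _ hx)
  simp only [mul_smul, inv_smul_smul] at this ⊢
  rw [this, inv_smul_smul]

theorem Amalgable.conj [DecidableEq X] {B D : Finset X} {g : o.Aut} (h : Amalgable B D g)
    (m : o.Aut) : Amalgable (B.image (m • ·)) (D.image (m • ·)) (m * g * m⁻¹) := by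
  intro g1 g2 h1 h2 D1 D2
  obtain ⟨k, f, hk, hf1, hf2⟩ := h _ _ h1.of_conj h2.of_conj (D1.image (m⁻¹ • ·))
    (D2.image (m⁻¹ • ·))
  refine ⟨m * k * m⁻¹, m * f * m⁻¹, ?_, ?_, ?_⟩
  · intro x hx
    obtain ⟨y, hy, rfl⟩ := Finset.mem_image.1 hx
    simp only [mul_smul, inv_smul_smul, hk y hy]
  · intro x hx
    have := hf1 _ (Finset.mem_image_of_mem _ hx)
    simp only [mul_smul, smul_inv_smul] at this ⊢
    rw [this, smul_inv_smul]
  · intro x hx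
    have := hf2 _ (Finset.mem_image_of_mem _ hx)
    simp only [mul_smul, smul_inv_smul] at this ⊢
    rw [inv_smul_smul, this]

/-- Cofinally many restrictions of `g` can be amalgamated. -/
def CofinalAmalgable (g : o.Aut) (P : Finset X) : Prop :=
  ∃ B D, P ⊆ D ∧ D ⊆ B ∧ (∀ x ∈ D, g • x ∈ B) ∧ Amalgable B D g

/-- The partial map `Q` occurs in `g` over `B`, whenever it can be amalgamated with `g`. -/
def Occurs (g : o.Aut) (p : Finset X × Finset X × Finset (X × X)) : Prop :=
  (Amalgable p.1 p.2.1 g ∧ ∃ g2, Agree p.2.1 g g2 ∧ ∀ q ∈ p.2.2, g2 • q.1 = q.2) →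
    ∃ k : o.Aut, (∀ b ∈ p.1, k • b = b) ∧ ∀ q ∈ p.2.2, g • (k • q.1) = k • q.2

/-- The automorphism `g` is generic. -/
structure IsGenericAut (g : o.Aut) : Prop where
  cofinal : ∀ P, CofinalAmalgable g P
  occurs : ∀ p, Occurs g p

theorem cofinalAmalgable_isOpen {g : o.Aut} {P : Finset X} (h : CofinalAmalgable g P) :
    ∃ D, ∀ h, Agree D g h → CofinalAmalgable h P := by
  obtain ⟨B, D, h1, h2, h3, h4⟩ := h
  exact ⟨D, fun h hh => ⟨B, D, h1, h2, fun x hx => by rw [hh x hx]; exact h3 x hx, h4.congr hh⟩⟩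

theorem cofinalAmalgable_dense (H : o.Universal) (g : o.Aut) (D P : Finset X) :
    ∃ h, Agree D g h ∧ CofinalAmalgable h P := by
  classical
  obtain ⟨B', D', g', h1, h2, h3, h4, -, h5⟩ := exists_good H (D ∪ P) g
  exact ⟨g', h4.mono Finset.subset_union_left, B', D', Finset.subset_union_right.trans h1, h2, h3,
    fun g1 g2 k1 k2 D1 D2 => h5.amalg H k1 k2 D1 D2⟩

/-- Both the conclusion and the failure of the premise depend on finitely many values only. -/
theorem occurs_isOpen {g : o.Aut} {p : Finset X × Finset X × Finset (X × X)} (h : Occurs g p) :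
    ∃ D, ∀ h, Agree D g h → Occurs h p := by
  classical
  by_cases hp : Amalgable p.1 p.2.1 g ∧ ∃ g2, Agree p.2.1 g g2 ∧ ∀ q ∈ p.2.2, g2 • q.1 = q.2
  · obtain ⟨k, h1, h2⟩ := h hp
    refine ⟨p.2.2.image (fun q => k • q.1), fun h hh _ => ⟨k, h1, fun q hq => ?_⟩⟩
    rw [hh _ (Finset.mem_image_of_mem _ hq), h2 q hq]
  · refine ⟨p.2.1, fun h hh hp' => absurd ?_ hp⟩
    obtain ⟨h1, g2, h2, h3⟩ := hp'
    exact ⟨h1.congr hh.symm, g2, hh.trans h2, h3⟩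

/-- The premise is exactly what lets the given finite part of g and the partial map be realized
together over B. -/
theorem occurs_dense (g : o.Aut) (D : Finset X) (p : Finset X × Finset X × Finset (X × X)) :
    ∃ h, Agree D g h ∧ Occurs h p := by
  classical
  by_cases hp : Amalgable p.1 p.2.1 g ∧ ∃ g2, Agree p.2.1 g g2 ∧ ∀ q ∈ p.2.2, g2 • q.1 = q.2
  · obtain ⟨h1, g2, h2, h3⟩ := hp
    obtain ⟨k, h, hk, k1, k2⟩ := h1 g g2 (Agree.refl _ _) h2 D (p.2.2.image Prod.fst)
    refine ⟨h, k1, fun _ => ⟨k, hk, fun q hq => ?_⟩⟩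
    rw [k2 _ (Finset.mem_image_of_mem _ hq), h3 q hq]
  · exact ⟨g, Agree.refl _ _, fun h => absurd h hp⟩

namespace IsGenericAut

variable {g g' : o.Aut}

theorem conj (hg : IsGenericAut g) (m : o.Aut) : IsGenericAut (m * g * m⁻¹) := by
  classical
  have hinv : m⁻¹ * (m * g * m⁻¹) * m = g := by group
  constructor
  · intro P
    obtain ⟨B, D, h1, h2, h3, h4⟩ := hg.cofinal (P.image (m⁻¹ • ·))
    refine ⟨_, _, fun x hx => ?_, Finset.image_subset_image h2, fun x hx => ?_, h4.conj m⟩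
    · exact Finset.mem_image.2 ⟨m⁻¹ • x, h1 (Finset.mem_image_of_mem _ hx), smul_inv_smul _ _⟩
    · obtain ⟨y, hy, rfl⟩ := Finset.mem_image.1 hx
      refine Finset.mem_image.2 ⟨g • y, h3 y hy, ?_⟩
      simp only [mul_smul, inv_smul_smul]
  · rintro ⟨B, D, Q⟩ ⟨h1, g2, h2, h3⟩
    simp only at h1 h2 h3
    have a1 := h1.conj m⁻¹
    have a2 := h2.conj m⁻¹
    rw [inv_inv, hinv] at a1 a2
    obtain ⟨k, k1, k2⟩ := hg.occurs ⟨B.image (m⁻¹ • ·), D.image (m⁻¹ • ·),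
      Q.image (fun q => (m⁻¹ • q.1, m⁻¹ • q.2))⟩ ⟨a1, _, a2, by
        intro q hq
        obtain ⟨q, hq', rfl⟩ := Finset.mem_image.1 hq
        simp only [mul_smul, smul_inv_smul, h3 q hq']⟩
    refine ⟨m * k * m⁻¹, fun b hb => ?_, fun q hq => ?_⟩
    · have := k1 _ (Finset.mem_image_of_mem _ hb)
      simp only [mul_smul] at this ⊢
      rw [this, smul_inv_smul]
    · have := k2 _ (Finset.mem_image_of_mem _ hq)
      simp only [mul_smul, inv_smul_smul] at this ⊢
      rw [this]

/-- Extension of a partial conjugacy. -/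
theorem extend (hg : IsGenericAut g) (hg' : IsGenericAut g') {B D : Finset X}
    (h : Amalgable B D g) (hD : Agree D g g') (P : Finset X) :
    ∃ (m : o.Aut) (B1 D1 : Finset X), P ⊆ D1 ∧ D1 ⊆ B1 ∧ (∀ x ∈ D1, g • x ∈ B1) ∧
      Amalgable B1 D1 g ∧ (∀ b ∈ B, m • b = b) ∧ Agree D1 g (m⁻¹ * g' * m) := by
  classical
  obtain ⟨B1, D1, h1, h2, h3, h4⟩ := hg.cofinal P
  obtain ⟨m, k1, k2⟩ := hg'.occurs ⟨B, D, D1.image (fun x => (x, g • x))⟩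
    ⟨h.congr hD, g, hD.symm, by
      intro q hq
      obtain ⟨x, _, rfl⟩ := Finset.mem_image.1 hq
      rfl⟩
  refine ⟨m, B1, D1, h1, h2, h3, h4, k1, fun x hx => ?_⟩
  rw [mul_smul, mul_smul, inv_smul_eq_iff]
  exact k2 _ (Finset.mem_image_of_mem _ hx)

end IsGenericAut

/-- A finite part of a conjugacy between `g` and `g'`. -/
structure PartialConj (g g' : o.Aut) where
  k : o.Aut
  B : Finset X
  D : Finset X
  sub : D ⊆ B
  map_sub : ∀ x ∈ D, g • x ∈ B
  amalgable : Amalgable B D g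
  agree : Agree D g (k⁻¹ * g' * k)

variable {g g' : o.Aut}

/-- One extension with g leading puts x into the domain; a second one, with the conjugate of g'
leading, puts x into the range. Values on the old B are unchanged. -/
theorem PartialConj.exists_extend (hg : IsGenericAut g) (hg' : IsGenericAut g')
    (s : PartialConj g g') (x : X) : ∃ t : PartialConj g g', s.B ⊆ t.D ∧
      (∀ b ∈ s.B, t.k • b = s.k • b) ∧ x ∈ t.D ∧ ∃ y ∈ t.D, t.k • y = x := by
  classical
  have conj : ∀ m : o.Aut, IsGenericAut (m⁻¹ * g' * m) := fun m => by
    simpa using hg'.conj m⁻¹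
  obtain ⟨m, B1, D1, h1, h2, h3, h4, h5, h6⟩ := hg.extend (conj s.k) s.amalgable s.agree
    (insert x s.B)
  let k1 := s.k * m
  have e1 : m⁻¹ * (s.k⁻¹ * g' * s.k) * m = k1⁻¹ * g' * k1 := by simp only [k1]; group
  rw [e1] at h6
  obtain ⟨n, B2, D2, i1, i2, i3, i4, i5, i6⟩ := (conj k1).extend hg (h4.congr h6) h6.symm
    (insert (k1⁻¹ • x) B1)
  have fix : ∀ b ∈ B1, b ∈ D2.image (n • ·) := fun b hb =>
    Finset.mem_image.2 ⟨b, i1 (Finset.mem_insert_of_mem hb), i5 b hb⟩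
  have ag : Agree (D2.image (n • ·)) (n * (k1⁻¹ * g' * k1) * n⁻¹) g := by
    have := i6.conj n
    rwa [show n * (n⁻¹ * g * n) * n⁻¹ = g by group] at this
  refine ⟨⟨k1 * n⁻¹, B2.image (n • ·), D2.image (n • ·), Finset.image_subset_image i2, ?_, ?_, ?_⟩,
    ?_, ?_, ?_, ?_⟩
  · intro y hy
    rw [ag y hy]
    obtain ⟨z, hz, rfl⟩ := Finset.mem_image.1 hy
    refine Finset.mem_image.2 ⟨_, i3 z hz, ?_⟩
    simp only [mul_smul, inv_smul_smul]
  · exact (i4.conj n).congr ag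
  · have := ag.symm
    rwa [show n * (k1⁻¹ * g' * k1) * n⁻¹ = (k1 * n⁻¹)⁻¹ * g' * (k1 * n⁻¹) by group] at this
  · exact fun b hb => fix b (h2 (h1 (Finset.mem_insert_of_mem hb)))
  · intro b hb
    have hb1 : b ∈ B1 := h2 (h1 (Finset.mem_insert_of_mem hb))
    simp only [k1]
    rw [mul_smul, inv_smul_eq_iff.2 (i5 b hb1).symm, mul_smul, h5 b hb]
  · exact fix x (h2 (h1 (Finset.mem_insert_self _ _)))
  · refine ⟨n • k1⁻¹ • x, Finset.mem_image_of_mem _ (i1 (Finset.mem_insert_self _ _)), ?_⟩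
    rw [mul_smul, inv_smul_smul, smul_inv_smul]

/-- Any two generic automorphisms are conjugate. -/
theorem IsGenericAut.isConj [Countable X] (H : o.Universal) (hg : IsGenericAut g)
    (hg' : IsGenericAut g') : ∃ h : o.Aut, g' = h * g * h⁻¹ := by
  classical
  -- The empty conjugacy is amalgamable by joint embedding; no compatibility between g and g' is
  -- needed.
  have start : PartialConj g g' := ⟨1, ∅, ∅, subset_rfl, by simp, fun g1 g2 _ _ D1 D2 => by
    obtain ⟨k, h, h1, h2⟩ := joint H g1 g2 D1 D2
    exact ⟨k, h, by simp, h1, h2⟩, fun x hx => absurd hx (Finset.notMem_empty x)⟩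
  choose next n1 n2 n3 n4 using PartialConj.exists_extend hg hg'
  rcases isEmpty_or_nonempty X with hX | hX
  · exact ⟨1, Subtype.ext (Equiv.ext fun x => hX.elim x)⟩
  obtain ⟨e, he⟩ := exists_surjective_nat X
  let s : ℕ → PartialConj g g' := fun n => Nat.rec start (fun n s => next s (e n)) n
  have s1 : ∀ n, s (n + 1) = next (s n) (e n) := fun n => rfl
  have mono : ∀ m n, m ≤ n → (s m).B ⊆ (s n).B ∧ ∀ b ∈ (s m).B, (s n).k • b = (s m).k • b := by
    intro m n hmn
    induction n, hmn using Nat.le_induction with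
    | base => exact ⟨subset_rfl, fun _ _ => rfl⟩
    | succ n _ ih =>
      rw [s1]
      exact ⟨ih.1.trans ((n1 _ _).trans (next _ _).sub),
        fun b hb => (n2 _ _ b (ih.1 hb)).trans (ih.2 b hb)⟩
  have hmem : ∀ x, ∃ n, x ∈ (s n).D ∧ ∃ y ∈ (s n).D, (s n).k • y = x := by
    intro x
    obtain ⟨n, rfl⟩ := he x
    exact ⟨n + 1, n3 _ _, n4 _ _⟩
  choose i hi j hj hji using hmem
  let F : X → X := fun x => (s (i x)).k • x
  have hF : ∀ x n, x ∈ (s n).B → F x = (s n).k • x := by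
    intro x n hn
    rcases le_total (i x) n with h | h
    · exact ((mono _ _ h).2 x ((s (i x)).sub (hi x))).symm
    · exact (mono _ _ h).2 x hn
  have hFm : ∀ x n, i x ≤ n → F x = (s n).k • x := fun x n hn =>
    hF x n ((mono _ _ hn).1 ((s (i x)).sub (hi x)))
  have hbij : Function.Bijective F := by
    constructor
    · intro x y hxy
      rw [hFm x _ (le_max_left (i x) (i y)), hFm y _ (le_max_right (i x) (i y))] at hxy
      exact smul_left_cancel _ hxy
    · intro x
      exact ⟨j x, (hF _ _ ((s (i x)).sub (hj x))).trans (hji x)⟩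
  let h : o.Aut := ⟨Equiv.ofBijective F hbij, by
    constructor
    · intro x y
      change o.lt (F x) (F y) ↔ _
      rw [hFm x _ (le_max_left (i x) (i y)), hFm y _ (le_max_right (i x) (i y)), lt_smul]
    · intro x y z
      change o.T (F x) (F y) (F z) ↔ _
      rw [hFm x (i x + i y + i z) (by omega), hFm y (i x + i y + i z) (by omega),
        hFm z (i x + i y + i z) (by omega), T_smul]⟩
  have hh : ∀ x, h • x = F x := fun _ => rfl
  refine ⟨h, eq_mul_inv_of_mul_eq (Subtype.ext (Equiv.ext fun x => ?_))⟩
  change g' • h • x = h • g • x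
  rw [hh, hh, hF x _ ((s (i x)).sub (hi x)), hF _ _ ((s (i x)).map_sub x (hi x)),
    ← (s (i x)).agree x (hi x), mul_smul, mul_smul, smul_inv_smul]

end OBT

variable {M : Type} [L.Structure M] {o : OBT M}

/-! ### Topology of the automorphism group -/

theorem isOpen_autTopology_iff {U : Set (M ≃[L] M)} :
    @IsOpen _ (autTopology L M) U ↔ ∀ g ∈ U, ∃ D : Finset M, ∀ h : M ≃[L] M,
      (∀ x ∈ D, h x = g x) → h ∈ U := by
  let : TopologicalSpace M := ⊥
  have : DiscreteTopology M := ⟨rfl⟩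
  let := autTopology L M
  constructor
  · intro hU g hg
    obtain ⟨V, hV, rfl⟩ := isOpen_induced_iff.1 hU
    obtain ⟨D, u, h1, h2⟩ := isOpen_pi_iff.1 hV _ hg
    refine ⟨D, fun h hh => h2 fun x hx => ?_⟩
    change h x ∈ u x
    rw [hh x hx]
    exact (h1 x hx).2
  · intro hU
    choose! D hD using hU
    refine isOpen_induced_iff.2 ⟨⋃ g ∈ U, Set.pi (D g : Set M) fun x => {g x}, ?_, ?_⟩
    · exact isOpen_biUnion fun g _ => isOpen_set_pi (D g).finite_toSet fun x _ => isOpen_discrete _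
    · ext h
      simp only [Set.mem_preimage, Set.mem_iUnion, Set.mem_pi, Set.mem_singleton_iff, exists_prop]
      exact ⟨fun ⟨g, hg, hh⟩ => hD g hg h hh, fun hh => ⟨h, hh, fun _ _ => rfl⟩⟩

/-- The automorphism group of a countable structure is a Baire space. -/
theorem baireSpace_aut [Countable M] (h : Describes M o) :
    @BaireSpace (M ≃[L] M) (autTopology L M) := by
  let : TopologicalSpace M := ⊥
  have : DiscreteTopology M := ⟨rfl⟩
  let := autTopology L M
  have hopen : ∀ (y : M), Continuous fun g : M ≃[L] M => g.symm y := by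
    intro y
    refine continuous_discrete_rng.2 fun x => isOpen_autTopology_iff.2 fun g hg => ⟨{x}, fun h hh => ?_⟩
    have h1 : g.symm y = x := hg
    have h2 : h x = g x := hh x (Finset.mem_singleton_self _)
    have h3 : y = h x := by rw [h2, ← h1, g.apply_symm_apply]
    change h.symm y = x
    rw [h3, h.symm_apply_apply]
  -- Pairing with the inverse makes the image closed: a pointwise limit of permutations alone need
  -- not be surjective.
  let F : (M ≃[L] M) → (M → M) × (M → M) := fun g => (g, g.symm)
  have hF : Topology.IsClosedEmbedding F := by
    have hc : Continuous F := by
      refine Continuous.prodMk ?_ (continuous_pi hopen)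
      exact continuous_induced_dom
    refine ⟨⟨Topology.IsInducing.of_comp hc continuous_fst ⟨rfl⟩, fun g h hgh => ?_⟩, ?_⟩
    · exact DFunLike.coe_injective (congrArg Prod.fst hgh)
    · have hr : Set.range F = ⋂ (x : M) (y : M) (z : M),
          {p | (p.1 x = y → p.2 y = x) ∧ (p.2 x = y → p.1 y = x) ∧
            (o.lt (p.1 x) (p.1 y) ↔ o.lt x y) ∧ (o.T (p.1 x) (p.1 y) (p.1 z) ↔ o.T x y z)} := by
        ext ⟨a, b⟩
        simp only [Set.mem_iInter, Set.mem_range]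
        constructor
        · rintro ⟨g, hg⟩ x y z
          obtain ⟨rfl, rfl⟩ := Prod.mk.inj hg
          refine ⟨?_, ?_, OBT.lt_smul (h.toAut g) x y, OBT.T_smul (h.toAut g) x y z⟩
          · rintro rfl; exact g.symm_apply_apply x
          · rintro rfl; exact g.apply_symm_apply x
        · intro hab
          have k1 : ∀ x, b (a x) = x := fun x => (hab x _ x).1 rfl
          have k2 : ∀ x, a (b x) = x := fun x => (hab x _ x).2.1 rfl
          exact ⟨h.ofAut ⟨⟨a, b, k1, k2⟩, fun x y => (hab x y x).2.2.1,
            fun x y z => (hab x y z).2.2.2⟩, rfl⟩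
      rw [hr]
      refine isClosed_iInter fun x => isClosed_iInter fun y => isClosed_iInter fun z => ?_
      have hcont : Continuous fun p : (M → M) × (M → M) =>
          (p.1 x, p.1 y, p.1 z, p.2 x, p.2 y) := by fun_prop
      exact (isClosed_discrete {q : M × M × M × M × M | (q.1 = y → q.2.2.2.2 = x) ∧
        (q.2.2.2.1 = y → q.2.1 = x) ∧ (o.lt q.1 q.2.1 ↔ o.lt x y) ∧
        (o.T q.1 q.2.1 q.2.2.1 ↔ o.T x y z)}).preimage hcont
  have := hF.IsCompletelyMetrizableSpace
  let := TopologicalSpace.upgradeIsCompletelyMetrizable (M ≃[L] M)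
  infer_instance

/-- Genericity is a countable intersection of open dense conditions. The Baire property provides one
generic automorphism, and its conjugacy class contains all the others. -/
theorem hasComeager (h : Generic M o) : HasComeagerConjugacyClass L M := by
  have := h.countable
  have H := h.universal
  let t := autTopology L M
  have hd := h.describes
  have key : ∀ P : o.Aut → Prop, (∀ g, P g → ∃ D, ∀ h, OBT.Agree D g h → P h) →
      (∀ g D, ∃ h, OBT.Agree D g h ∧ P h) → {f : M ≃[L] M | P (hd.toAut f)} ∈ residual (M ≃[L] M) := by
    intro P h1 h2
    refine residual_of_dense_open ?_ ?_
    · refine isOpen_autTopology_iff.2 fun g hg => ?_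
      obtain ⟨D, hD⟩ := h1 _ hg
      exact ⟨D, fun f hf => hD _ hf⟩
    · rw [dense_iff_inter_open]
      rintro U hU ⟨g, hg⟩
      obtain ⟨D, hD⟩ := isOpen_autTopology_iff.1 hU g hg
      obtain ⟨f, hf, hP⟩ := h2 (hd.toAut g) D
      exact ⟨hd.ofAut f, hD _ hf, hP⟩
  have hgen : {f : M ≃[L] M | OBT.IsGenericAut (hd.toAut f)} ∈ residual (M ≃[L] M) := by
    have h1 := (countable_iInter_mem (ι := Finset M)).2 fun P =>
      key (fun g => OBT.CofinalAmalgable g P) (fun g => OBT.cofinalAmalgable_isOpen)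
        fun g D => OBT.cofinalAmalgable_dense H g D P
    have h2 := (countable_iInter_mem (ι := Finset M × Finset M × Finset (M × M))).2 fun p =>
      key (fun g => OBT.Occurs g p) (fun g => OBT.occurs_isOpen)
        fun g D => OBT.occurs_dense g D p
    filter_upwards [h1, h2] with f h1 h2
    exact ⟨fun P => Set.mem_iInter.1 h1 P, fun p => Set.mem_iInter.1 h2 p⟩
  have := baireSpace_aut hd
  have : Nonempty (M ≃[L] M) := ⟨Language.Equiv.refl L M⟩
  obtain ⟨g, hg⟩ := (dense_of_mem_residual hgen).nonempty
  refine ⟨g, Filter.mem_of_superset hgen fun f hf => ?_⟩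
  obtain ⟨k, hk⟩ := OBT.IsGenericAut.isConj H hg hf
  refine ⟨hd.ofAut k, ?_⟩
  ext x
  exact congrArg (fun a : o.Aut => a • x) hk

end OrderedBoron

theorem mainTheorem2 :
    OrderedBoron.HasCAP (OrderedBoron.partialAuts OrderedBoron.SB) ∧
    (∃ (M : Type) (_ : OrderedBoron.L.Structure M), OrderedBoron.IsUniversalOrderedBoronTree M) ∧
    (∀ (M : Type) [OrderedBoron.L.Structure M], OrderedBoron.IsUniversalOrderedBoronTree M →
      OrderedBoron.HasComeagerConjugacyClass OrderedBoron.L M) := by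
  refine ⟨?_, OrderedBoron.exists_universal, fun M _ hM => ?_⟩
  -- CAP does not mention a limit; any universal tree serves as an ambient space in which partial
  -- automorphisms are restrictions of automorphisms.
  · obtain ⟨M, _, hM⟩ := OrderedBoron.exists_universal
    obtain ⟨o, h⟩ := hM.generic
    exact OrderedBoron.hasCAP h.universal h.describes
  · obtain ⟨o, h⟩ := hM.generic
    exact OrderedBoron.hasComeager h
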